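/- **Setting.** Let $dA$ be Lebesgue measure on $\mathbb C$, $D(z,r)$ the open disk with centre $z$ and radius $r$. A weight is a non-negative, locally integrable function $w$ on $\mathbb C$ that does not vanish almost everywhere; write $w(E)=\int_E w\,dA$. For $1<p<\infty$ with $1/p+1/p'=1$, $w\in A_p^{\mathrm{restricted}}$ means that for some $r>0$ $$\sup_{Q:\ell(Q)=r}\Big(\frac1{A(Q)}\int_Q w\,dA\Big)\Big(\frac1{A(Q)}\int_Q w^{-p'/p}\,dA\Big)^{p/p'}<\infty,$$ and $w\in A_1^{\mathrm{restricted}}$ means that for some $r>0$, $\sup_{Q:\ell(Q)=r}\big(\frac1{A(Q)}\int_Q w\,dA\big)\|w^{-1}\|_{L^\infty(Q)}<\infty$, where $Q$ runs over the squares with sides parallel to the axes and side length $\ell(Q)=r$. Put $A_\infty^{\mathrm{restricted}}=\bigcup_{1\le p<\infty}A_p^{\mathrm{restricted}}$. Let $\alpha>0$ and $w\in A_\infty^{\mathrm{restricted}}$. $F^2_{\alpha,w}$ is the space of entire functions $f$ with $\|f\|^2=\int_{\mathbb C}|f(z)|^2e^{-\alpha|z|^2}w(z)\,dA(z)<\infty$,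 with the corresponding inner product. $B^w_z$ is its reproducing kernel at $z$, so $f(z)=\langle f,B^w_z\rangle$ for $f\in F^2_{\alpha,w}$, and $b^w_z=B^w_z/\|B^w_z\|$. For a positive Borel measure $\mu$ on $\mathbb C$ put $$T_\mu f(z)=\int_{\mathbb C}f(\xi)\overline{B^w_z(\xi)}e^{-\alpha|\xi|^2}d\mu(\xi),\quad \widetilde\mu(z)=\int_{\mathbb C}|b^w_z(\xi)|^2e^{-\alpha|\xi|^2}d\mu(\xi),\quad \widehat\mu_{w,r}(z)=\frac{\mu(D(z,r))}{w(D(z,r))},$$ the last two with values in $[0,\infty]$. That $T_\mu$ is a bounded (compact) operator on $F^2_{\alpha,w}$ means that the integral converges absolutely for all $f\in F^2_{\alpha,w}$ and $z\in\mathbb C$ and that $f\mapsto T_\mu f$ is a bounded (compact) operator from $F^2_{\alpha,w}$ to itself. A compact operator $T$ on a Hilbert space has a canonical decomposition $Tx=\sum_n s_n(T)\langle x,e_n\rangle\sigma_n$ with orthonormal systems $(e_n)$, $(\sigma_n)$ and non-increasing singular values $s_n(T)\ge0$ tending to $0$. For $h:[0,\infty)\to[0,\infty)$, $T\in\mathcal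 S_h$ means that $T$ is compact and $\sum_n h(Cs_n(T))<\infty$ for some $C>0$. Put $h(\infty)=\infty$ in the integrals below. **Theorem 5.1.** Let $\alpha>0$ and $w\in A_\infty^{\mathrm{restricted}}$. There is $\delta\in(0,1)$, depending only on $\alpha$ and $w$, such that for every $r>0$ there is $c>0$ with $$|B^w_a(z)|\ \ge\ c\,\frac{e^{\frac\alpha2|a|^2+\frac\alpha2|z|^2}}{w(D(a,r))}\qquad(a\in\mathbb C,\ z\in D(a,\delta)).\tag{$*$}$$ Let $\delta\in(0,1)$ be any constant with this property. Then for every positive Borel measure $\mu$ on $\mathbb C$ and every continuous, strictly increasing, convex $h:[0,\infty)\to[0,\infty)$ with $h(0)=0$ the following are equivalent: (a) $T_\mu\in\mathcal S_h(F^2_{\alpha,w})$; (b) there is $C>0$ with $\int_{\mathbb C}h(C\widetilde\mu)\,dA<\infty$; (c) for some $r\in(0,\delta)$ there is $C>0$ with $\int_{\mathbb C}h(C\widehat\mu_{w,r})\,dA<\infty$; (c') for every $r\in(0,\delta)$ there is $C>0$ with $\int_{\mathbb C}h(C\widehat\mu_{w,r})\,dA<\infty$. Moreover, for every $r\in(0,\delta)$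 there is $K\ge1$, independent of $\mu$ and $h$, such that for all such $\mu$ and $h$ for which $T_\mu$ is compact on $F^2_{\alpha,w}$ there are $C_1,C_2,C_3>0$ with $K^{-1}\le C_1/C_2\le K$, $K^{-1}\le C_2/C_3\le K$, $$K^{-1}\int_{\mathbb C}h(C_2\widetilde\mu)\,dA\le\sum_n h(C_1s_n(T_\mu))\le K\int_{\mathbb C}h(C_2\widetilde\mu)\,dA,$$ $$K^{-1}\int_{\mathbb C}h(C_3\widehat\mu_{w,r})\,dA\le\int_{\mathbb C}h(C_2\widetilde\mu)\,dA\le K\int_{\mathbb C}h(C_3\widehat\mu_{w,r})\,dA$$ in $[0,\infty]$; if $T_\mu\in\mathcal S_h(F^2_{\alpha,w})$, they can be chosen so that these quantities are finite. -/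

import Mathlib

open MeasureTheory Set Filter Topology
open scoped ENNReal NNReal

namespace WeightedFock

/-! ### Weights on the complex plane and the restricted Muckenhoupt classes -/

/-- A weight on `ℂ`: a non-negative, locally integrable function which is not the zero function
(that is, it does not vanish almost everywhere). -/
structure IsWeight (w : ℂ → ℝ) : Prop where
  nonneg : ∀ z, 0 ≤ w z
  locallyIntegrable : LocallyIntegrable w volume
  nontrivial : ¬ w =ᵐ[volume] 0

/-- The (closed) square with sides parallel to the axes, centre `c` and side length `r`. -/
def square (c : ℂ) (r : ℝ) : Set ℂ :=
  {z | |z.re - c.re| ≤ r / 2 ∧ |z.im - c.im| ≤ r / 2}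

/-- `w(E) = ∫_E w dA`. -/
noncomputable def weightMass (w : ℂ → ℝ) (E : Set ℂ) : ℝ≥0∞ :=
  ∫⁻ z in E, ENNReal.ofReal (w z)

/-- The restricted class for an exponent `1 < p < ∞`, with `p' = p / (p - 1)`. The negative power
of `w` takes the value `∞` where `w` vanishes. -/
def IsRestrictedAp (p : ℝ) (w : ℂ → ℝ) : Prop :=
  ∃ r : ℝ, 0 < r ∧
    (⨆ c : ℂ, (⨍⁻ z in square c r, ENNReal.ofReal (w z) ∂volume) *
      (⨍⁻ z in square c r, ENNReal.ofReal (w z) ^ (-(p.conjExponent / p)) ∂volume) ^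
        (p / p.conjExponent)) < ∞

/-- The restricted class for the exponent `1`. -/
def IsRestrictedA1 (w : ℂ → ℝ) : Prop :=
  ∃ r : ℝ, 0 < r ∧
    (⨆ c : ℂ, (⨍⁻ z in square c r, ENNReal.ofReal (w z) ∂volume) *
      essSup (fun z => (ENNReal.ofReal (w z))⁻¹) (volume.restrict (square c r))) < ∞

/-- The class `A_∞^restricted`, the union of the classes `A_p^restricted` over `1 ≤ p < ∞`. -/
def IsRestrictedAInfty (w : ℂ → ℝ) : Prop :=
  IsRestrictedA1 w ∨ ∃ p : ℝ, 1 < p ∧ IsRestrictedAp p w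

/-! ### The weighted Fock space `F²_{α,w}` -/

/-- The measure `e^{-α|z|²} w(z) dA(z)`. -/
noncomputable def fockMeasure (α : ℝ) (w : ℂ → ℝ) : Measure ℂ :=
  volume.withDensity fun z => ENNReal.ofReal (Real.exp (-α * ‖z‖ ^ 2) * w z)

/-- The weighted Fock space `F²_{α,w}`: the subspace of those elements of
`L²(e^{-α|z|²} w dA)` which are represented by an entire function, with the inherited
inner product. -/
noncomputable def FockSpace (α : ℝ) (w : ℂ → ℝ) : Submodule ℂ (Lp ℂ 2 (fockMeasure α w)) where
  carrier := {f | ∃ F : ℂ → ℂ, Differentiable ℂ F ∧ f =ᵐ[fockMeasure α w] F}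
  add_mem' := by
    rintro f g ⟨F, hF, hfF⟩ ⟨G, hG, hgG⟩
    exact ⟨F + G, hF.add hG, (Lp.coeFn_add f g).trans (hfF.add hgG)⟩
  zero_mem' := ⟨0, differentiable_const 0, Lp.coeFn_zero _ _ _⟩
  smul_mem' := by
    rintro c f ⟨F, hF, hfF⟩
    exact ⟨c • F, hF.const_smul c, (Lp.coeFn_smul c f).trans (hfF.const_smul c)⟩

variable {α : ℝ} {w : ℂ → ℝ}

/-- The entire function which represents an element of `F²_{α,w}` (unique when `w` is a weight,
by the identity theorem). All pointwise values of elements of `F²_{α,w}` are values of it. -/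
noncomputable def entireRep (f : FockSpace α w) : ℂ → ℂ := f.2.choose

open Classical in
/-- The reproducing kernel `B^w_z` of `F²_{α,w}` at `z`: the element with
`f(z) = ⟨f, B^w_z⟩` for all `f` (and `0` should there be no such element). Mathlib's inner product
is conjugate linear in the first variable. -/
noncomputable def kernel (α : ℝ) (w : ℂ → ℝ) (z : ℂ) : FockSpace α w :=
  if h : ∃ k : FockSpace α w, ∀ f : FockSpace α w, entireRep f z = inner ℂ k f
  then h.choose else 0

/-- The normalized reproducing kernel `b^w_z = B^w_z / ‖B^w_z‖`. -/
noncomputable def normalizedKernel (α : ℝ) (w : ℂ → ℝ) (z : ℂ) : FockSpace α w :=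
  ((‖kernel α w z‖⁻¹ : ℝ) : ℂ) • kernel α w z

/-- The local lower estimate for the reproducing kernels on disks of radius `δ`: for each `r > 0`,
`|B^w_a(z)| ≳ e^{α|a|²/2 + α|z|²/2} / w(D(a,r))` for all `a` and all `z ∈ D(a,δ)`, with a constant
that does not depend on `a` and `z`. -/
def KernelLowerBound (α : ℝ) (w : ℂ → ℝ) (δ : ℝ) : Prop :=
  ∀ r : ℝ, 0 < r → ∃ c : ℝ, 0 < c ∧ ∀ a : ℂ, ∀ z ∈ Metric.ball a δ,
    c * (Real.exp (α / 2 * ‖a‖ ^ 2 + α / 2 * ‖z‖ ^ 2) / (weightMass w (Metric.ball a r)).toReal)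
      ≤ ‖entireRep (kernel α w a) z‖

/-! ### Toeplitz operators, Berezin transforms and average functions -/

/-- `T` is the Toeplitz operator `T_μ` on `F²_{α,w}`: for all `f ∈ F²_{α,w}` and all `z` the integral
`∫ f(ξ) conj(B^w_z(ξ)) e^{-α|ξ|²} dμ(ξ)` converges absolutely and equals `(T f)(z)`. -/
def IsToeplitz (μ : Measure ℂ) (T : FockSpace α w →L[ℂ] FockSpace α w) : Prop :=
  ∀ (f : FockSpace α w) (z : ℂ),
    Integrable (fun ξ => entireRep f ξ * starRingEnd ℂ (entireRep (kernel α w z) ξ) *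
      (Real.exp (-α * ‖ξ‖ ^ 2) : ℂ)) μ ∧
    entireRep (T f) z = ∫ ξ, entireRep f ξ * starRingEnd ℂ (entireRep (kernel α w z) ξ) *
      (Real.exp (-α * ‖ξ‖ ^ 2) : ℂ) ∂μ

/-- The Berezin transform of `μ`, with values in `[0,∞]`. -/
noncomputable def berezin (α : ℝ) (w : ℂ → ℝ) (μ : Measure ℂ) (z : ℂ) : ℝ≥0∞ :=
  ∫⁻ ξ, ENNReal.ofReal
    (‖entireRep (normalizedKernel α w z) ξ‖ ^ 2 * Real.exp (-α * ‖ξ‖ ^ 2)) ∂μ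

/-- The average function `μ(D(z,r)) / w(D(z,r))`, with values in `[0,∞]`. -/
noncomputable def average (w : ℂ → ℝ) (r : ℝ) (μ : Measure ℂ) (z : ℂ) : ℝ≥0∞ :=
  μ (Metric.ball z r) / weightMass w (Metric.ball z r)

/-! ### Singular values and the class `S_h` -/

section SingularValues

variable {H : Type*} [NormedAddCommGroup H] [InnerProductSpace ℂ H]

/-- `s` is the sequence of the coefficients in a canonical decomposition
`T x = ∑ s_n ⟨x, e_n⟩ σ_n` of `T`: it is non-increasing, non-negative and tends to `0`, and the
systems `e` and `σ` are orthonormal. Finite decompositions are padded by zeros, and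
only the vectors which belong to non-zero coefficients matter. -/
def IsSingularValueSeq (T : H →L[ℂ] H) (s : ℕ → ℝ≥0) : Prop :=
  Antitone s ∧ Tendsto s atTop (𝓝 0) ∧
    ∃ e σ : ℕ → H,
      Orthonormal ℂ (fun n : {n // s n ≠ 0} => e n) ∧
      Orthonormal ℂ (fun n : {n // s n ≠ 0} => σ n) ∧
      ∀ x : H, HasSum (fun n => ((s n : ℝ) : ℂ) • inner ℂ (e n) x • σ n) (T x)

open Classical in
/-- The sequence of singular values of a compact operator on a Hilbert space (indexed from `0`).
A canonical decomposition exists for each such operator and its coefficients are unique; the value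
is `0` for an operator without canonical decomposition. -/
noncomputable def singularValues (T : H →L[ℂ] H) : ℕ → ℝ≥0 :=
  if h : ∃ s, IsSingularValueSeq T s then h.choose else 0

/-- The sum `∑ h(C s_n(T))` in `[0,∞]`. -/
noncomputable def singularSum (h : ℝ≥0 → ℝ≥0) (T : H →L[ℂ] H) (C : ℝ≥0) : ℝ≥0∞ :=
  ∑' n, (h (C * singularValues T n) : ℝ≥0∞)

/-- The class `S_h(H)`: compact operators with `∑ h(C s_n(T)) < ∞` for some `C > 0`. -/
def MemSchattenClass (h : ℝ≥0 → ℝ≥0) (T : H →L[ℂ] H) : Prop :=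
  IsCompactOperator T ∧ ∃ C : ℝ≥0, 0 < C ∧ singularSum h T C < ∞

end SingularValues

/-- The extension of `h : [0,∞) → [0,∞)` to `[0,∞]` by `h(∞) = ∞`. -/
noncomputable def extendTop (h : ℝ≥0 → ℝ≥0) (x : ℝ≥0∞) : ℝ≥0∞ :=
  if x = ∞ then ∞ else (h x.toNNReal : ℝ≥0∞)

/-- The integral `∫ h(C g(z)) dA(z)` in `[0,∞]` of a function `g` with values in `[0,∞]`. -/
noncomputable def modularIntegral (h : ℝ≥0 → ℝ≥0) (g : ℂ → ℝ≥0∞) (C : ℝ≥0) : ℝ≥0∞ :=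
  ∫⁻ z, extendTop h (C * g z)

/-- The functions `h` which are admitted: continuous, strictly increasing, convex on `[0,∞)`, with
`h(0) = 0`. -/
structure IsGauge (h : ℝ≥0 → ℝ≥0) : Prop where
  continuous : Continuous h
  strictMono : StrictMono h
  convex : ConvexOn ℝ≥0 univ h
  map_zero : h 0 = 0

/-- `x ≍ y` in `[0,∞]` with constant `K`. -/
def Comparable (K : ℝ≥0) (x y : ℝ≥0∞) : Prop :=
  x ≤ K * y ∧ y ≤ K * x

end WeightedFock

namespace WeightedFock

/-! ### Weights as locally doubling measures -/

/-! Everything happens at scale one. Write ν for w dA. The Muckenhoupt condition enters only through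
local doubling: a disk of radius ρ carries at least a fixed multiple of ρ^k of the mass of nearby
disks of fixed size. With it, `LocallyDoubling.exists_fockDensity_le` bounds |F(a)|² e^{-α|a|²}
ν(D(a,1)) by the integral of |F|² e^{-α|z|²} dν over a small disk about a, for F entire. So point
evaluations are bounded, the norm of the kernel satisfies ‖B_z‖² ≍ e^{α|z|²} / ν(D(z,1)), and a
Schwarz estimate carries this size from the diagonal to a disk of fixed radius, which is (∗).

Two integral inequalities follow. The normalized kernels satisfy a Bessel inequality, ∫ |⟨b_z, f⟩|²
dA(z) ≤ C‖f‖² (`exists_lintegral_inner_normalizedKernel_le`). The μ-integral of |f|² e^{-α|z|²} is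
at most a constant times its ν-integral against the average function
(`exists_lintegral_fockDensity_le_average`).

The theorem then rests on four comparisons, the last three by Jensen's inequality for h. (1) By (∗)
the average is pointwise at most K times the Berezin transform. (2) The Berezin transform at z is
dominated by the mean of the average function for the probability measure |b_z|² e^{-α|ζ|²} dν(ζ).
Apply Jensen and integrate in z: the kernels integrate to at most C / ν(D(ζ,1)), and dν(ζ) /
ν(D(ζ,1)) is traded for dA by enlarging the radius from r/2 to r. (3) The Berezin transform is ⟨b_z,
T b_z⟩ ≤ ∑ s_n p_n(z), with weights p_n(z) of sum at most 1 and of integral at most C in z. (4) Each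
s_n = ⟨σ_n, T e_n⟩ is dominated by the mean of the average function for the probability measure with
ν-density ½(|e_n|² + |σ_n|²) e^{-α|ζ|²}. By Bessel these densities sum to at most ‖B_ζ‖² e^{-α|ζ|²}
≤ C / ν(D(ζ,1)), and one ends as in (2).

Since h need not be doubling, the constants stay inside h. Two-sided comparison comes from the
intermediate value theorem: the modular integrals are continuous in the multiplier as long as they
are finite, so suitable C₂ and C₃ exist within fixed ratios of C₁. If they are never finite, all
three quantities are ∞.

The operator itself is J*J for the embedding J of the Fock space into L²(e^{-α|z|²} dμ). It is
compact when the averages vanish at infinity, as a norm limit of integrals of rank one operators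
over large disks. -/

/-- The measure `w dA`. -/
noncomputable def weightMeasure (w : ℂ → ℝ) : Measure ℂ :=
  volume.withDensity fun z => ENNReal.ofReal (w z)

lemma weightMass_eq (w : ℂ → ℝ) {E : Set ℂ} (hE : MeasurableSet E) :
    weightMass w E = weightMeasure w E := (withDensity_apply _ hE).symm

lemma IsWeight.aemeasurable {w : ℂ → ℝ} (hw : IsWeight w) :
    AEMeasurable (fun z => ENNReal.ofReal (w z)) volume :=
  hw.locallyIntegrable.aestronglyMeasurable.aemeasurable.ennreal_ofReal

/-- A consequence of Hölder's inequality behind the Muckenhoupt condition. -/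
lemma measure_rpow_le_lintegral_mul {X : Type*} [MeasurableSpace X] {μ : Measure X} {p : ℝ}
    (hp : 1 < p) {f : X → ℝ≥0∞} (hf : AEMeasurable f μ) (hf_top : ∀ x, f x ≠ ∞)
    (hfin : ∫⁻ x, f x ^ (-(p.conjExponent / p)) ∂μ ≠ ∞) :
    μ univ ^ p ≤ (∫⁻ x, f x ∂μ) *
      (∫⁻ x, f x ^ (-(p.conjExponent / p)) ∂μ) ^ (p / p.conjExponent) := by
  have hpq := Real.HolderConjugate.conjExponent hp
  set q := p.conjExponent
  have hp0 : 0 < p := hpq.pos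
  have hq0 : 0 < q := hpq.symm.pos
  -- The negative power is ∞ at the zeros of f, so its integrability makes f positive almost
  -- everywhere. This is what lets the two powers multiply to 1 below.
  have hae : ∀ᵐ x ∂μ, f x ≠ 0 := by
    filter_upwards [ae_lt_top' (hf.pow_const _) hfin] with x hx h0
    rw [h0, ENNReal.zero_rpow_of_neg (by simp; positivity)] at hx
    exact lt_irrefl _ hx
  have key := ENNReal.lintegral_mul_le_Lp_mul_Lq μ hpq (hf.pow_const (1 / p))
    (hf.pow_const (-(1 / p)))
  have h1 : ∫⁻ x, ((fun x => f x ^ (1 / p)) * fun x => f x ^ (-(1 / p))) x ∂μ = μ univ := by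
    rw [← lintegral_one]
    refine lintegral_congr_ae ?_
    filter_upwards [hae] with x hx
    simp only [Pi.mul_apply]
    rw [← ENNReal.rpow_add _ _ hx (hf_top x)]
    simp
  have h2 : ∀ x, (f x ^ (1 / p)) ^ p = f x := fun x => by
    rw [← ENNReal.rpow_mul, one_div_mul_cancel hp0.ne', ENNReal.rpow_one]
  have h3 : ∀ x, (f x ^ (-(1 / p))) ^ q = f x ^ (-(q / p)) := fun x => by
    rw [← ENNReal.rpow_mul]; congr 1; ring
  simp only [h1, h2, h3] at key
  calc μ univ ^ p ≤ ((∫⁻ x, f x ∂μ) ^ (1 / p) * (∫⁻ x, f x ^ (-(q / p)) ∂μ) ^ (1 / q)) ^ p := by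
        gcongr
    _ = _ := by
        rw [ENNReal.mul_rpow_of_nonneg _ _ hp0.le, ← ENNReal.rpow_mul, ← ENNReal.rpow_mul,
          one_div_mul_cancel hp0.ne', ENNReal.rpow_one]
        congr 2; ring

lemma ball_subset_square {z c : ℂ} {ρ r : ℝ} (h : dist z c + ρ ≤ r / 2) :
    Metric.ball z ρ ⊆ square c r := by
  intro x hx
  have h1 : ‖x - c‖ ≤ r / 2 := by
    rw [← dist_eq_norm]
    have := dist_triangle x z c
    have := Metric.mem_ball.1 hx
    linarith
  exact ⟨(Complex.abs_re_le_norm (x - c)).trans h1, (Complex.abs_im_le_norm (x - c)).trans h1⟩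

lemma isClosed_square (c : ℂ) (r : ℝ) : IsClosed (square c r) := by
  have h1 : Continuous fun z : ℂ => |z.re - c.re| := by fun_prop
  have h2 : Continuous fun z : ℂ => |z.im - c.im| := by fun_prop
  exact (isClosed_le h1 continuous_const).inter (isClosed_le h2 continuous_const)

lemma volume_square (c : ℂ) (r : ℝ) : volume (square c r) = volume (square 0 r) := by
  have : square 0 r = (fun z => c + z) ⁻¹' square c r := by
    ext z; simp [square]
  rw [this, measure_preimage_add]

lemma square_subset_closedBall (r : ℝ) : square 0 r ⊆ Metric.closedBall 0 r := by
  intro z hz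
  have := Complex.norm_le_abs_re_add_abs_im z
  have h1 := hz.1
  have h2 := hz.2
  simp at h1 h2 ⊢
  linarith

lemma volume_square_ne_top (c : ℂ) (r : ℝ) : volume (square c r) ≠ ∞ := by
  rw [volume_square]
  exact ((measure_mono (square_subset_closedBall r)).trans_lt measure_closedBall_lt_top).ne

lemma volume_square_pos (c : ℂ) {r : ℝ} (hr : 0 < r) : volume (square c r) ≠ 0 :=
  ((Metric.measure_ball_pos volume c (half_pos hr)).trans_le
    (measure_mono (ball_subset_square (by simp)))).ne'

/-- The only property of `A_∞^restricted` weights which is used: subsets of squares of a fixed size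
carry a definite part of the mass of the square. -/
lemma IsRestrictedAp.exists_mass_le {w : ℂ → ℝ} (hw : IsWeight w) {p : ℝ} (hp : 1 < p)
    (hA : IsRestrictedAp p w) : ∃ r : ℝ, 0 < r ∧ ∃ C : ℝ≥0∞, C ≠ ∞ ∧
      ∀ c : ℂ, ∀ E ⊆ square c r, MeasurableSet E →
        (volume E / volume (square 0 r)) ^ p * weightMeasure w (square c r) ≤
          C * weightMeasure w E := by
  obtain ⟨r, hr, hS⟩ := hA
  set S := ⨆ c : ℂ, (⨍⁻ z in square c r, ENNReal.ofReal (w z) ∂volume) *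
      (⨍⁻ z in square c r, ENNReal.ofReal (w z) ^ (-(p.conjExponent / p)) ∂volume) ^
        (p / p.conjExponent) with hSdef
  refine ⟨r, hr, S, hS.ne, fun c E hE hEm => ?_⟩
  have hpq := Real.HolderConjugate.conjExponent hp
  have hp0 : 0 < p := hpq.pos
  have hq0 : 0 < p.conjExponent := hpq.symm.pos
  have hle := le_iSup (fun c : ℂ => (⨍⁻ z in square c r, ENNReal.ofReal (w z) ∂volume) *
      (⨍⁻ z in square c r, ENNReal.ofReal (w z) ^ (-(p.conjExponent / p)) ∂volume) ^
        (p / p.conjExponent)) c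
  rw [← hSdef] at hle
  simp only [setLAverage_eq, volume_square c] at hle
  have hV0 := volume_square_pos 0 hr
  have hVt := volume_square_ne_top 0 r
  set V := volume (square 0 r)
  have hQ : weightMeasure w (square c r) = ∫⁻ z in square c r, ENNReal.ofReal (w z) :=
    withDensity_apply _ (isClosed_square c r).measurableSet
  have hEE : weightMeasure w E = ∫⁻ z in E, ENNReal.ofReal (w z) := withDensity_apply _ hEm
  rw [hQ, hEE]
  set I := ∫⁻ z in square c r, ENNReal.ofReal (w z) ^ (-(p.conjExponent / p))
  set W := ∫⁻ z in square c r, ENNReal.ofReal (w z)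
  -- A square on which the dual integral diverges must have zero mass, for otherwise the supremum
  -- would be infinite; the claim is then trivial.
  by_cases hI : I = ∞
  · have : W = 0 := by
      by_contra hW
      rw [hI, ENNReal.top_div_of_ne_top hVt, ENNReal.top_rpow_of_pos (by positivity),
        ENNReal.mul_top (ENNReal.div_ne_zero.2 ⟨hW, hVt⟩)] at hle
      exact absurd hS (not_lt.2 hle)
    simp [this]
  have hIE : ∫⁻ z in E, ENNReal.ofReal (w z) ^ (-(p.conjExponent / p)) ≤ I :=
    lintegral_mono_set hE
  have key := measure_rpow_le_lintegral_mul (μ := volume.restrict E) hp hw.aemeasurable.restrict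
    (fun x => ENNReal.ofReal_ne_top) (ne_top_of_le_ne_top hI hIE)
  rw [Measure.restrict_apply_univ] at key
  calc (volume E / V) ^ p * W
      = volume E ^ p * W / V ^ p := by
        rw [ENNReal.div_rpow_of_nonneg _ _ hp0.le]; simp only [div_eq_mul_inv]; ring
    _ ≤ ((∫⁻ z in E, ENNReal.ofReal (w z)) * I ^ (p / p.conjExponent)) * W / V ^ p := by
        gcongr
        exact key.trans (by gcongr)
    _ = (W / V * (I / V) ^ (p / p.conjExponent)) * ∫⁻ z in E, ENNReal.ofReal (w z) := by
        have e : p = 1 + p / p.conjExponent := by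
          have := hpq.sub_one_mul_conj
          field_simp
          linarith
        rw [ENNReal.div_rpow_of_nonneg _ _ (by positivity)]
        have e' : V ^ p = V * V ^ (p / p.conjExponent) := by
          conv_lhs => rw [e]
          rw [ENNReal.rpow_add _ _ hV0 hVt, ENNReal.rpow_one]
        rw [e']
        simp only [div_eq_mul_inv]
        rw [ENNReal.mul_inv (Or.inl hV0) (Or.inl hVt)]
        ring
    _ ≤ _ := by gcongr

/-- The essential supremum N of 1/w gives 1 ≤ N w almost everywhere on the square, hence |E| ≤ N
w(E). The exponent 1 is kept as a real power so that both classes have the same conclusion. -/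
lemma IsRestrictedA1.exists_mass_le {w : ℂ → ℝ}
    (hA : IsRestrictedA1 w) : ∃ r : ℝ, 0 < r ∧ ∃ C : ℝ≥0∞, C ≠ ∞ ∧
      ∀ c : ℂ, ∀ E ⊆ square c r, MeasurableSet E →
        (volume E / volume (square 0 r)) ^ (1 : ℝ) * weightMeasure w (square c r) ≤
          C * weightMeasure w E := by
  obtain ⟨r, hr, hS⟩ := hA
  set S := ⨆ c : ℂ, (⨍⁻ z in square c r, ENNReal.ofReal (w z) ∂volume) *
      essSup (fun z => (ENNReal.ofReal (w z))⁻¹) (volume.restrict (square c r)) with hSdef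
  refine ⟨r, hr, S, hS.ne, fun c E hE hEm => ?_⟩
  have hle := le_iSup (fun c : ℂ => (⨍⁻ z in square c r, ENNReal.ofReal (w z) ∂volume) *
      essSup (fun z => (ENNReal.ofReal (w z))⁻¹) (volume.restrict (square c r))) c
  rw [← hSdef] at hle
  simp only [setLAverage_eq, volume_square c] at hle
  have hVt := volume_square_ne_top 0 r
  have hQ : weightMeasure w (square c r) = ∫⁻ z in square c r, ENNReal.ofReal (w z) :=
    withDensity_apply _ (isClosed_square c r).measurableSet
  have hEE : weightMeasure w E = ∫⁻ z in E, ENNReal.ofReal (w z) := withDensity_apply _ hEm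
  rw [hQ, hEE, ENNReal.rpow_one]
  set V := volume (square 0 r)
  set W := ∫⁻ z in square c r, ENNReal.ofReal (w z)
  set N := essSup (fun z => (ENNReal.ofReal (w z))⁻¹) (volume.restrict (square c r))
  by_cases hN : N = ∞
  · have : W = 0 := by
      by_contra hW
      rw [hN, ENNReal.mul_top (ENNReal.div_ne_zero.2 ⟨hW, hVt⟩)] at hle
      exact absurd hS (not_lt.2 hle)
    simp [this]
  have hae : ∀ᵐ z ∂volume.restrict E, 1 ≤ N * ENNReal.ofReal (w z) := by
    filter_upwards [ae_restrict_of_ae_restrict_of_subset hE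
      (ENNReal.ae_le_essSup (μ := volume.restrict (square c r))
        (fun z => (ENNReal.ofReal (w z))⁻¹))] with z hz
    have h0 : ENNReal.ofReal (w z) ≠ 0 := by
      intro h
      rw [h, ENNReal.inv_zero, top_le_iff] at hz
      exact hN hz
    calc 1 = (ENNReal.ofReal (w z))⁻¹ * ENNReal.ofReal (w z) :=
          (ENNReal.inv_mul_cancel h0 ENNReal.ofReal_ne_top).symm
      _ ≤ _ := by gcongr
  have key : volume E ≤ N * ∫⁻ z in E, ENNReal.ofReal (w z) := by
    rw [← setLIntegral_one, ← lintegral_const_mul' _ _ hN]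
    exact lintegral_mono_ae hae
  calc volume E / V * W ≤ (N * ∫⁻ z in E, ENNReal.ofReal (w z)) / V * W := by gcongr
    _ = (W / V * N) * ∫⁻ z in E, ENNReal.ofReal (w z) := by simp only [div_eq_mul_inv]; ring
    _ ≤ _ := by gcongr

/-- A locally finite measure on the plane for which small disks carry a definite part of the mass of
nearby disks of a fixed size. -/
structure LocallyDoubling (ν : Measure ℂ) : Prop where
  finite : ∀ a r, ν (Metric.ball a r) ≠ ∞
  ne_zero : ν ≠ 0
  doubling : ∃ r₀ : ℝ, 0 < r₀ ∧ ∃ k : ℕ, ∃ C : ℝ≥0, ∀ a z : ℂ, ∀ ρ : ℝ, 0 < ρ → ρ ≤ r₀ →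
    dist z a ≤ r₀ → ENNReal.ofReal ρ ^ k * ν (Metric.ball a r₀) ≤ C * ν (Metric.ball z ρ)

/-- Apply the mass estimate to the disk D(z,ρ) inside a square of the fixed size. Its relative area
is a multiple of ρ², so its mass is at least a multiple of ρ^{2p}, up to rounding p upwards. -/
theorem IsWeight.locallyDoubling {w : ℂ → ℝ} (hw : IsWeight w) (hA : IsRestrictedAInfty w) :
    LocallyDoubling (weightMeasure w) where
  finite a r := by
    have h := hw.locallyIntegrable.integrableOn_isCompact (isCompact_closedBall a r)
    rw [weightMeasure, withDensity_apply _ measurableSet_ball]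
    refine ne_top_of_le_ne_top h.2.ne (((lintegral_mono_set Metric.ball_subset_closedBall)).trans
      (lintegral_mono fun z => ?_))
    exact Real.ofReal_le_enorm _
  ne_zero h := by
    refine hw.nontrivial ?_
    rw [weightMeasure, withDensity_eq_zero_iff hw.aemeasurable] at h
    filter_upwards [h] with z hz
    exact le_antisymm (by simpa using hz) (hw.nonneg z)
  doubling := by
    obtain ⟨p, hp, r, hr, C, hC, H⟩ : ∃ p : ℝ, 1 ≤ p ∧ ∃ r : ℝ, 0 < r ∧ ∃ C : ℝ≥0∞, C ≠ ∞ ∧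
        ∀ c : ℂ, ∀ E ⊆ square c r, MeasurableSet E →
        (volume E / volume (square 0 r)) ^ p * weightMeasure w (square c r) ≤
          C * weightMeasure w E := by
      rcases hA with hA | ⟨p, hp, hA⟩
      · exact ⟨1, le_rfl, hA.exists_mass_le⟩
      · exact ⟨p, hp.le, hA.exists_mass_le hw hp⟩
    have hV0 := volume_square_pos 0 hr
    have hVt := volume_square_ne_top 0 r
    set V := volume (square 0 r) with hV
    set k := ⌈p⌉₊
    set t : ℝ≥0∞ := NNReal.pi / V with ht
    have ht0 : t ≠ 0 := ENNReal.div_ne_zero.2 ⟨by simp [NNReal.pi_ne_zero], hVt⟩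
    have htt : t ≠ ∞ := ENNReal.div_ne_top (by simp) hV0
    have hD : C / t ^ k ≠ ∞ := ENNReal.div_ne_top hC (by positivity)
    -- With r₀ = r/4 the disk D(z,ρ) stays in the square of side r about a. The exponent 2k reflects
    -- the area πρ², and t is the ratio of π to the area of the square.
    refine ⟨r / 4, by positivity, 2 * k, (C / t ^ k).toNNReal, fun a z ρ hρ hρr hza => ?_⟩
    have hsub : Metric.ball z ρ ⊆ square a r := ball_subset_square (by linarith)
    have h1 := H a _ hsub measurableSet_ball
    have hle1 : volume (Metric.ball z ρ) / V ≤ 1 := by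
      rw [hV, ← volume_square a]
      exact ENNReal.div_le_of_le_mul (by simpa using measure_mono (μ := volume) hsub)
    have h2 : (volume (Metric.ball z ρ) / V) ^ k ≤ (volume (Metric.ball z ρ) / V) ^ p := by
      rw [← ENNReal.rpow_natCast]
      exact ENNReal.rpow_le_rpow_of_exponent_ge hle1 (Nat.le_ceil p)
    have h3 : volume (Metric.ball z ρ) / V = ENNReal.ofReal ρ ^ 2 * t := by
      rw [Complex.volume_ball, ht, mul_div_assoc]
    have h4 : weightMeasure w (Metric.ball a (r / 4)) ≤ weightMeasure w (square a r) :=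
      measure_mono (ball_subset_square (by simp; linarith))
    rw [ENNReal.coe_toNNReal hD]
    have h5 : ENNReal.ofReal ρ ^ (2 * k) * t ^ k * weightMeasure w (Metric.ball a (r / 4)) ≤
        C * weightMeasure w (Metric.ball z ρ) := by
      calc _ = (volume (Metric.ball z ρ) / V) ^ k * weightMeasure w (Metric.ball a (r / 4)) := by
            rw [h3, mul_pow, ← pow_mul]
        _ ≤ (volume (Metric.ball z ρ) / V) ^ p * weightMeasure w (square a r) := by gcongr
        _ ≤ _ := h1
    have htk0 : t ^ k ≠ 0 := pow_ne_zero _ ht0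
    have htkt : t ^ k ≠ ∞ := by finiteness
    calc _ = (ENNReal.ofReal ρ ^ (2 * k) * t ^ k * weightMeasure w (Metric.ball a (r / 4))) /
          t ^ k := by
          rw [mul_right_comm, mul_div_assoc, ENNReal.div_self htk0 htkt, mul_one]
      _ ≤ C * weightMeasure w (Metric.ball z ρ) / t ^ k := by gcongr
      _ = _ := by simp only [div_eq_mul_inv]; ring

/-! ### Consequences of local doubling: chaining, positivity and growth -/

namespace LocallyDoubling

variable {ν : Measure ℂ}

/-- Disks of fixed sizes at bounded distance have comparable masses. -/
lemma exists_le (hν : LocallyDoubling ν) (R s : ℝ) {ρ : ℝ} (hρ : 0 < ρ) :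
    ∃ C : ℝ≥0, 1 ≤ C ∧ ∀ a z : ℂ, dist z a ≤ s →
      ν (Metric.ball a R) ≤ C * ν (Metric.ball z ρ) := by
  obtain ⟨r₀, hr₀, k, C, H⟩ := hν.doubling
  have step : ∀ ρ, 0 < ρ → ρ ≤ r₀ → ∃ D : ℝ≥0, ∀ a z : ℂ, dist z a ≤ r₀ →
      ν (Metric.ball a r₀) ≤ D * ν (Metric.ball z ρ) := by
    intro ρ hρ hρr
    have h0 : ENNReal.ofReal ρ ^ k ≠ 0 := by positivity
    have ht : ENNReal.ofReal ρ ^ k ≠ ∞ := by finiteness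
    refine ⟨(C / ENNReal.ofReal ρ ^ k).toNNReal, fun a z hza => ?_⟩
    rw [ENNReal.coe_toNNReal (ENNReal.div_ne_top (by simp) h0)]
    calc ν (Metric.ball a r₀) = (ENNReal.ofReal ρ ^ k * ν (Metric.ball a r₀)) /
          ENNReal.ofReal ρ ^ k := by
          rw [mul_comm, mul_div_assoc, ENNReal.div_self h0 ht, mul_one]
      _ ≤ C * ν (Metric.ball z ρ) / ENNReal.ofReal ρ ^ k :=
          ENNReal.div_le_div_right (H a z ρ hρ hρr hza) _
      _ = _ := by simp only [div_eq_mul_inv]; ring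
  have chain : ∀ n : ℕ, ∃ D : ℝ≥0, ∀ a z : ℂ, dist z a ≤ n * r₀ →
      ν (Metric.ball a r₀) ≤ D * ν (Metric.ball z r₀) := by
    obtain ⟨D₁, hD₁⟩ := step r₀ hr₀ le_rfl
    intro n
    induction n with
    | zero => exact ⟨1, fun a z h => by simp_all⟩
    | succ n ih =>
      obtain ⟨D, hD⟩ := ih
      refine ⟨D * D₁, fun a z h => ?_⟩
      push_cast at h
      have hn : (0 : ℝ) < n + 1 := by positivity
      -- The point that divides the segment from a to z in the ratio n : 1, so that n steps lead to
      -- y and one more to z.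
      set y : ℂ := a + ((n / (n + 1) : ℝ) : ℂ) * (z - a) with hy
      have hd : ‖z - a‖ ≤ (n + 1) * r₀ := by rwa [dist_eq_norm] at h
      have h1 : dist y a ≤ n * r₀ := by
        rw [dist_eq_norm, hy, add_sub_cancel_left, norm_mul, Complex.norm_real, Real.norm_of_nonneg
          (by positivity)]
        calc _ ≤ n / (n + 1) * ((n + 1) * r₀) := by gcongr
          _ = _ := by field_simp
      have h2 : dist z y ≤ r₀ := by
        have : z - y = ((1 / (n + 1) : ℝ) : ℂ) * (z - a) := by
          have : (n : ℂ) + 1 ≠ 0 := by exact_mod_cast hn.ne'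
          rw [hy]; push_cast; field_simp; ring
        rw [dist_eq_norm, this, norm_mul, Complex.norm_real, Real.norm_of_nonneg (by positivity)]
        calc _ ≤ 1 / (n + 1) * ((n + 1) * r₀) := by gcongr
          _ = _ := by field_simp
      calc _ ≤ D * ν (Metric.ball y r₀) := hD a y h1
        _ ≤ D * (D₁ * ν (Metric.ball z r₀)) := by gcongr; exact hD₁ y z h2
        _ = _ := by push_cast; ring
  obtain ⟨F, hFs, hFf, hF⟩ := finite_cover_balls_of_compact (isCompact_closedBall (0 : ℂ) R) hr₀
  obtain ⟨n, hn⟩ := exists_nat_ge ((R + s) / r₀)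
  obtain ⟨D, hD⟩ := chain n
  obtain ⟨D', hD'⟩ := step (min ρ r₀) (lt_min hρ hr₀) (min_le_right _ _)
  -- The cover of D(a,R) is a translate of one fixed cover of the disk about 0, so the number of
  -- small disks does not depend on a. The summand 1 only serves the normalization 1 ≤ C.
  refine ⟨1 + hFf.toFinset.card * (D * D'), by simp, fun a z hza => ?_⟩
  have hcov : Metric.ball a R ⊆ ⋃ t ∈ hFf.toFinset, Metric.ball (a + t) r₀ := by
    intro x hx
    have hx' : x - a ∈ Metric.closedBall (0 : ℂ) R := by
      rw [mem_closedBall_zero_iff, ← dist_eq_norm]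
      exact (Metric.mem_ball.1 hx).le
    obtain ⟨t, ht, hxt⟩ := mem_iUnion₂.1 (hF hx')
    refine mem_iUnion₂.2 ⟨t, by simpa using ht, ?_⟩
    rw [Metric.mem_ball, dist_eq_norm] at hxt ⊢
    rwa [← sub_sub]
  calc ν (Metric.ball a R) ≤ ∑ t ∈ hFf.toFinset, ν (Metric.ball (a + t) r₀) :=
        (measure_mono hcov).trans (measure_biUnion_finset_le _ _)
    _ ≤ ∑ t ∈ hFf.toFinset, D * D' * ν (Metric.ball z ρ) := by
        refine Finset.sum_le_sum fun t ht => ?_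
        have ht' : ‖t‖ ≤ R := by simpa using hFs (by simpa using ht)
        have hdist : dist z (a + t) ≤ n * r₀ := by
          rw [div_le_iff₀ hr₀] at hn
          have : dist a (a + t) = ‖t‖ := by simp
          linarith [dist_triangle z a (a + t)]
        calc _ ≤ D * ν (Metric.ball z r₀) := hD _ _ hdist
          _ ≤ D * (D' * ν (Metric.ball z (min ρ r₀))) := by
              gcongr; exact hD' z z (by simpa using hr₀.le)
          _ ≤ D * (D' * ν (Metric.ball z ρ)) := by gcongr; exact min_le_left _ _
          _ = _ := by ring
    _ = hFf.toFinset.card * (D * D') * ν (Metric.ball z ρ) := by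
        rw [Finset.sum_const, nsmul_eq_mul]; ring
    _ ≤ _ := by
        gcongr
        push_cast
        exact le_add_self

/-- A null disk would force all concentric disks to be null, and then the whole measure. -/
lemma pos (hν : LocallyDoubling ν) (a : ℂ) {r : ℝ} (hr : 0 < r) : 0 < ν (Metric.ball a r) := by
  rw [pos_iff_ne_zero]
  intro h0
  refine hν.ne_zero (Measure.measure_univ_eq_zero.1 ?_)
  rw [← Metric.iUnion_ball_nat a, measure_iUnion_null_iff]
  intro n
  obtain ⟨C, -, hC⟩ := hν.exists_le n 0 hr
  have := hC a a (by simp)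
  rw [h0, mul_zero] at this
  exact le_antisymm this bot_le

lemma isLocallyFiniteMeasure (hν : LocallyDoubling ν) : IsLocallyFiniteMeasure ν :=
  ⟨fun x => ⟨Metric.ball x 1, Metric.ball_mem_nhds x one_pos, (hν.finite x 1).lt_top⟩⟩

/-- The mass of small disks is bounded below by a power of the radius. -/
lemma exists_pow_mul_le (hν : LocallyDoubling ν) : ∃ k : ℕ, ∃ C : ℝ≥0, 1 ≤ C ∧ ∀ a z : ℂ, ∀ ρ : ℝ,
    0 < ρ → ρ ≤ 1 → dist z a ≤ 1 →
      ENNReal.ofReal ρ ^ k * ν (Metric.ball a 1) ≤ C * ν (Metric.ball z ρ) := by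
  obtain ⟨r₀, hr₀, k, C, H⟩ := hν.doubling
  obtain ⟨D, hD1, hD⟩ := hν.exists_le 1 1 hr₀
  refine ⟨k, D * (1 + C), one_le_mul hD1 (by simp), fun a z ρ hρ hρ1 hza => ?_⟩
  have hz : ν (Metric.ball a 1) ≤ D * ν (Metric.ball z r₀) := hD a z hza
  have : ENNReal.ofReal ρ ^ k * ν (Metric.ball z r₀) ≤ (1 + C) * ν (Metric.ball z ρ) := by
    rcases le_total ρ r₀ with h | h
    · refine (H z z ρ hρ h (by simpa using hr₀.le)).trans ?_
      gcongr; exact le_add_self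
    · calc _ ≤ 1 * ν (Metric.ball z ρ) := by
            gcongr
            exact pow_le_one₀ (by positivity) (by simpa using hρ1)
        _ ≤ _ := by gcongr; simp
  calc _ ≤ ENNReal.ofReal ρ ^ k * (D * ν (Metric.ball z r₀)) := by gcongr
    _ = D * (ENNReal.ofReal ρ ^ k * ν (Metric.ball z r₀)) := by ring
    _ ≤ D * ((1 + C) * ν (Metric.ball z ρ)) := by gcongr
    _ = _ := by push_cast; ring

/-- The masses of unit disks vary at most exponentially. -/
lemma exists_growth (hν : LocallyDoubling ν) : ∃ L : ℝ, 0 < L ∧ ∀ a z : ℂ,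
    ν (Metric.ball z 1) ≤ ENNReal.ofReal (Real.exp (L * (dist z a + 1))) * ν (Metric.ball a 1) := by
  obtain ⟨C, hC1, hC⟩ := hν.exists_le 1 1 one_pos
  have chain : ∀ n : ℕ, ∀ a z : ℂ, dist a z ≤ n →
      ν (Metric.ball z 1) ≤ (C : ℝ≥0∞) ^ n * ν (Metric.ball a 1) := by
    intro n
    induction n with
    | zero => intro a z h; simp_all
    | succ n ih =>
      intro a z h
      push_cast at h
      have hn : (0 : ℝ) < n + 1 := by positivity
      set y : ℂ := z + ((n / (n + 1) : ℝ) : ℂ) * (a - z) with hy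
      have hd : ‖a - z‖ ≤ (n + 1) := by rwa [dist_eq_norm] at h
      have h1 : dist y z ≤ n := by
        rw [dist_eq_norm, hy, add_sub_cancel_left, norm_mul, Complex.norm_real, Real.norm_of_nonneg
          (by positivity)]
        calc _ ≤ n / (n + 1) * ((n + 1) : ℝ) := by gcongr
          _ = _ := by field_simp
      have h2 : dist a y ≤ 1 := by
        have : a - y = ((1 / (n + 1) : ℝ) : ℂ) * (a - z) := by
          have : (n : ℂ) + 1 ≠ 0 := by exact_mod_cast hn.ne'
          rw [hy]; push_cast; field_simp; ring
        rw [dist_eq_norm, this, norm_mul, Complex.norm_real, Real.norm_of_nonneg (by positivity)]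
        calc _ ≤ 1 / (n + 1) * ((n + 1) : ℝ) := by gcongr
          _ = _ := by field_simp
      calc _ ≤ (C : ℝ≥0∞) ^ n * ν (Metric.ball y 1) := ih y z h1
        _ ≤ (C : ℝ≥0∞) ^ n * (C * ν (Metric.ball a 1)) := by gcongr; exact hC y a h2
        _ = _ := by ring
  have hC0 : (0 : ℝ) < C := lt_of_lt_of_le one_pos (by exact_mod_cast hC1)
  -- The chain has at most dist z a + 1 steps, each costing a factor C; the extra 1 makes the
  -- exponent positive also when C = 1.
  refine ⟨Real.log C + 1, by have := Real.log_nonneg (x := C) (by exact_mod_cast hC1); linarith,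
    fun a z => ?_⟩
  refine (chain ⌈dist z a⌉₊ a z (by rw [dist_comm]; exact Nat.le_ceil _)).trans ?_
  gcongr
  rw [← ENNReal.ofReal_coe_nnreal, ← ENNReal.ofReal_pow (by positivity)]
  refine ENNReal.ofReal_le_ofReal ?_
  have h1 : (⌈dist z a⌉₊ : ℝ) ≤ dist z a + 1 := (Nat.ceil_lt_add_one dist_nonneg).le
  calc (C : ℝ) ^ ⌈dist z a⌉₊ = Real.exp (Real.log C * ⌈dist z a⌉₊) := by
        rw [mul_comm, Real.exp_nat_mul, Real.exp_log hC0]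
    _ ≤ _ := by
        have := Real.log_nonneg (x := C) (by exact_mod_cast hC1)
        gcongr
        linarith

end LocallyDoubling

end WeightedFock


namespace WeightedFock

/-! ### Pointwise estimates for entire functions -/

/-- A weighted sub-mean value property, for locally doubling measures. -/
lemma LocallyDoubling.exists_sq_norm_le {ν : Measure ℂ} (hν : LocallyDoubling ν) {R : ℝ}
    (hR : 0 < R) (hR1 : R ≤ 1) : ∃ C : ℝ≥0, ∀ a : ℂ, ∀ G : ℂ → ℂ, Differentiable ℂ G →
      ENNReal.ofReal (‖G a‖ ^ 2) * ν (Metric.ball a 1) ≤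
        C * ∫⁻ z in Metric.ball a R, ENNReal.ofReal (‖G z‖ ^ 2) ∂ν := by
  obtain ⟨m, D, hD1, hD⟩ := hν.exists_pow_mul_le
  -- A positive exponent is needed, so that the function Ψ below vanishes on the boundary circle.
  obtain ⟨k, hk⟩ : ∃ k, k = m + 1 := ⟨_, rfl⟩
  -- Chosen so that the Schwarz estimate on D(z₀,d/2) lets G vary by at most half of |G(z₀)| on
  -- D(z₀,d/A).
  set A : ℝ := 4 * (2 ^ k + 2) with hA
  have hA0 : 0 < A := by positivity
  refine ⟨(4 * A ^ k / R ^ (2 * k)).toNNReal * D, fun a G hG => ?_⟩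
  -- Subharmonicity says nothing directly about ν-means. Instead pass to a maximum point z₀ of Ψ, at
  -- distance d from the circle. There |G| ≤ 2^k |G(z₀)| on D(z₀,d/2), hence |G| ≥ |G(z₀)|/2 on the
  -- smaller disk D(z₀,d/A). That disk may have mass as small as d^k, but the maximality |G(a)| R^k
  -- ≤ |G(z₀)| d^k pays for the loss.
  set Ψ : ℂ → ℝ := fun z => ‖G z‖ * (R - dist z a) ^ k with hΨ
  have hcont : ContinuousOn Ψ (Metric.closedBall a R) := by
    have := hG.continuous
    fun_prop
  obtain ⟨z₀, hz₀, hmax⟩ := (isCompact_closedBall a R).exists_isMaxOn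
    ⟨a, Metric.mem_closedBall_self hR.le⟩ hcont
  have hmax' : ∀ z, dist z a ≤ R → ‖G z‖ * (R - dist z a) ^ k ≤ ‖G z₀‖ * (R - dist z₀ a) ^ k :=
    fun z hz => hmax hz
  have hdist0 : 0 ≤ dist z₀ a := dist_nonneg
  have hGa : ‖G a‖ * R ^ k ≤ ‖G z₀‖ * (R - dist z₀ a) ^ k := by
    simpa using hmax' a (by simpa using hR.le)
  set d := R - dist z₀ a with hd
  have hd0 : 0 ≤ d := by
    have := Metric.mem_closedBall.1 hz₀
    linarith
  have hdR : d ≤ R := by linarith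
  rcases eq_or_ne (G a) 0 with h0 | h0
  · simp [h0]
  have hGa0 : 0 < ‖G a‖ := norm_pos_iff.2 h0
  have hprod : 0 < ‖G z₀‖ * d ^ k := lt_of_lt_of_le (by positivity) hGa
  have hGz : 0 < ‖G z₀‖ := pos_of_mul_pos_left hprod (by positivity)
  have hdk : 0 < d ^ k := pos_of_mul_pos_right hprod (by positivity)
  have hdpos : 0 < d := by
    refine lt_of_le_of_ne hd0 fun h => ?_
    rw [← h, zero_pow (by omega)] at hdk
    exact lt_irrefl _ hdk
  have hbd : ∀ z ∈ Metric.ball z₀ (d / 2), ‖G z‖ ≤ 2 ^ k * ‖G z₀‖ := by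
    intro z hz
    have h1 : dist z a ≤ R - d / 2 := by
      have := dist_triangle z z₀ a
      have := Metric.mem_ball.1 hz
      linarith
    have h2 := hmax' z (by linarith)
    have h3 : ‖G z‖ * (d / 2) ^ k ≤ ‖G z₀‖ * d ^ k := by
      refine le_trans ?_ h2
      gcongr
      linarith
    rw [div_pow, mul_div_assoc', div_le_iff₀ (by positivity)] at h3
    exact le_of_mul_le_mul_right (by linarith) hdk
  set ρ := d / A with hρ
  have hρ0 : 0 < ρ := by positivity
  have h2k : (1 : ℝ) ≤ 2 ^ k := one_le_pow₀ (by norm_num)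
  have hρd : ρ ≤ d / 2 := by
    rw [hρ]
    gcongr
    linarith
  have hlow : ∀ z ∈ Metric.ball z₀ ρ, ‖G z₀‖ / 2 ≤ ‖G z‖ := by
    intro z hz
    have hz' := Metric.ball_subset_ball hρd hz
    have hmaps : MapsTo G (Metric.ball z₀ (d / 2))
        (Metric.closedBall (G z₀) ((2 ^ k + 2) * ‖G z₀‖)) := by
      intro y hy
      rw [Metric.mem_closedBall, dist_eq_norm]
      have := norm_sub_le (G y) (G z₀)
      have := hbd y hy
      linarith
    have h1 := Complex.dist_le_div_mul_dist_of_mapsTo_ball hG.differentiableOn hmaps hz'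
    have h2 : dist (G z) (G z₀) ≤ ‖G z₀‖ / 2 := by
      calc _ ≤ (2 ^ k + 2) * ‖G z₀‖ / (d / 2) * ρ := by
            refine h1.trans ?_
            gcongr
            exact (Metric.mem_ball.1 hz).le
        _ = _ := by rw [hρ, hA]; field_simp; norm_num
    rw [dist_eq_norm] at h2
    have := norm_sub_norm_le (G z₀) (G z)
    rw [norm_sub_rev] at this
    linarith
  have hsub : Metric.ball z₀ ρ ⊆ Metric.ball a R := by
    refine Metric.ball_subset_ball' ?_
    linarith
  have hint : ENNReal.ofReal ((‖G z₀‖ / 2) ^ 2) * ν (Metric.ball z₀ ρ) ≤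
      ∫⁻ z in Metric.ball a R, ENNReal.ofReal (‖G z‖ ^ 2) ∂ν := by
    calc _ = ∫⁻ z in Metric.ball z₀ ρ, ENNReal.ofReal ((‖G z₀‖ / 2) ^ 2) ∂ν := by simp
      _ ≤ ∫⁻ z in Metric.ball z₀ ρ, ENNReal.ofReal (‖G z‖ ^ 2) ∂ν := by
          refine setLIntegral_mono' measurableSet_ball fun z hz => ?_
          gcongr
          exact hlow z hz
      _ ≤ _ := lintegral_mono_set hsub
  have hρ1 : ρ ≤ 1 := by linarith
  have hdoub : ENNReal.ofReal ρ ^ k * ν (Metric.ball a 1) ≤ D * ν (Metric.ball z₀ ρ) := by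
    refine le_trans ?_ (hD a z₀ ρ hρ0 hρ1 (by linarith))
    gcongr ?_ * _
    exact pow_le_pow_of_le_one (zero_le) (by simpa using hρ1) (by omega)
  have hreal : ‖G a‖ ^ 2 ≤ 4 * A ^ k / R ^ (2 * k) * ((‖G z₀‖ / 2) ^ 2 * ρ ^ k) := by
    have h1 : (‖G a‖ * R ^ k) ^ 2 ≤ ‖G z₀‖ ^ 2 * d ^ k := by
      calc (‖G a‖ * R ^ k) ^ 2 ≤ (‖G z₀‖ * d ^ k) ^ 2 := by gcongr
        _ = ‖G z₀‖ ^ 2 * (d ^ k * d ^ k) := by ring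
        _ ≤ ‖G z₀‖ ^ 2 * (d ^ k * 1) := by
            gcongr
            exact pow_le_one₀ hd0 (by linarith)
        _ = _ := by ring
    calc ‖G a‖ ^ 2 = (‖G a‖ * R ^ k) ^ 2 / R ^ (2 * k) := by
          rw [mul_pow, ← pow_mul, mul_comm k 2]; field_simp
      _ ≤ ‖G z₀‖ ^ 2 * d ^ k / R ^ (2 * k) := by gcongr
      _ = _ := by
          rw [hρ]
          simp only [div_pow]
          field_simp
          norm_num
  calc ENNReal.ofReal (‖G a‖ ^ 2) * ν (Metric.ball a 1)
      ≤ ENNReal.ofReal (4 * A ^ k / R ^ (2 * k) * ((‖G z₀‖ / 2) ^ 2 * ρ ^ k)) *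
        ν (Metric.ball a 1) := by gcongr
    _ = ENNReal.ofReal (4 * A ^ k / R ^ (2 * k)) * ENNReal.ofReal ((‖G z₀‖ / 2) ^ 2) *
        (ENNReal.ofReal ρ ^ k * ν (Metric.ball a 1)) := by
        rw [ENNReal.ofReal_mul (by positivity), ENNReal.ofReal_mul (by positivity),
          ENNReal.ofReal_pow hρ0.le]
        ring
    _ ≤ ENNReal.ofReal (4 * A ^ k / R ^ (2 * k)) * ENNReal.ofReal ((‖G z₀‖ / 2) ^ 2) *
        (D * ν (Metric.ball z₀ ρ)) := by gcongr
    _ = ((4 * A ^ k / R ^ (2 * k)).toNNReal * D : ℝ≥0) *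
        (ENNReal.ofReal ((‖G z₀‖ / 2) ^ 2) * ν (Metric.ball z₀ ρ)) := by
        rw [ENNReal.coe_mul]
        change _ = ENNReal.ofReal _ * _ * _
        ring
    _ ≤ _ := by gcongr

/-- The function `|F(z)|² e^{-α|z|²}`. -/
noncomputable def fockDensity (α : ℝ) (F : ℂ → ℂ) (z : ℂ) : ℝ≥0∞ :=
  ENNReal.ofReal (‖F z‖ ^ 2 * Real.exp (-α * ‖z‖ ^ 2))

lemma measurable_fockDensity (α : ℝ) {F : ℂ → ℂ} (hF : Continuous F) :
    Measurable (fockDensity α F) := by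
  unfold fockDensity
  fun_prop

/-- Multiplication by a zero free entire function which moves the Gaussian weight to `a`. -/
noncomputable def twist (α : ℝ) (a : ℂ) (F : ℂ → ℂ) (z : ℂ) : ℂ :=
  F z * Complex.exp (-(α * starRingEnd ℂ a * (z - a)) - α * ‖a‖ ^ 2 / 2)

lemma differentiable_twist (α : ℝ) (a : ℂ) {F : ℂ → ℂ} (hF : Differentiable ℂ F) :
    Differentiable ℂ (twist α a F) := by
  unfold twist
  fun_prop

/-- Completing the square: −α Re(ā(z−a)) − α|a|²/2 = −α|z|²/2 + α|z−a|²/2. Near a the Gaussian is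
thus absorbed into an entire function, up to a bounded factor. -/
lemma norm_twist (α : ℝ) (a : ℂ) (F : ℂ → ℂ) (z : ℂ) :
    ‖twist α a F z‖ = ‖F z‖ * Real.exp (-α / 2 * ‖z‖ ^ 2) * Real.exp (α / 2 * ‖z - a‖ ^ 2) := by
  rw [twist, norm_mul, Complex.norm_exp, mul_assoc ‖F z‖, ← Real.exp_add]
  congr 2
  simp only [Complex.sq_norm, Complex.normSq_apply, Complex.sub_re, Complex.neg_re, Complex.mul_re,
    Complex.mul_im, Complex.ofReal_re, Complex.ofReal_im, Complex.conj_re, Complex.conj_im,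
    Complex.sub_im, ← Complex.ofReal_pow, ← Complex.ofReal_mul, ← Complex.ofReal_ofNat,
    ← Complex.ofReal_div]
  ring

lemma norm_twist_sq (α : ℝ) (a : ℂ) (F : ℂ → ℂ) (z : ℂ) :
    ‖twist α a F z‖ ^ 2 = ‖F z‖ ^ 2 * Real.exp (-α * ‖z‖ ^ 2) * Real.exp (α * ‖z - a‖ ^ 2) := by
  rw [norm_twist, mul_pow, mul_pow, ← Real.exp_nat_mul, ← Real.exp_nat_mul]
  push_cast
  congr 2
  · ring_nf
  · ring_nf

/-- The unweighted estimate applied to the twist of F at a: the extra factor e^{α|z−a|²} is 1 at the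
centre and at most e^α on the disk. -/
lemma LocallyDoubling.exists_fockDensity_le {ν : Measure ℂ} (hν : LocallyDoubling ν) {α : ℝ}
    (hα : 0 < α) {R : ℝ} (hR : 0 < R) (hR1 : R ≤ 1) :
    ∃ C : ℝ≥0, ∀ a : ℂ, ∀ F : ℂ → ℂ, Differentiable ℂ F →
      fockDensity α F a * ν (Metric.ball a 1) ≤
        C * ∫⁻ z in Metric.ball a R, fockDensity α F z ∂ν := by
  obtain ⟨C, hC⟩ := hν.exists_sq_norm_le hR hR1
  refine ⟨C * (Real.exp α).toNNReal, fun a F hF => ?_⟩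
  have h := hC a _ (differentiable_twist α a hF)
  have h0 : ENNReal.ofReal (‖twist α a F a‖ ^ 2) = fockDensity α F a := by
    simp [norm_twist_sq, fockDensity]
  rw [h0] at h
  refine h.trans ?_
  rw [ENNReal.coe_mul, mul_assoc]
  gcongr _ * ?_
  rw [← lintegral_const_mul' _ _ (by simp)]
  refine setLIntegral_mono' measurableSet_ball fun z hz => ?_
  rw [norm_twist_sq, fockDensity, ENNReal.ofReal_mul (by positivity), mul_comm]
  gcongr ?_ * _
  refine ENNReal.ofReal_le_ofReal (Real.exp_le_exp.2 ?_)
  have : ‖z - a‖ ≤ 1 := by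
    rw [← dist_eq_norm]
    exact (Metric.mem_ball.1 hz).le.trans hR1
  calc α * ‖z - a‖ ^ 2 ≤ α * 1 ^ 2 := by gcongr
    _ = α := by ring

end WeightedFock


namespace WeightedFock

/-! ### The Hilbert space structure of the weighted Fock space -/

/-- The standing assumptions: `α > 0`, and `w` is a weight with a locally doubling mass. -/
class Admissible (α : ℝ) (w : ℂ → ℝ) : Prop where
  pos : 0 < α
  weight : IsWeight w
  doubling : LocallyDoubling (weightMeasure w)

variable {α : ℝ} {w : ℂ → ℝ}

/-- A shortcut which makes the lemmas on inner product spaces applicable by rewriting. -/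
noncomputable instance : Inner ℂ (FockSpace α w) := InnerProductSpace.toInner

lemma fockMeasure_eq [h : Admissible α w] : fockMeasure α w =
    (weightMeasure w).withDensity fun z => ENNReal.ofReal (Real.exp (-α * ‖z‖ ^ 2)) := by
  rw [weightMeasure, ← withDensity_mul₀ h.weight.aemeasurable (by fun_prop)]
  unfold fockMeasure
  congr 1
  ext z
  rw [ENNReal.ofReal_mul (by positivity), mul_comm, Pi.mul_apply]

lemma ae_fockMeasure_iff [h : Admissible α w] {p : ℂ → Prop} :
    (∀ᵐ z ∂fockMeasure α w, p z) ↔ ∀ᵐ z ∂weightMeasure w, p z := by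
  rw [fockMeasure_eq, ae_withDensity_iff (by fun_prop)]
  simp [Real.exp_pos]

/-- Every disk has positive mass, so the open set where F and G differ is empty once it is null.
This makes the chosen entire representative independent of the choice. -/
lemma eq_of_ae_eq [h : Admissible α w] {F G : ℂ → ℂ} (hF : Continuous F) (hG : Continuous G)
    (hFG : F =ᵐ[fockMeasure α w] G) : F = G := by
  by_contra hne
  obtain ⟨z, hz⟩ := Function.ne_iff.1 hne
  obtain ⟨r, hr, hball⟩ := Metric.isOpen_iff.1 (isOpen_ne_fun hF hG) z hz
  have h0 : weightMeasure w {x | F x ≠ G x} = 0 := ae_fockMeasure_iff.1 hFG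
  exact (h.doubling.pos z hr).ne' (measure_mono_null hball h0)

lemma differentiable_entireRep (f : FockSpace α w) : Differentiable ℂ (entireRep f) :=
  f.2.choose_spec.1

lemma continuous_entireRep (f : FockSpace α w) : Continuous (entireRep f) :=
  (differentiable_entireRep f).continuous

lemma coeFn_ae_eq_entireRep (f : FockSpace α w) :
    ((f : Lp ℂ 2 (fockMeasure α w)) : ℂ → ℂ) =ᵐ[fockMeasure α w] entireRep f :=
  f.2.choose_spec.2

lemma entireRep_eq [Admissible α w] {f : FockSpace α w} {F : ℂ → ℂ} (hF : Continuous F)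
    (hf : ((f : Lp ℂ 2 (fockMeasure α w)) : ℂ → ℂ) =ᵐ[fockMeasure α w] F) : entireRep f = F :=
  eq_of_ae_eq (continuous_entireRep f) hF ((coeFn_ae_eq_entireRep f).symm.trans hf)

lemma entireRep_add [Admissible α w] (f g : FockSpace α w) (z : ℂ) :
    entireRep (f + g) z = entireRep f z + entireRep g z := by
  rw [entireRep_eq ((continuous_entireRep f).add (continuous_entireRep g)) ?_, Pi.add_apply]
  exact (Lp.coeFn_add _ _).trans ((coeFn_ae_eq_entireRep f).add (coeFn_ae_eq_entireRep g))

lemma entireRep_smul [Admissible α w] (c : ℂ) (f : FockSpace α w) (z : ℂ) :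
    entireRep (c • f) z = c * entireRep f z := by
  rw [entireRep_eq (F := fun z => c * entireRep f z) ((continuous_entireRep f).const_mul c)]
  exact (Lp.coeFn_smul _ _).trans ((coeFn_ae_eq_entireRep f).const_smul c)

lemma entireRep_sub [Admissible α w] (f g : FockSpace α w) (z : ℂ) :
    entireRep (f - g) z = entireRep f z - entireRep g z := by
  have := entireRep_add (f - g) g z
  rw [sub_add_cancel] at this
  rw [this, add_sub_cancel_right]

lemma lintegral_fockMeasure [Admissible α w] {g : ℂ → ℝ≥0∞} (hg : Measurable g) :
    ∫⁻ z, g z ∂fockMeasure α w =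
      ∫⁻ z, ENNReal.ofReal (Real.exp (-α * ‖z‖ ^ 2)) * g z ∂weightMeasure w := by
  rw [fockMeasure_eq, lintegral_withDensity_eq_lintegral_mul _ (by fun_prop) hg]
  rfl

lemma lintegral_enorm_sq [Admissible α w] {F : ℂ → ℂ} (hF : Continuous F) :
    ∫⁻ z, ‖F z‖ₑ ^ 2 ∂fockMeasure α w = ∫⁻ z, fockDensity α F z ∂weightMeasure w := by
  rw [lintegral_fockMeasure (by fun_prop)]
  refine lintegral_congr fun z => ?_
  rw [fockDensity, mul_comm, ENNReal.ofReal_mul (by positivity), ENNReal.ofReal_pow (norm_nonneg _),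
    ofReal_norm]

lemma enorm_Lp_sq {X : Type*} [MeasurableSpace X] {μ : Measure X} (f : Lp ℂ 2 μ) :
    ENNReal.ofReal (‖f‖ ^ 2) = ∫⁻ z, ‖f z‖ₑ ^ 2 ∂μ := by
  rw [ENNReal.ofReal_pow (norm_nonneg _), ofReal_norm, Lp.enorm_def,
    eLpNorm_eq_lintegral_rpow_enorm_toReal (by simp) (by simp)]
  simp only [ENNReal.toReal_ofNat, ENNReal.rpow_ofNat]
  rw [← ENNReal.rpow_natCast, ← ENNReal.rpow_mul]
  simp

lemma ofReal_norm_sq [Admissible α w] (f : FockSpace α w) :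
    ENNReal.ofReal (‖f‖ ^ 2) = ∫⁻ z, fockDensity α (entireRep f) z ∂weightMeasure w := by
  rw [← lintegral_enorm_sq (continuous_entireRep f), Submodule.coe_norm, enorm_Lp_sq]
  refine lintegral_congr_ae ?_
  filter_upwards [coeFn_ae_eq_entireRep f] with z hz
  rw [hz]

lemma exists_fockDensity_entireRep_le (α : ℝ) (w : ℂ → ℝ) [h : Admissible α w] :
    ∃ C : ℝ≥0, ∀ (f : FockSpace α w) (a : ℂ),
      fockDensity α (entireRep f) a * weightMeasure w (Metric.ball a 1) ≤
        C * ENNReal.ofReal (‖f‖ ^ 2) := by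
  obtain ⟨C, hC⟩ := h.doubling.exists_fockDensity_le h.pos one_pos le_rfl
  refine ⟨C, fun f a => (hC a _ (differentiable_entireRep f)).trans ?_⟩
  rw [ofReal_norm_sq]
  gcongr
  exact Measure.restrict_le_self

/-- Point evaluations are locally uniformly bounded. -/
lemma exists_norm_entireRep_le (α : ℝ) (w : ℂ → ℝ) [h : Admissible α w] (R : ℝ) :
    ∃ C : ℝ, 0 ≤ C ∧ ∀ (f : FockSpace α w) (z : ℂ), ‖z‖ ≤ R → ‖entireRep f z‖ ≤ C * ‖f‖ := by
  obtain ⟨C, hC⟩ := exists_fockDensity_entireRep_le α w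
  obtain ⟨D, hD1, hD⟩ := h.doubling.exists_le 1 R one_pos
  set m := (weightMeasure w (Metric.ball 0 1)).toReal with hm
  have hm0 : 0 < m := ENNReal.toReal_pos (h.doubling.pos 0 one_pos).ne' (h.doubling.finite 0 1)
  have hD0 : (0 : ℝ) < D := lt_of_lt_of_le one_pos (by exact_mod_cast hD1)
  have hα := h.pos
  refine ⟨√(Real.exp (α * R ^ 2) * C * D / m), by positivity, fun f z hz => ?_⟩
  have h1 : fockDensity α (entireRep f) z * weightMeasure w (Metric.ball 0 1) ≤
      D * C * ENNReal.ofReal (‖f‖ ^ 2) := by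
    calc _ ≤ fockDensity α (entireRep f) z * (D * weightMeasure w (Metric.ball z 1)) := by
          gcongr
          exact hD 0 z (by simpa using hz)
      _ = D * (fockDensity α (entireRep f) z * weightMeasure w (Metric.ball z 1)) := by ring
      _ ≤ D * (C * ENNReal.ofReal (‖f‖ ^ 2)) := mul_le_mul_right (hC f z) _
      _ = _ := by ring
  have h2 := ENNReal.toReal_mono (by finiteness) h1
  rw [ENNReal.toReal_mul, ENNReal.toReal_mul, ENNReal.toReal_mul, fockDensity,
    ENNReal.toReal_ofReal (by positivity), ENNReal.toReal_ofReal (by positivity), ← hm] at h2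
  simp only [ENNReal.coe_toReal] at h2
  refine le_of_sq_le_sq ?_ (by positivity) |> fun h => h
  rw [mul_pow, Real.sq_sqrt (by positivity)]
  have h3 : Real.exp (-(α * R ^ 2)) ≤ Real.exp (-α * ‖z‖ ^ 2) := by
    rw [neg_mul]; gcongr
  have h4 : ‖entireRep f z‖ ^ 2 * Real.exp (-(α * R ^ 2)) * m ≤ D * C * ‖f‖ ^ 2 := by
    refine le_trans ?_ h2
    gcongr
  rw [Real.exp_neg] at h4
  have hE := Real.exp_pos (α * R ^ 2)
  calc ‖entireRep f z‖ ^ 2 = (‖entireRep f z‖ ^ 2 * (Real.exp (α * R ^ 2))⁻¹ * m) *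
        (Real.exp (α * R ^ 2) / m) := by field_simp
    _ ≤ (D * C * ‖f‖ ^ 2) * (Real.exp (α * R ^ 2) / m) := by gcongr
    _ = _ := by ring

/-- Locally uniform bounds on point evaluations turn norm convergence into locally uniform
convergence, so the representatives have an entire limit. A subsequence converging almost everywhere
identifies it with the limit in L². -/
instance isClosed_fockSpace [h : Admissible α w] :
    IsClosed (FockSpace α w : Set (Lp ℂ 2 (fockMeasure α w))) := by
  refine IsSeqClosed.isClosed fun u f hu hf => ?_
  lift u to ℕ → FockSpace α w using hu
  have hC : ∀ R : ℝ, UniformCauchySeqOn (fun n => entireRep (u n)) atTop (Metric.closedBall 0 R) := by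
    intro R
    obtain ⟨C, hC0, hC⟩ := exists_norm_entireRep_le α w R
    rw [Metric.uniformCauchySeqOn_iff]
    intro ε hε
    have hcau := hf.cauchySeq
    rw [Metric.cauchySeq_iff] at hcau
    obtain ⟨N, hN⟩ := hcau (ε / (C + 1)) (by positivity)
    refine ⟨N, fun m hm n hn z hz => ?_⟩
    have h1 := hN m hm n hn
    rw [dist_eq_norm, ← entireRep_sub]
    have h2 : ‖u m - u n‖ < ε / (C + 1) := by
      rw [dist_eq_norm] at h1
      exact h1
    calc _ ≤ C * ‖u m - u n‖ := hC _ z (by simpa using hz)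
      _ ≤ (C + 1) * ‖u m - u n‖ := by gcongr; linarith
      _ < (C + 1) * (ε / (C + 1)) := by gcongr
      _ = ε := by field_simp
  have hpt : ∀ z : ℂ, ∃ y, Tendsto (fun n => entireRep (u n) z) atTop (𝓝 y) := fun z =>
    cauchySeq_tendsto_of_complete ((hC ‖z‖).cauchySeq (by simp))
  choose F hF using hpt
  have hloc : TendstoLocallyUniformlyOn (fun n => entireRep (u n)) F atTop univ := by
    rw [tendstoLocallyUniformlyOn_iff_forall_isCompact isOpen_univ]
    intro K _ hK
    obtain ⟨R, hR⟩ := hK.isBounded.subset_closedBall 0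
    exact ((hC R).tendstoUniformlyOn_of_tendsto fun z _ => hF z).mono hR
  have hFd : Differentiable ℂ F := differentiableOn_univ.1
    (hloc.differentiableOn (Eventually.of_forall fun n =>
      (differentiable_entireRep (u n)).differentiableOn) isOpen_univ)
  refine ⟨F, hFd, ?_⟩
  have hmeas := tendstoInMeasure_of_tendsto_Lp hf
  obtain ⟨ns, hns, hae⟩ := hmeas.exists_seq_tendsto_ae
  have hall : ∀ᵐ z ∂fockMeasure α w, ∀ n, (u n : Lp ℂ 2 (fockMeasure α w)) z = entireRep (u n) z :=
    ae_all_iff.2 fun n => coeFn_ae_eq_entireRep (u n)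
  filter_upwards [hae, hall] with z hz hz'
  simp only [hz'] at hz
  exact tendsto_nhds_unique hz ((hF z).comp hns.tendsto_atTop)

instance [Admissible α w] : CompleteSpace (FockSpace α w) :=
  (isClosed_fockSpace (α := α) (w := w)).completeSpace_coe

/-- The evaluation at `z`, as a continuous linear functional. -/
noncomputable def evalCLM (α : ℝ) (w : ℂ → ℝ) [Admissible α w] (z : ℂ) : FockSpace α w →L[ℂ] ℂ :=
  LinearMap.mkContinuousOfExistsBound
    { toFun := fun f => entireRep f z
      map_add' := fun f g => entireRep_add f g z
      map_smul' := fun c f => entireRep_smul c f z }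
    (by
      obtain ⟨C, -, hC⟩ := exists_norm_entireRep_le α w ‖z‖
      exact ⟨C, fun f => hC f z le_rfl⟩)

/-- The reproducing property. -/
lemma entireRep_eq_inner [Admissible α w] (f : FockSpace α w) (z : ℂ) :
    entireRep f z = inner ℂ (kernel α w z) f := by
  have h : ∃ k : FockSpace α w, ∀ f : FockSpace α w, entireRep f z = inner ℂ k f :=
    ⟨(InnerProductSpace.toDual ℂ _).symm (evalCLM α w z), fun f =>
      (InnerProductSpace.toDual_symm_apply (x := f) (y := evalCLM α w z)).symm⟩
  have h' : kernel α w z = h.choose := dif_pos h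
  rw [h']
  exact h.choose_spec f

lemma entireRep_kernel_symm [Admissible α w] (z ζ : ℂ) :
    entireRep (kernel α w z) ζ = starRingEnd ℂ (entireRep (kernel α w ζ) z) := by
  rw [entireRep_eq_inner, entireRep_eq_inner, inner_conj_symm]

lemma entireRep_kernel_self [Admissible α w] (z : ℂ) :
    entireRep (kernel α w z) z = ((‖kernel α w z‖ ^ 2 : ℝ) : ℂ) := by
  rw [entireRep_eq_inner, inner_self_eq_norm_sq_to_K]
  simp

lemma norm_entireRep_le [Admissible α w] (f : FockSpace α w) (z : ℂ) :
    ‖entireRep f z‖ ≤ ‖kernel α w z‖ * ‖f‖ := by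
  rw [entireRep_eq_inner]
  exact norm_inner_le_norm _ _

/-- Duality: for f = B_z − B_a the difference f(z) − f(a) equals ‖f‖². -/
lemma norm_sub_kernel_le [Admissible α w] {C : ℝ} (hC : 0 ≤ C) {z a : ℂ}
    (h : ∀ f : FockSpace α w, ‖entireRep f z - entireRep f a‖ ≤ C * ‖f‖) :
    ‖kernel α w z - kernel α w a‖ ≤ C := by
  have := h (kernel α w z - kernel α w a)
  rw [entireRep_eq_inner _ z, entireRep_eq_inner _ a, ← inner_sub_left,
    inner_self_eq_norm_sq_to_K] at this
  set t := ‖kernel α w z - kernel α w a‖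
  have ht : 0 ≤ t := norm_nonneg _
  have h' : t * t ≤ C * t := by
    rw [← sq]
    simpa using this
  rcases ht.eq_or_lt with h0 | h0
  · rw [← h0]; exact hC
  · exact le_of_mul_le_mul_right h' h0

/-- The reproducing kernels depend continuously on the point. -/
lemma continuous_kernel [Admissible α w] : Continuous (kernel α w) := by
  rw [continuous_iff_continuousAt]
  intro a
  obtain ⟨C, hC0, hC⟩ := exists_norm_entireRep_le α w (‖a‖ + 1)
  rw [ContinuousAt, tendsto_iff_norm_sub_tendsto_zero]
  have hlim : Tendsto (fun z => 2 * C * dist z a) (𝓝 a) (𝓝 0) := by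
    have : Continuous fun z : ℂ => 2 * C * dist z a := by fun_prop
    simpa using this.tendsto a
  refine squeeze_zero' (Eventually.of_forall fun z => norm_nonneg _) ?_ hlim
  filter_upwards [Metric.ball_mem_nhds a one_pos] with z hz
  refine norm_sub_kernel_le (by positivity) fun f => ?_
  have hball : ∀ y ∈ Metric.ball a 1, ‖y‖ ≤ ‖a‖ + 1 := by
    intro y hy
    have h1 := Metric.mem_ball.1 hy
    rw [dist_eq_norm] at h1
    have := norm_le_norm_add_norm_sub' y a
    linarith
  -- A holomorphic function bounded by C‖f‖ on D(a,1) is Lipschitz at a with constant 2C‖f‖, by the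
  -- Schwarz lemma; the constant is uniform in f.
  have hmaps : MapsTo (entireRep f) (Metric.ball a 1)
      (Metric.closedBall (entireRep f a) (2 * C * ‖f‖)) := by
    intro y hy
    rw [Metric.mem_closedBall, dist_eq_norm]
    have h1 := hC f y (hball y hy)
    have h2 := hC f a (by linarith [norm_nonneg a])
    have := norm_sub_le (entireRep f y) (entireRep f a)
    linarith
  have := Complex.dist_le_div_mul_dist_of_mapsTo_ball
    (differentiable_entireRep f).differentiableOn hmaps hz
  rw [dist_eq_norm, div_one] at this
  linarith

/-- An entire function with finite norm defines an element of the Fock space. -/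
lemma exists_entireRep_eq [Admissible α w] {F : ℂ → ℂ} (hF : Differentiable ℂ F)
    (hfin : ∫⁻ z, fockDensity α F z ∂weightMeasure w ≠ ∞) :
    ∃ f : FockSpace α w, entireRep f = F := by
  have hmem : MemLp F 2 (fockMeasure α w) := by
    refine ⟨hF.continuous.aestronglyMeasurable, ?_⟩
    rw [eLpNorm_lt_top_iff_lintegral_rpow_enorm_lt_top (by simp) (by simp)]
    simp only [ENNReal.toReal_ofNat, ENNReal.rpow_ofNat]
    rw [lintegral_enorm_sq hF.continuous]
    exact hfin.lt_top
  exact ⟨⟨hmem.toLp F, F, hF, hmem.coeFn_toLp⟩, entireRep_eq hF.continuous hmem.coeFn_toLp⟩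

end WeightedFock


namespace WeightedFock

/-! ### Estimates for the reproducing kernel -/

/-- Tonelli's theorem, because y ∈ D(x,r) is a symmetric relation. This is how local means over
disks are moved from one measure to another. -/
lemma lintegral_ball_swap {μ ν : Measure ℂ} [SFinite μ] [SFinite ν] (r : ℝ) {f : ℂ → ℂ → ℝ≥0∞}
    (hf : Measurable (Function.uncurry f)) :
    ∫⁻ x, ∫⁻ y in Metric.ball x r, f x y ∂ν ∂μ = ∫⁻ y, ∫⁻ x in Metric.ball y r, f x y ∂μ ∂ν := by
  have hset : MeasurableSet {p : ℂ × ℂ | dist p.2 p.1 < r} :=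
    measurableSet_lt (by fun_prop) measurable_const
  have h1 : ∀ x, ∫⁻ y in Metric.ball x r, f x y ∂ν =
      ∫⁻ y, {p : ℂ × ℂ | dist p.2 p.1 < r}.indicator (Function.uncurry f) (x, y) ∂ν := fun x => by
    rw [← lintegral_indicator measurableSet_ball]
    rfl
  have h2 : ∀ y, ∫⁻ x in Metric.ball y r, f x y ∂μ =
      ∫⁻ x, {p : ℂ × ℂ | dist p.2 p.1 < r}.indicator (Function.uncurry f) (x, y) ∂μ := fun y => by
    rw [← lintegral_indicator measurableSet_ball]
    refine lintegral_congr fun x => ?_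
    simp only [indicator, Metric.mem_ball, mem_ofPred_eq, dist_comm, Function.uncurry]
  simp only [h1, h2]
  exact lintegral_lintegral_swap (hf.indicator hset).aemeasurable

lemma measurable_measure_ball (μ : Measure ℂ) [SFinite μ] (r : ℝ) :
    Measurable fun z => μ (Metric.ball z r) := by
  have hset : MeasurableSet {p : ℂ × ℂ | dist p.2 p.1 < r} :=
    measurableSet_lt (by fun_prop) measurable_const
  exact measurable_measure_prodMk_left hset

lemma lintegral_one_add_norm_lt_top :
    ∫⁻ z : ℂ, ENNReal.ofReal ((1 + ‖z‖) ^ (-3 : ℝ)) < ∞ :=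
  finite_integral_one_add_norm (by simp [Complex.finrank_real_complex]; norm_num)

/-- From (1+t)³/3! ≤ e^{1+t}. The power −3 is integrable over the plane. -/
lemma exp_neg_le_one_add_rpow {t : ℝ} (ht : 0 ≤ t) :
    Real.exp (-t) ≤ 6 * Real.exp 1 * (1 + t) ^ (-3 : ℝ) := by
  have h := Real.pow_div_factorial_le_exp (1 + t) (by positivity) 3
  rw [Real.rpow_neg (by positivity), Real.exp_neg, show (3 : ℝ) = (3 : ℕ) by norm_num,
    Real.rpow_natCast]
  rw [Real.exp_add] at h
  have h6 : ((Nat.factorial 3 : ℕ) : ℝ) = 6 := by norm_num [Nat.factorial]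
  rw [h6, div_le_iff₀ (by norm_num)] at h
  have he := Real.exp_pos t
  rw [inv_le_iff_one_le_mul₀ he, ← div_eq_mul_inv, mul_comm, ← mul_div_assoc,
    one_le_div (by positivity)]
  linarith

/-- Dominate the Gaussian at z by the integral of e^{-(L+1)|u−a|} over u ∈ D(z,1) and swap. The
inner integral becomes ν(D(u,1)), which grows at most like e^{L|u−a|} ν(D(a,1)), and the surplus
decay e^{-|u−a|} is integrable. -/
lemma LocallyDoubling.exists_lintegral_gaussian_le {ν : Measure ℂ} (hν : LocallyDoubling ν) {α : ℝ}
    (hα : 0 < α) : ∃ C : ℝ≥0, ∀ a : ℂ,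
      ∫⁻ z, ENNReal.ofReal (Real.exp (-α * ‖z - a‖ ^ 2)) ∂ν ≤ C * ν (Metric.ball a 1) := by
  obtain ⟨L, hL0, hL⟩ := hν.exists_growth
  have := hν.isLocallyFiniteMeasure
  -- The first term is from (L+1)t ≤ (L+1)²/(4α) + αt², the second from |u−a| ≤ |z−a| + 1.
  set K : ℝ := Real.exp ((L + 1) ^ 2 / (4 * α) + (L + 1)) with hK
  set V : ℝ≥0∞ := volume (Metric.ball (0 : ℂ) 1) with hV
  have hV0 : V ≠ 0 := (Metric.measure_ball_pos volume (0 : ℂ) one_pos).ne'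
  have hVt : V ≠ ∞ := measure_ball_lt_top.ne
  set J : ℝ≥0∞ := ∫⁻ z : ℂ, ENNReal.ofReal ((1 + ‖z‖) ^ (-3 : ℝ)) with hJ
  set D : ℝ≥0∞ := ENNReal.ofReal (K * Real.exp L * (6 * Real.exp 1)) * J / V with hD
  have hDt : D ≠ ∞ :=
    ENNReal.div_ne_top (ENNReal.mul_ne_top (by simp) lintegral_one_add_norm_lt_top.ne) hV0
  refine ⟨D.toNNReal, fun a => ?_⟩
  rw [ENNReal.coe_toNNReal hDt]
  set g : ℂ → ℝ≥0∞ := fun u => ENNReal.ofReal (K * Real.exp (-(L + 1) * ‖u - a‖)) with hg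
  have hgm : Measurable g := by fun_prop
  have h1 : ∀ z, ENNReal.ofReal (Real.exp (-α * ‖z - a‖ ^ 2)) * V ≤
      ∫⁻ u in Metric.ball z 1, g u := by
    intro z
    have hVz : V = volume (Metric.ball z 1) := by simp only [hV, Complex.volume_ball]
    rw [hVz, ← setLIntegral_const]
    refine setLIntegral_mono' measurableSet_ball fun u hu => ENNReal.ofReal_le_ofReal ?_
    rw [hK, ← Real.exp_add]
    refine Real.exp_le_exp.2 ?_
    have hu1 : ‖u - a‖ ≤ ‖z - a‖ + 1 := by
      have h2 := dist_triangle u z a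
      have h3 := Metric.mem_ball.1 hu
      rw [dist_eq_norm, dist_eq_norm z a] at h2
      linarith
    have h4 : (L + 1) * ‖u - a‖ ≤ (L + 1) * (‖z - a‖ + 1) := by gcongr
    have h5 : (L + 1) * ‖z - a‖ ≤ (L + 1) ^ 2 / (4 * α) + α * ‖z - a‖ ^ 2 := by
      have h6 : 0 ≤ (2 * α * ‖z - a‖ - (L + 1)) ^ 2 / (4 * α) := by positivity
      have h7 : (2 * α * ‖z - a‖ - (L + 1)) ^ 2 / (4 * α) =
          (L + 1) ^ 2 / (4 * α) + α * ‖z - a‖ ^ 2 - (L + 1) * ‖z - a‖ := by field_simp; ring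
      linarith
    linarith
  have h2 : (∫⁻ z, ENNReal.ofReal (Real.exp (-α * ‖z - a‖ ^ 2)) ∂ν) * V ≤
      ENNReal.ofReal (K * Real.exp L * (6 * Real.exp 1)) * J * ν (Metric.ball a 1) := by
    calc _ = ∫⁻ z, ENNReal.ofReal (Real.exp (-α * ‖z - a‖ ^ 2)) * V ∂ν :=
          (lintegral_mul_const' _ _ hVt).symm
      _ ≤ ∫⁻ z, (∫⁻ u in Metric.ball z 1, g u) ∂ν := lintegral_mono h1
      _ = ∫⁻ u, ∫⁻ z in Metric.ball u 1, g u ∂ν :=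
          lintegral_ball_swap 1 (f := fun _ u => g u) (hgm.comp measurable_snd)
      _ = ∫⁻ u, g u * ν (Metric.ball u 1) := by simp
      _ ≤ ∫⁻ u, ENNReal.ofReal (K * Real.exp L * (6 * Real.exp 1)) * ν (Metric.ball a 1) *
            ENNReal.ofReal ((1 + ‖u - a‖) ^ (-3 : ℝ)) := by
          refine lintegral_mono fun u => ?_
          calc _ ≤ g u * (ENNReal.ofReal (Real.exp (L * (dist u a + 1))) *
                ν (Metric.ball a 1)) := by gcongr; exact hL a u
            _ = ENNReal.ofReal (K * Real.exp L * Real.exp (-‖u - a‖)) * ν (Metric.ball a 1) := by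
                have e : Real.exp (-(L + 1) * ‖u - a‖) * Real.exp (L * (dist u a + 1)) =
                    Real.exp L * Real.exp (-‖u - a‖) := by
                  rw [← Real.exp_add, ← Real.exp_add, dist_eq_norm]
                  congr 1
                  ring
                rw [hg, ← mul_assoc, ← ENNReal.ofReal_mul (by positivity), mul_assoc K,
                  mul_assoc K, e]
            _ ≤ ENNReal.ofReal (K * Real.exp L * (6 * Real.exp 1 * (1 + ‖u - a‖) ^ (-3 : ℝ))) *
                ν (Metric.ball a 1) := by
                gcongr
                exact exp_neg_le_one_add_rpow (norm_nonneg _)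
            _ = _ := by
                rw [← mul_assoc, ENNReal.ofReal_mul (by positivity)]
                ring
      _ = _ := by
          rw [lintegral_const_mul' _ _ (by finiteness [hν.finite a 1]),
            lintegral_sub_right_eq_self (fun u : ℂ => ENNReal.ofReal ((1 + ‖u‖) ^ (-3 : ℝ))) a]
          ring
  calc _ = (∫⁻ z, ENNReal.ofReal (Real.exp (-α * ‖z - a‖ ^ 2)) ∂ν) * V / V := by
        rw [mul_div_assoc, ENNReal.div_self hV0 hVt, mul_one]
    _ ≤ _ := ENNReal.div_le_div_right h2 V
    _ = _ := by rw [hD]; simp only [div_eq_mul_inv]; ring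

/-- The mass of the unit disk with centre `z`, as a real number. -/
noncomputable def unitMass (w : ℂ → ℝ) (z : ℂ) : ℝ := (weightMeasure w (Metric.ball z 1)).toReal

variable (α : ℝ) (w : ℂ → ℝ)

lemma ofReal_unitMass [h : Admissible α w] (z : ℂ) :
    ENNReal.ofReal (unitMass w z) = weightMeasure w (Metric.ball z 1) :=
  ENNReal.ofReal_toReal (h.doubling.finite z 1)

lemma unitMass_pos [h : Admissible α w] (z : ℂ) : 0 < unitMass w z :=
  ENNReal.toReal_pos (h.doubling.pos z one_pos).ne' (h.doubling.finite z 1)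

/-- Test the evaluation estimate on f = B_z, for which f(z) = ‖f‖², and cancel one factor ‖f‖². -/
lemma exists_norm_kernel_le [h : Admissible α w] : ∃ C : ℝ, 0 < C ∧ ∀ z : ℂ,
    ‖kernel α w z‖ ^ 2 * unitMass w z ≤ C * Real.exp (α * ‖z‖ ^ 2) := by
  obtain ⟨C, hC⟩ := exists_fockDensity_entireRep_le α w
  refine ⟨C + 1, by positivity, fun z => ?_⟩
  rcases eq_or_ne (kernel α w z) 0 with h0 | h0
  · rw [h0]; simp; positivity
  have hk : 0 < ‖kernel α w z‖ := norm_pos_iff.2 h0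
  have h1 := hC (kernel α w z) z
  have hm := unitMass_pos α w z
  rw [← ofReal_unitMass α w, fockDensity, ← ENNReal.ofReal_mul (by positivity),
    ← ENNReal.ofReal_coe_nnreal, ← ENNReal.ofReal_mul (by positivity),
    ENNReal.ofReal_le_ofReal_iff (by positivity), entireRep_kernel_self, Complex.norm_real,
    Real.norm_of_nonneg (by positivity)] at h1
  have h2 : ‖kernel α w z‖ ^ 2 * Real.exp (-α * ‖z‖ ^ 2) * unitMass w z ≤ C := by
    refine le_of_mul_le_mul_right ?_ (pow_pos hk 2)
    calc _ = _ := by ring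
      _ ≤ _ := h1
  rw [neg_mul, Real.exp_neg] at h2
  have hE := Real.exp_pos (α * ‖z‖ ^ 2)
  calc ‖kernel α w z‖ ^ 2 * unitMass w z = (‖kernel α w z‖ ^ 2 * (Real.exp (α * ‖z‖ ^ 2))⁻¹ *
        unitMass w z) * Real.exp (α * ‖z‖ ^ 2) := by field_simp
    _ ≤ C * Real.exp (α * ‖z‖ ^ 2) := by gcongr
    _ ≤ _ := by gcongr; linarith

/-- Test with the unweighted kernel F(z) = e^{αāz}. Its density is e^{α|a|²} times a Gaussian
centred at a, so ‖F‖² ≤ C e^{α|a|²} ν(D(a,1)), while F(a) = e^{α|a|²}. Now use |F(a)| ≤ ‖B_a‖ ‖F‖.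
-/
lemma exists_le_norm_kernel [h : Admissible α w] : ∃ c : ℝ, 0 < c ∧ ∀ z : ℂ,
    c * Real.exp (α * ‖z‖ ^ 2) ≤ ‖kernel α w z‖ ^ 2 * unitMass w z := by
  obtain ⟨C, hC⟩ := h.doubling.exists_lintegral_gaussian_le h.pos
  refine ⟨(C + 1 : ℝ)⁻¹, by positivity, fun a => ?_⟩
  set F : ℂ → ℂ := fun z => Complex.exp (α * starRingEnd ℂ a * z) with hF
  have hFd : Differentiable ℂ F := by fun_prop
  have hdens : ∀ z, fockDensity α F z =
      ENNReal.ofReal (Real.exp (α * ‖a‖ ^ 2)) * ENNReal.ofReal (Real.exp (-α * ‖z - a‖ ^ 2)) := by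
    intro z
    rw [fockDensity, hF, ← ENNReal.ofReal_mul (by positivity), Complex.norm_exp,
      ← Real.exp_nat_mul, ← Real.exp_add, ← Real.exp_add]
    congr 2
    simp only [Complex.sq_norm, Complex.normSq_apply, Complex.sub_re, Complex.mul_re,
      Complex.mul_im, Complex.ofReal_re, Complex.ofReal_im, Complex.conj_re, Complex.conj_im,
      Complex.sub_im]
    push_cast
    ring
  have hm := unitMass_pos α w a
  have hint : ∫⁻ z, fockDensity α F z ∂weightMeasure w ≤
      ENNReal.ofReal (C * Real.exp (α * ‖a‖ ^ 2) * unitMass w a) := by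
    simp only [hdens]
    rw [lintegral_const_mul' _ _ (by simp), ENNReal.ofReal_mul (by positivity),
      ENNReal.ofReal_mul (by positivity), ofReal_unitMass α w, ENNReal.ofReal_coe_nnreal,
      mul_comm (C : ℝ≥0∞), mul_assoc]
    gcongr
    exact hC a
  obtain ⟨f, hf⟩ := exists_entireRep_eq hFd (ne_top_of_le_ne_top (by simp) hint)
  rw [← hf, ← ofReal_norm_sq, ENNReal.ofReal_le_ofReal_iff (by positivity)] at hint
  have h1 := norm_entireRep_le f a
  have h2 : ‖entireRep f a‖ = Real.exp (α * ‖a‖ ^ 2) := by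
    rw [hf, hF, Complex.norm_exp]
    congr 1
    simp only [Complex.sq_norm, Complex.normSq_apply, Complex.mul_re,
      Complex.mul_im, Complex.ofReal_re, Complex.ofReal_im, Complex.conj_re, Complex.conj_im]
    ring
  rw [h2] at h1
  set E := Real.exp (α * ‖a‖ ^ 2)
  have hE : 0 < E := Real.exp_pos _
  have h3 : E * E ≤ (C + 1) * E * (‖kernel α w a‖ ^ 2 * unitMass w a) := by
    calc E * E = E ^ 2 := by ring
      _ ≤ (‖kernel α w a‖ * ‖f‖) ^ 2 := by gcongr
      _ = ‖kernel α w a‖ ^ 2 * ‖f‖ ^ 2 := by ring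
      _ ≤ ‖kernel α w a‖ ^ 2 * (C * E * unitMass w a) := by gcongr
      _ ≤ ‖kernel α w a‖ ^ 2 * ((C + 1) * E * unitMass w a) := by gcongr; linarith
      _ = _ := by ring
  rw [inv_mul_le_iff₀ (by positivity)]
  refine le_of_mul_le_mul_right ?_ hE
  calc _ ≤ _ := h3
    _ = _ := by ring

lemma norm_kernel_pos [h : Admissible α w] (z : ℂ) : 0 < ‖kernel α w z‖ := by
  obtain ⟨c, hc, H⟩ := exists_le_norm_kernel α w
  have h1 := H z
  have h2 : 0 < ‖kernel α w z‖ ^ 2 * unitMass w z := lt_of_lt_of_le (by positivity) h1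
  exact norm_pos_iff.2 fun h0 => by simp [h0] at h2

lemma norm_normalizedKernel [h : Admissible α w] (z : ℂ) : ‖normalizedKernel α w z‖ = 1 := by
  rw [normalizedKernel, norm_smul, Complex.norm_real, norm_inv, norm_norm,
    inv_mul_cancel₀ (norm_kernel_pos α w z).ne']

lemma norm_entireRep_normalizedKernel [h : Admissible α w] (z ζ : ℂ) :
    ‖entireRep (normalizedKernel α w z) ζ‖ = ‖entireRep (kernel α w z) ζ‖ / ‖kernel α w z‖ := by
  rw [normalizedKernel, entireRep_smul, norm_mul, Complex.norm_real, norm_inv, norm_norm,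
    div_eq_inv_mul]

/-- The twisted kernel is at least cX at a and at most C₁X on D(a,1), where X = e^{α|a|²/2} /
ν(D(a,1)). The Schwarz lemma then keeps it above cX/2 near a. The radius r affects only the
constant, through ν(D(a,1)) ≤ K ν(D(a,r)), and not δ. -/
lemma exists_kernelLowerBound [h : Admissible α w] :
    ∃ δ ∈ Ioo (0 : ℝ) 1, KernelLowerBound α w δ := by
  obtain ⟨C, hC0, hC⟩ := exists_norm_kernel_le α w
  obtain ⟨c, hc0, hc⟩ := exists_le_norm_kernel α w
  obtain ⟨D, hD1, hD⟩ := h.doubling.exists_le 1 1 one_pos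
  have hα := h.pos
  have hD1' : (1 : ℝ) ≤ D := by exact_mod_cast hD1
  have hD0 : (0 : ℝ) < D := by linarith
  set C₁ : ℝ := C * D * Real.exp (α / 2) with hC₁
  have hC₁0 : 0 < C₁ := by positivity
  -- The twisted kernel is Lipschitz at a with constant 2C₁X, so within c/(4C₁) it moves by at most
  -- cX/2. The bound 1/2 secures δ < 1.
  refine ⟨min (1 / 2) (c / (4 * C₁)), ⟨by positivity, by
    linarith [min_le_left (1 / 2) (c / (4 * C₁))]⟩, fun r hr => ?_⟩
  obtain ⟨K, hK1, hK⟩ := h.doubling.exists_le 1 0 hr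
  have hK0 : (0 : ℝ) < K := lt_of_lt_of_le one_pos (by exact_mod_cast hK1)
  refine ⟨c / 2 * Real.exp (-(α / 2)) / K, by positivity, fun a z hz => ?_⟩
  have hma := unitMass_pos α w a
  set X : ℝ := Real.exp (α / 2 * ‖a‖ ^ 2) / unitMass w a with hX
  have hX0 : 0 < X := by positivity
  have hza : ‖z - a‖ < min (1 / 2) (c / (4 * C₁)) := by
    rw [← dist_eq_norm]; exact hz
  have hGbd : ∀ y ∈ Metric.ball a 1, ‖twist α a (entireRep (kernel α w a)) y‖ ≤ C₁ * X := by
    intro y hy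
    have hy1 : ‖y - a‖ ≤ 1 := by
      rw [← dist_eq_norm]; exact (Metric.mem_ball.1 hy).le
    have hmy := unitMass_pos α w y
    have hmass : unitMass w a ≤ D * unitMass w y := by
      have := ENNReal.toReal_mono (ENNReal.mul_ne_top (by simp) (h.doubling.finite y 1))
        (hD a y (Metric.mem_ball.1 hy).le)
      rwa [ENNReal.toReal_mul, ENNReal.coe_toReal] at this
    have hprod : ‖entireRep (kernel α w a) y‖ * unitMass w a ≤
        C * D * (Real.exp (α / 2 * ‖a‖ ^ 2) * Real.exp (α / 2 * ‖y‖ ^ 2)) := by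
      refine abs_le_of_sq_le_sq' ?_ (by positivity) |>.2
      have hle : ‖entireRep (kernel α w a) y‖ ≤ ‖kernel α w y‖ * ‖kernel α w a‖ :=
        norm_entireRep_le _ _
      have e1 : ∀ x : ℂ, Real.exp (α * ‖x‖ ^ 2) = Real.exp (α / 2 * ‖x‖ ^ 2) ^ 2 := fun x => by
        rw [← Real.exp_nat_mul]; congr 1; push_cast; ring
      calc (‖entireRep (kernel α w a) y‖ * unitMass w a) ^ 2
          ≤ (‖kernel α w y‖ * ‖kernel α w a‖ * unitMass w a) ^ 2 := by gcongr
        _ = (‖kernel α w a‖ ^ 2 * unitMass w a) * (‖kernel α w y‖ ^ 2 * unitMass w a) := by ring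
        _ ≤ (C * Real.exp (α * ‖a‖ ^ 2)) * (‖kernel α w y‖ ^ 2 * (D * unitMass w y)) := by
            refine mul_le_mul (hC a) ?_ (by positivity) (by positivity)
            gcongr
        _ = (C * Real.exp (α * ‖a‖ ^ 2)) * (D * (‖kernel α w y‖ ^ 2 * unitMass w y)) := by ring
        _ ≤ (C * Real.exp (α * ‖a‖ ^ 2)) * (D * (C * Real.exp (α * ‖y‖ ^ 2))) := by
            exact mul_le_mul_of_nonneg_left (mul_le_mul_of_nonneg_left (hC y) hD0.le) (by positivity)
        _ = C ^ 2 * D * (Real.exp (α / 2 * ‖a‖ ^ 2) * Real.exp (α / 2 * ‖y‖ ^ 2)) ^ 2 := by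
            rw [e1, e1]; ring
        _ ≤ C ^ 2 * D ^ 2 * (Real.exp (α / 2 * ‖a‖ ^ 2) * Real.exp (α / 2 * ‖y‖ ^ 2)) ^ 2 := by
            gcongr
            nlinarith
        _ = _ := by ring
    rw [norm_twist, hX, hC₁, ← mul_div_assoc, le_div_iff₀ hma]
    have hexp : Real.exp (α / 2 * ‖y - a‖ ^ 2) ≤ Real.exp (α / 2) := by
      refine Real.exp_le_exp.2 ?_
      have : ‖y - a‖ ^ 2 ≤ 1 := pow_le_one₀ (norm_nonneg _) hy1
      nlinarith
    have hinv : Real.exp (-α / 2 * ‖y‖ ^ 2) * Real.exp (α / 2 * ‖y‖ ^ 2) = 1 := by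
      rw [← Real.exp_add]; simp; ring
    calc ‖entireRep (kernel α w a) y‖ * Real.exp (-α / 2 * ‖y‖ ^ 2) *
          Real.exp (α / 2 * ‖y - a‖ ^ 2) * unitMass w a
        = (‖entireRep (kernel α w a) y‖ * unitMass w a) * Real.exp (-α / 2 * ‖y‖ ^ 2) *
          Real.exp (α / 2 * ‖y - a‖ ^ 2) := by ring
      _ ≤ (C * D * (Real.exp (α / 2 * ‖a‖ ^ 2) * Real.exp (α / 2 * ‖y‖ ^ 2))) *
          Real.exp (-α / 2 * ‖y‖ ^ 2) * Real.exp (α / 2) := by gcongr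
      _ = C * D * Real.exp (α / 2) * Real.exp (α / 2 * ‖a‖ ^ 2) *
          (Real.exp (-α / 2 * ‖y‖ ^ 2) * Real.exp (α / 2 * ‖y‖ ^ 2)) := by ring
      _ = _ := by rw [hinv, mul_one]
  have hGa : c * X ≤ ‖twist α a (entireRep (kernel α w a)) a‖ := by
    rw [norm_twist, entireRep_kernel_self, Complex.norm_real, Real.norm_of_nonneg (by positivity),
      hX, ← mul_div_assoc, div_le_iff₀ hma]
    have e : Real.exp (α / 2 * ‖a‖ ^ 2) = Real.exp (α * ‖a‖ ^ 2) * Real.exp (-α / 2 * ‖a‖ ^ 2) := by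
      rw [← Real.exp_add]; congr 1; ring
    rw [e]
    simp only [sub_self, norm_zero, ne_eq, OfNat.ofNat_ne_zero, not_false_eq_true, zero_pow,
      mul_zero, Real.exp_zero, mul_one]
    calc _ = (c * Real.exp (α * ‖a‖ ^ 2)) * Real.exp (-α / 2 * ‖a‖ ^ 2) := by ring
      _ ≤ (‖kernel α w a‖ ^ 2 * unitMass w a) * Real.exp (-α / 2 * ‖a‖ ^ 2) := by
          exact mul_le_mul_of_nonneg_right (hc a) (Real.exp_pos _).le
      _ = _ := by ring
  have hz1 : z ∈ Metric.ball a 1 := by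
    rw [Metric.mem_ball, dist_eq_norm]
    have := min_le_left (1 / 2) (c / (4 * C₁))
    linarith
  have hmaps : MapsTo (twist α a (entireRep (kernel α w a))) (Metric.ball a 1)
      (Metric.closedBall (twist α a (entireRep (kernel α w a)) a) (2 * C₁ * X)) := by
    intro y hy
    rw [Metric.mem_closedBall, dist_eq_norm]
    have h1 := norm_sub_le (twist α a (entireRep (kernel α w a)) y)
      (twist α a (entireRep (kernel α w a)) a)
    have h2 := hGbd y hy
    have h3 := hGbd a (Metric.mem_ball_self one_pos)
    linarith
  have hdiff := Complex.dist_le_div_mul_dist_of_mapsTo_ball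
    (differentiable_twist α a (differentiable_entireRep (kernel α w a))).differentiableOn hmaps hz1
  have hGz : c / 2 * X ≤ ‖twist α a (entireRep (kernel α w a)) z‖ := by
    have h1 : dist (twist α a (entireRep (kernel α w a)) z)
        (twist α a (entireRep (kernel α w a)) a) ≤ c / 2 * X := by
      refine hdiff.trans ?_
      rw [dist_eq_norm, div_one]
      calc 2 * C₁ * X * ‖z - a‖ ≤ 2 * C₁ * X * (c / (4 * C₁)) := by
            gcongr
            exact hza.le.trans (min_le_right _ _)
        _ = _ := by field_simp; norm_num
    rw [dist_eq_norm, norm_sub_rev] at h1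
    have := norm_sub_norm_le (twist α a (entireRep (kernel α w a)) a)
      (twist α a (entireRep (kernel α w a)) z)
    linarith
  rw [norm_twist] at hGz
  have hmr : unitMass w a ≤ K * (weightMass w (Metric.ball a r)).toReal := by
    have := ENNReal.toReal_mono (ENNReal.mul_ne_top (by simp) (h.doubling.finite a r))
      (hK a a (by simp))
    rw [weightMass_eq _ measurableSet_ball]
    rwa [ENNReal.toReal_mul, ENNReal.coe_toReal] at this
  have hexp : Real.exp (α / 2 * ‖z - a‖ ^ 2) ≤ Real.exp (α / 2) := by
    refine Real.exp_le_exp.2 ?_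
    have : ‖z - a‖ ^ 2 ≤ 1 := pow_le_one₀ (norm_nonneg _) (by
      rw [← dist_eq_norm]; exact (Metric.mem_ball.1 hz1).le)
    nlinarith
  have hmr0 : 0 < (weightMass w (Metric.ball a r)).toReal := pos_of_mul_pos_right
    (lt_of_lt_of_le hma hmr) hK0.le
  have hle : 1 / (weightMass w (Metric.ball a r)).toReal ≤ K / unitMass w a := by
    rw [div_le_div_iff₀ hmr0 hma]; linarith
  set B := ‖entireRep (kernel α w a) z‖
  have hfin : c / 2 * X ≤ B * Real.exp (-α / 2 * ‖z‖ ^ 2) * Real.exp (α / 2) :=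
    hGz.trans (by gcongr)
  have e1 : Real.exp (α / 2 * ‖z‖ ^ 2) * Real.exp (-α / 2 * ‖z‖ ^ 2) = 1 := by
    rw [← Real.exp_add]; simp; ring
  have e2 : Real.exp (-(α / 2)) * Real.exp (α / 2) = 1 := by rw [← Real.exp_add]; simp
  calc c / 2 * Real.exp (-(α / 2)) / K *
        (Real.exp (α / 2 * ‖a‖ ^ 2 + α / 2 * ‖z‖ ^ 2) / (weightMass w (Metric.ball a r)).toReal)
      = c / 2 * Real.exp (-(α / 2)) / K * (Real.exp (α / 2 * ‖a‖ ^ 2) *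
        Real.exp (α / 2 * ‖z‖ ^ 2)) * (1 / (weightMass w (Metric.ball a r)).toReal) := by
        rw [Real.exp_add]; ring
    _ ≤ c / 2 * Real.exp (-(α / 2)) / K * (Real.exp (α / 2 * ‖a‖ ^ 2) *
        Real.exp (α / 2 * ‖z‖ ^ 2)) * (K / unitMass w a) := by gcongr
    _ = Real.exp (-(α / 2)) * Real.exp (α / 2 * ‖z‖ ^ 2) * (c / 2 * X) := by
        rw [hX]; field_simp
    _ ≤ Real.exp (-(α / 2)) * Real.exp (α / 2 * ‖z‖ ^ 2) *
        (B * Real.exp (-α / 2 * ‖z‖ ^ 2) * Real.exp (α / 2)) := by gcongr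
    _ = B * (Real.exp (α / 2 * ‖z‖ ^ 2) * Real.exp (-α / 2 * ‖z‖ ^ 2)) *
        (Real.exp (-(α / 2)) * Real.exp (α / 2)) := by ring
    _ = B := by rw [e1, e2]; ring

end WeightedFock


namespace WeightedFock

/-! ### Gauge functions and Jensen's inequality -/

section Gauge

variable {h : ℝ≥0 → ℝ≥0}

@[simp] lemma extendTop_coe (h : ℝ≥0 → ℝ≥0) (x : ℝ≥0) : extendTop h x = h x := by
  simp [extendTop]

@[simp] lemma extendTop_top (h : ℝ≥0 → ℝ≥0) : extendTop h ∞ = ∞ := by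
  simp [extendTop]

lemma IsGauge.monotone_extendTop (hh : IsGauge h) : Monotone (extendTop h) := by
  intro x y hxy
  induction y with
  | top => simp
  | coe y =>
    lift x to ℝ≥0 using ne_top_of_le_ne_top ENNReal.coe_ne_top hxy
    rw [extendTop_coe, extendTop_coe]
    exact_mod_cast hh.strictMono.monotone (by exact_mod_cast hxy)

lemma IsGauge.measurable_extendTop (hh : IsGauge h) : Measurable (extendTop h) :=
  hh.monotone_extendTop.measurable

lemma IsGauge.convexOn_real (hh : IsGauge h) :
    ConvexOn ℝ (Ici 0) fun x : ℝ => (h x.toNNReal : ℝ) := by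
  refine ⟨convex_Ici 0, fun x hx y hy a b ha hb hab => ?_⟩
  have := hh.convex.2 (mem_univ x.toNNReal) (mem_univ y.toNNReal)
    (zero_le : (0 : ℝ≥0) ≤ a.toNNReal) (zero_le : (0 : ℝ≥0) ≤ b.toNNReal)
    (by rw [← Real.toNNReal_add ha hb, hab, Real.toNNReal_one])
  have h2 : (a • x + b • y).toNNReal = a.toNNReal • x.toNNReal + b.toNNReal • y.toNNReal := by
    rw [smul_eq_mul, smul_eq_mul, smul_eq_mul, smul_eq_mul, Real.toNNReal_add
      (mul_nonneg ha hx) (mul_nonneg hb hy), Real.toNNReal_mul ha, Real.toNNReal_mul hb]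
  beta_reduce
  rw [h2]
  have h3 : ((h (a.toNNReal • x.toNNReal + b.toNNReal • y.toNNReal) : ℝ≥0) : ℝ) ≤
      ((a.toNNReal • h x.toNNReal + b.toNNReal • h y.toNNReal : ℝ≥0) : ℝ) := by exact_mod_cast this
  simpa [ha, hb] using h3

/-- A gauge function is the supremum of its affine minorants. -/
lemma IsGauge.exists_affine_le (hh : IsGauge h) {x : ℝ≥0∞} {a : ℝ≥0} (ha : a < extendTop h x) :
    ∃ m b : ℝ≥0, (∀ y : ℝ≥0∞, m * y ≤ extendTop h y + b) ∧ (a + b : ℝ≥0∞) ≤ m * x := by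
  -- A real affine minorant y ↦ cy + c' with value a at x. From h(0) = 0 follows c' ≤ 0, and then cx
  -- ≥ a ≥ 0 with x > 0 forces c ≥ 0; so m = c and b = −c' are admissible.
  have key : ∀ x a : ℝ≥0, a < h x →
      ∃ m b : ℝ≥0, (∀ y : ℝ≥0∞, m * y ≤ extendTop h y + b) ∧ (a + b : ℝ≥0∞) = m * x := by
    intro x a ha
    have hcont : ContinuousOn (fun x : ℝ => (h x.toNNReal : ℝ)) (Ici 0) := by
      have := hh.continuous
      fun_prop
    obtain ⟨c, c', hle, heq⟩ := hh.convexOn_real.exists_affine_le_of_lt_real (x := x) (a := a)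
      (mem_Ici.2 x.2) (by simpa using ha) isClosed_Ici hcont.lowerSemicontinuousOn
    have hc' : c' ≤ 0 := by simpa [hh.map_zero] using hle 0 (by simp)
    have hx : 0 < (x : ℝ) := by
      refine lt_of_le_of_ne x.2 fun h0 => ?_
      rw [← NNReal.coe_zero, NNReal.coe_inj] at h0
      rw [← h0, hh.map_zero] at ha
      exact not_lt_zero ha
    have hc0 : 0 ≤ c := by
      by_contra hc
      have := mul_neg_of_neg_of_pos (not_le.1 hc) hx
      have := a.2
      change (0 : ℝ) ≤ (a : ℝ) at this
      linarith
    refine ⟨c.toNNReal, (-c').toNNReal, fun y => ?_, ?_⟩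
    · induction y with
      | top => simp
      | coe y =>
        rw [extendTop_coe]
        norm_cast
        rw [← NNReal.coe_le_coe]
        push_cast
        rw [Real.coe_toNNReal _ hc0, Real.coe_toNNReal _ (by linarith)]
        have := hle y y.2
        rw [Real.toNNReal_coe] at this
        linarith
    · norm_cast
      rw [← NNReal.coe_inj]
      push_cast
      rw [Real.coe_toNNReal _ hc0, Real.coe_toNNReal _ (by linarith)]
      linarith
  induction x with
  | top =>
    -- At x = ∞ any minorant of positive slope will do, and one comes from the point 1.
    have h1 : 0 < h 1 := by simpa [hh.map_zero] using hh.strictMono (zero_lt_one (α := ℝ≥0))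
    obtain ⟨m, b, hle, heq⟩ := key 1 (h 1 / 2) (half_lt_self h1)
    refine ⟨m, b, hle, ?_⟩
    have hm : (m : ℝ≥0∞) ≠ 0 := by
      rintro hm
      rw [hm, zero_mul] at heq
      have : ((h 1 / 2 : ℝ≥0) : ℝ≥0∞) = 0 := by simp_all
      simp [h1.ne'] at this
    rw [ENNReal.mul_top hm]
    exact le_top
  | coe x =>
    obtain ⟨m, b, hle, heq⟩ := key x a (by simpa using ha)
    exact ⟨m, b, hle, heq.le⟩

/-- Jensen's inequality for gauge functions and measures of mass at most `1`. -/
lemma IsGauge.extendTop_lintegral_le (hh : IsGauge h) {X : Type*} [MeasurableSpace X]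
    {P : Measure X} (hP : P univ ≤ 1) (g : X → ℝ≥0∞) :
    extendTop h (∫⁻ x, g x ∂P) ≤ ∫⁻ x, extendTop h (g x) ∂P := by
  refine ENNReal.le_of_forall_nnreal_lt fun a ha => ?_
  obtain ⟨m, b, hle, heq⟩ := hh.exists_affine_le ha
  refine (ENNReal.add_le_add_iff_right (ENNReal.coe_ne_top (r := b))).1 ?_
  calc (a + b : ℝ≥0∞) ≤ m * ∫⁻ x, g x ∂P := heq
    _ = ∫⁻ x, m * g x ∂P := (lintegral_const_mul' _ _ (by simp)).symm
    _ ≤ ∫⁻ x, (extendTop h (g x) + b) ∂P := lintegral_mono fun x => hle _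
    _ = ∫⁻ x, extendTop h (g x) ∂P + b * P univ := by
        rw [lintegral_add_right _ measurable_const, lintegral_const]
    -- Mass at most 1 suffices, since the minorants y ↦ my − b have b ≥ 0.
    _ ≤ ∫⁻ x, extendTop h (g x) ∂P + b * 1 := by gcongr
    _ = _ := by rw [mul_one]

lemma IsGauge.modularIntegral_mono (hh : IsGauge h) {g g' : ℂ → ℝ≥0∞} {C C' : ℝ≥0}
    (hle : ∀ z, C * g z ≤ C' * g' z) : modularIntegral h g C ≤ modularIntegral h g' C' :=
  lintegral_mono fun z => hh.monotone_extendTop (hle z)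

end Gauge

/-! ### Integral estimates -/

variable (α : ℝ) (w : ℂ → ℝ)

lemma LocallyDoubling.ball_ne_zero {ν : Measure ℂ} (hν : LocallyDoubling ν) (z : ℂ) {r : ℝ}
    (hr : 0 < r) : ν (Metric.ball z r) ≠ 0 := (hν.pos z hr).ne'

lemma average_eq (w : ℂ → ℝ) (r : ℝ) (μ : Measure ℂ) (z : ℂ) :
    average w r μ z = μ (Metric.ball z r) / weightMeasure w (Metric.ball z r) := by
  rw [average, weightMass_eq _ measurableSet_ball]

lemma Admissible.isLocallyFiniteMeasure (h : Admissible α w) :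
    IsLocallyFiniteMeasure (weightMeasure w) := h.doubling.isLocallyFiniteMeasure

lemma measurable_average [h : Admissible α w] (r : ℝ) (μ : Measure ℂ) [SFinite μ] :
    Measurable (average w r μ) := by
  have := h.isLocallyFiniteMeasure
  have : average w r μ = fun z => μ (Metric.ball z r) / weightMeasure w (Metric.ball z r) :=
    funext fun z => average_eq w r μ z
  rw [this]
  exact (measurable_measure_ball μ r).div (measurable_measure_ball _ r)

lemma fockDensity_entireRep_le_mul_inv [h : Admissible α w] {C : ℝ≥0∞} {F : ℂ → ℂ} {z : ℂ}
    {B : ℝ≥0∞} (hle : fockDensity α F z * weightMeasure w (Metric.ball z 1) ≤ C * B) :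
    fockDensity α F z ≤ C * (weightMeasure w (Metric.ball z 1))⁻¹ * B := by
  have h0 := h.doubling.ball_ne_zero z one_pos
  have ht := h.doubling.finite z 1
  rw [mul_right_comm, ← div_eq_mul_inv, ENNReal.le_div_iff_mul_le (Or.inl h0) (Or.inl ht)]
  exact hle

/-- Integrate the local estimate over the centre z and swap: each point y is counted with the area π
of a unit disk. -/
lemma exists_lintegral_fockDensity_mul_le [h : Admissible α w] : ∃ C : ℝ≥0, ∀ f : FockSpace α w,
    ∫⁻ z, fockDensity α (entireRep f) z * weightMeasure w (Metric.ball z 1) ≤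
      C * ENNReal.ofReal (‖f‖ ^ 2) := by
  have := h.isLocallyFiniteMeasure
  obtain ⟨C, hC⟩ := h.doubling.exists_fockDensity_le h.pos one_pos le_rfl
  refine ⟨C * NNReal.pi, fun f => ?_⟩
  have hm := measurable_fockDensity α (continuous_entireRep f)
  calc _ ≤ ∫⁻ z, C * (∫⁻ y in Metric.ball z 1, fockDensity α (entireRep f) y ∂weightMeasure w) :=
        lintegral_mono fun z => hC z _ (differentiable_entireRep f)
    _ = C * ∫⁻ z, (∫⁻ y in Metric.ball z 1, fockDensity α (entireRep f) y ∂weightMeasure w) :=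
        lintegral_const_mul' _ _ (by simp)
    _ = C * ∫⁻ y, (∫⁻ _ in Metric.ball y 1, fockDensity α (entireRep f) y) ∂weightMeasure w := by
        rw [lintegral_ball_swap 1 (f := fun _ y => fockDensity α (entireRep f) y)
          (hm.comp measurable_snd)]
    _ = C * ∫⁻ y, fockDensity α (entireRep f) y * NNReal.pi ∂weightMeasure w := by simp
    _ = _ := by
        rw [lintegral_mul_const' _ _ (by simp), ofReal_norm_sq, ENNReal.coe_mul]
        ring

/-- The Carleson estimate. -/
lemma exists_lintegral_fockDensity_le_average [h : Admissible α w] {r : ℝ} (hr : 0 < r)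
    (hr1 : r ≤ 1) : ∃ C : ℝ≥0, ∀ (μ : Measure ℂ) [SFinite μ] (f : FockSpace α w),
    ∫⁻ z, fockDensity α (entireRep f) z ∂μ ≤
      C * ∫⁻ z, average w r μ z * fockDensity α (entireRep f) z ∂weightMeasure w := by
  have := h.isLocallyFiniteMeasure
  obtain ⟨C, hC⟩ := h.doubling.exists_fockDensity_le h.pos hr hr1
  obtain ⟨D, hD1, hD⟩ := h.doubling.exists_le 1 1 one_pos
  refine ⟨C * D, fun μ _ f => ?_⟩
  set ν := weightMeasure w with hν
  set M : ℂ → ℝ≥0∞ := fun z => ν (Metric.ball z 1) with hM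
  have hm := measurable_fockDensity α (continuous_entireRep f)
  have hMm : Measurable M := measurable_measure_ball ν 1
  -- The mass of the unit disk at the centre is moved inside the integral by doubling, so that after
  -- the swap it stands at the same point as the density.
  have hpt : ∀ z, fockDensity α (entireRep f) z ≤
      C * D * ∫⁻ y in Metric.ball z r, fockDensity α (entireRep f) y * (M y)⁻¹ ∂ν := by
    intro z
    refine (fockDensity_entireRep_le_mul_inv α w (hC z _ (differentiable_entireRep f))).trans ?_
    rw [mul_assoc, mul_assoc]
    gcongr _ * ?_
    rw [← lintegral_const_mul' _ _
      (ENNReal.inv_ne_top.2 (h.doubling.ball_ne_zero z one_pos)), ← lintegral_const_mul' _ _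
      (by simp)]
    refine setLIntegral_mono' measurableSet_ball fun y hy => ?_
    have h1 : M y ≤ D * M z := hD y z (by rw [dist_comm]; exact (Metric.mem_ball.1 hy).le.trans hr1)
    have h2 : (M z)⁻¹ ≤ D * (M y)⁻¹ := by
      rw [← div_eq_mul_inv, ENNReal.le_div_iff_mul_le (Or.inl (h.doubling.ball_ne_zero y one_pos))
        (Or.inl (h.doubling.finite y 1)), mul_comm, ← div_eq_mul_inv,
        ENNReal.div_le_iff_le_mul (Or.inl (h.doubling.ball_ne_zero z one_pos))
        (Or.inl (h.doubling.finite z 1))]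
      exact h1
    calc _ ≤ D * (M y)⁻¹ * fockDensity α (entireRep f) y := by gcongr
      _ = _ := by ring
  calc _ ≤ ∫⁻ z, C * D * ∫⁻ y in Metric.ball z r, fockDensity α (entireRep f) y * (M y)⁻¹ ∂ν ∂μ :=
        lintegral_mono hpt
    _ = C * D * ∫⁻ z, ∫⁻ y in Metric.ball z r, fockDensity α (entireRep f) y * (M y)⁻¹ ∂ν ∂μ :=
        lintegral_const_mul' _ _ (by finiteness)
    _ = C * D * ∫⁻ y, ∫⁻ _ in Metric.ball y r, fockDensity α (entireRep f) y * (M y)⁻¹ ∂μ ∂ν := by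
        rw [lintegral_ball_swap r (f := fun _ y => fockDensity α (entireRep f) y * (M y)⁻¹)
          ((hm.mul hMm.inv).comp measurable_snd)]
    _ = C * D * ∫⁻ y, μ (Metric.ball y r) / M y * fockDensity α (entireRep f) y ∂ν := by
        congr 1
        refine lintegral_congr fun y => ?_
        rw [setLIntegral_const, div_eq_mul_inv]
        ring
    _ ≤ _ := by
        rw [ENNReal.coe_mul]
        gcongr _ * ?_
        refine lintegral_mono fun y => ?_
        rw [average_eq]
        gcongr
        exact measure_mono (Metric.ball_subset_ball hr1)

/-- Averages over small disks are controlled by averages over the larger disks nearby. -/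
lemma exists_average_le [h : Admissible α w] {r : ℝ} (hr : 0 < r) : ∃ K : ℝ≥0, 1 ≤ K ∧
    ∀ (μ : Measure ℂ) (z y : ℂ), dist z y ≤ r / 2 →
      average w (r / 2) μ y ≤ K * average w r μ z := by
  obtain ⟨D, hD1, hD⟩ := h.doubling.exists_le r (r / 2) (half_pos hr)
  refine ⟨D, hD1, fun μ z y hzy => ?_⟩
  rw [average_eq, average_eq]
  have h1 : weightMeasure w (Metric.ball z r) ≤ D * weightMeasure w (Metric.ball y (r / 2)) :=
    hD z y (by rwa [dist_comm])
  have h2 : Metric.ball y (r / 2) ⊆ Metric.ball z r :=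
    Metric.ball_subset_ball' (by rw [dist_comm]; linarith)
  have h3 : (weightMeasure w (Metric.ball y (r / 2)))⁻¹ ≤
      D * (weightMeasure w (Metric.ball z r))⁻¹ := by
    rw [← div_eq_mul_inv, ENNReal.le_div_iff_mul_le (Or.inl (h.doubling.ball_ne_zero z hr))
      (Or.inl (h.doubling.finite z r)), mul_comm, ← div_eq_mul_inv,
      ENNReal.div_le_iff_le_mul (Or.inl (h.doubling.ball_ne_zero y (half_pos hr)))
      (Or.inl (h.doubling.finite y _))]
    exact h1
  calc _ = μ (Metric.ball y (r / 2)) * (weightMeasure w (Metric.ball y (r / 2)))⁻¹ :=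
        div_eq_mul_inv _ _
    _ ≤ μ (Metric.ball z r) * (D * (weightMeasure w (Metric.ball z r))⁻¹) := by gcongr
    _ = _ := by rw [div_eq_mul_inv]; ring

/-- The average at y over radius r/2 is at most K times the average over radius r at every z ∈
D(y,r/2). Integrating in z gives a substitute for subharmonicity of the average function. -/
lemma extendTop_average_mul_le {r : ℝ} {K : ℝ≥0}
    (hK : ∀ (μ : Measure ℂ) (z y : ℂ), dist z y ≤ r / 2 →
      average w (r / 2) μ y ≤ K * average w r μ z)
    {h : ℝ≥0 → ℝ≥0} (hh : IsGauge h) (μ : Measure ℂ) (t : ℝ≥0) (y : ℂ) :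
    extendTop h (t * average w (r / 2) μ y) * volume (Metric.ball (0 : ℂ) (r / 2)) ≤
      ∫⁻ z in Metric.ball y (r / 2), extendTop h ((t * K : ℝ≥0) * average w r μ z) := by
  have hVz : volume (Metric.ball (0 : ℂ) (r / 2)) = volume (Metric.ball y (r / 2)) := by
    simp only [Complex.volume_ball]
  rw [hVz, ← setLIntegral_const]
  refine setLIntegral_mono' measurableSet_ball fun z hz => hh.monotone_extendTop ?_
  rw [ENNReal.coe_mul, mul_assoc]
  gcongr
  exact hK μ z y (Metric.mem_ball.1 hz).le

/-- By doubling, dν(y)/ν(D(y,1)) has bounded mass on disks of radius r/2. Replacing the value at y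
by an area integral over a disk and swapping therefore turns this measure into dA, at the price of
the larger radius r. -/
lemma exists_lintegral_average_le [ha : Admissible α w] {r : ℝ} (hr : 0 < r) (hr1 : r ≤ 1) :
    ∃ C K : ℝ≥0, 1 ≤ K ∧ ∀ (μ : Measure ℂ) [SFinite μ] (h : ℝ≥0 → ℝ≥0), IsGauge h → ∀ t : ℝ≥0,
      ∫⁻ y, extendTop h (t * average w (r / 2) μ y) * (weightMeasure w (Metric.ball y 1))⁻¹
        ∂weightMeasure w ≤ C * modularIntegral h (average w r μ) (t * K) := by
  have := ha.isLocallyFiniteMeasure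
  obtain ⟨K, hK1, hK⟩ := exists_average_le α w hr
  obtain ⟨D, hD1, hD⟩ := ha.doubling.exists_le 1 1 one_pos
  set V : ℝ≥0∞ := volume (Metric.ball (0 : ℂ) (r / 2)) with hV
  have hV0 : V ≠ 0 := (Metric.measure_ball_pos volume (0 : ℂ) (half_pos hr)).ne'
  have hVt : V ≠ ∞ := measure_ball_lt_top.ne
  have hDV : D / V ≠ ∞ := ENNReal.div_ne_top (by simp) hV0
  refine ⟨(D / V).toNNReal, K, hK1, fun μ _ h hh t => ?_⟩
  rw [ENNReal.coe_toNNReal hDV]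
  set ν := weightMeasure w with hν
  set M : ℂ → ℝ≥0∞ := fun z => ν (Metric.ball z 1) with hM
  have hMm : Measurable M := measurable_measure_ball ν 1
  set Ψ : ℂ → ℝ≥0∞ := fun z => extendTop h ((t * K : ℝ≥0) * average w r μ z) with hΨ
  have hΨm : Measurable Ψ :=
    hh.measurable_extendTop.comp ((measurable_average α w r μ).const_mul _)
  have h1 : (∫⁻ y, extendTop h (t * average w (r / 2) μ y) * (M y)⁻¹ ∂ν) * V ≤
      D * ∫⁻ z, Ψ z := by
    calc _ = ∫⁻ y, extendTop h (t * average w (r / 2) μ y) * (M y)⁻¹ * V ∂ν :=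
          (lintegral_mul_const' _ _ hVt).symm
      _ ≤ ∫⁻ y, (∫⁻ z in Metric.ball y (r / 2), Ψ z * (M y)⁻¹) ∂ν := by
          refine lintegral_mono fun y => ?_
          have hMt : (M y)⁻¹ ≠ ∞ := ENNReal.inv_ne_top.2 (ha.doubling.ball_ne_zero y one_pos)
          rw [lintegral_mul_const' _ _ hMt, mul_right_comm]
          gcongr
          exact extendTop_average_mul_le w hK hh μ t y
      _ = ∫⁻ z, ∫⁻ y in Metric.ball z (r / 2), Ψ z * (M y)⁻¹ ∂ν :=
          lintegral_ball_swap (r / 2) (f := fun y z => Ψ z * (M y)⁻¹)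
            ((hΨm.comp measurable_snd).mul (hMm.inv.comp measurable_fst))
      _ ≤ ∫⁻ z, D * Ψ z := by
          refine lintegral_mono fun z => ?_
          have hMz0 := ha.doubling.ball_ne_zero z one_pos
          have hMzt := ha.doubling.finite z 1
          calc _ ≤ ∫⁻ y in Metric.ball z (r / 2), Ψ z * (D * (M z)⁻¹) ∂ν := by
                refine setLIntegral_mono' measurableSet_ball fun y hy => ?_
                gcongr
                rw [← div_eq_mul_inv, ENNReal.le_div_iff_mul_le (Or.inl hMz0) (Or.inl hMzt),
                  mul_comm, ← div_eq_mul_inv, ENNReal.div_le_iff_le_mul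
                  (Or.inl (ha.doubling.ball_ne_zero y one_pos)) (Or.inl (ha.doubling.finite y 1))]
                exact hD z y (by linarith [Metric.mem_ball.1 hy])
            _ = D * Ψ z * ((M z)⁻¹ * ν (Metric.ball z (r / 2))) := by
                rw [setLIntegral_const]; ring
            _ ≤ D * Ψ z * ((M z)⁻¹ * M z) := by
                gcongr
                exact measure_mono (Metric.ball_subset_ball (by linarith))
            _ = _ := by rw [ENNReal.inv_mul_cancel hMz0 hMzt, mul_one]
      _ = _ := lintegral_const_mul' _ _ (by simp)
  calc _ = (∫⁻ y, extendTop h (t * average w (r / 2) μ y) * (M y)⁻¹ ∂ν) * V / V := by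
        rw [mul_div_assoc, ENNReal.div_self hV0 hVt, mul_one]
    _ ≤ D * (∫⁻ z, Ψ z) / V := ENNReal.div_le_div_right h1 V
    _ = _ := by rw [modularIntegral]; simp only [div_eq_mul_inv]; ring

end WeightedFock


namespace WeightedFock

/-! ### Berezin transforms and averages -/

variable (α : ℝ) (w : ℂ → ℝ)

variable {α w} in
lemma entireRep_normalizedKernel [h : Admissible α w] (z ζ : ℂ) :
    entireRep (normalizedKernel α w z) ζ = inner ℂ (kernel α w ζ) (normalizedKernel α w z) :=
  entireRep_eq_inner _ _

lemma continuous_normalizedKernel [h : Admissible α w] : Continuous (normalizedKernel α w) := by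
  have h1 := continuous_kernel (α := α) (w := w)
  unfold normalizedKernel
  refine Continuous.smul (Complex.continuous_ofReal.comp ?_) h1
  exact h1.norm.inv₀ fun z => (norm_kernel_pos α w z).ne'

lemma measurable_uncurry_fockDensity_normalizedKernel [h : Admissible α w] :
    Measurable fun p : ℂ × ℂ => fockDensity α (entireRep (normalizedKernel α w p.1)) p.2 := by
  have h1 := continuous_kernel (α := α) (w := w)
  have h2 := continuous_normalizedKernel α w
  unfold fockDensity
  simp only [entireRep_normalizedKernel]
  refine ENNReal.measurable_ofReal.comp (Continuous.measurable ?_)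
  refine Continuous.mul ?_ (by fun_prop)
  exact ((h1.comp continuous_snd).inner (h2.comp continuous_fst)).norm.pow 2

lemma measurable_fockDensity_normalizedKernel [h : Admissible α w] (ζ : ℂ) :
    Measurable fun z => fockDensity α (entireRep (normalizedKernel α w z)) ζ := by
  have h2 := continuous_normalizedKernel α w
  unfold fockDensity
  simp only [entireRep_normalizedKernel]
  refine ENNReal.measurable_ofReal.comp (Continuous.measurable ?_)
  exact ((continuous_const.inner h2).norm.pow 2).mul continuous_const

lemma berezin_eq (μ : Measure ℂ) (z : ℂ) :
    berezin α w μ z = ∫⁻ ζ, fockDensity α (entireRep (normalizedKernel α w z)) ζ ∂μ := rfl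

lemma measurable_berezin [h : Admissible α w] (μ : Measure ℂ) [SFinite μ] :
    Measurable (berezin α w μ) :=
  (measurable_uncurry_fockDensity_normalizedKernel α w).lintegral_prod_right'

variable {α w} in
lemma norm_inner_normalizedKernel_sq [h : Admissible α w] (f : FockSpace α w) (z : ℂ) :
    ‖(inner ℂ (normalizedKernel α w z) f : ℂ)‖ ^ 2 =
      ‖entireRep f z‖ ^ 2 / ‖kernel α w z‖ ^ 2 := by
  have e : (inner ℂ (normalizedKernel α w z) f : ℂ) =
      starRingEnd ℂ ((‖kernel α w z‖⁻¹ : ℝ) : ℂ) * inner ℂ (kernel α w z) f :=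
    inner_smul_left (𝕜 := ℂ) (kernel α w z) f ((‖kernel α w z‖⁻¹ : ℝ) : ℂ)
  rw [e, norm_mul, ← entireRep_eq_inner, RCLike.norm_conj,
    Complex.norm_real, norm_inv, norm_norm]
  field_simp [(norm_kernel_pos α w z).ne']

/-- Bessel's inequality for the continuous family b_z: the integrand is |f(z)|²/‖B_z‖², and the
lower bound for ‖B_z‖ makes it at most a multiple of |f(z)|² e^{-α|z|²} ν(D(z,1)). -/
lemma exists_lintegral_inner_normalizedKernel_le [h : Admissible α w] :
    ∃ C : ℝ≥0, ∀ f : FockSpace α w,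
      ∫⁻ z, ENNReal.ofReal (‖(inner ℂ (normalizedKernel α w z) f : ℂ)‖ ^ 2) ≤
        C * ENNReal.ofReal (‖f‖ ^ 2) := by
  obtain ⟨C, hC⟩ := exists_lintegral_fockDensity_mul_le α w
  obtain ⟨c, hc0, hc⟩ := exists_le_norm_kernel α w
  refine ⟨c⁻¹.toNNReal * C, fun f => ?_⟩
  have hpt : ∀ z, ENNReal.ofReal (‖(inner ℂ (normalizedKernel α w z) f : ℂ)‖ ^ 2) ≤
      c⁻¹.toNNReal * (fockDensity α (entireRep f) z * weightMeasure w (Metric.ball z 1)) := by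
    intro z
    change _ ≤ ENNReal.ofReal c⁻¹ * _
    have hk := norm_kernel_pos α w z
    have hm := unitMass_pos α w z
    rw [← ofReal_unitMass α w, fockDensity, ← ENNReal.ofReal_mul (by positivity),
      ← ENNReal.ofReal_mul (by positivity)]
    refine ENNReal.ofReal_le_ofReal ?_
    rw [norm_inner_normalizedKernel_sq, div_le_iff₀ (by positivity), neg_mul, Real.exp_neg]
    have h1 := hc z
    have hE := Real.exp_pos (α * ‖z‖ ^ 2)
    calc ‖entireRep f z‖ ^ 2 = c⁻¹ * (‖entireRep f z‖ ^ 2 * (Real.exp (α * ‖z‖ ^ 2))⁻¹) *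
          (c * Real.exp (α * ‖z‖ ^ 2)) := by field_simp
      _ ≤ c⁻¹ * (‖entireRep f z‖ ^ 2 * (Real.exp (α * ‖z‖ ^ 2))⁻¹) *
          (‖kernel α w z‖ ^ 2 * unitMass w z) := by gcongr
      _ = _ := by ring
  calc _ ≤ ∫⁻ z, c⁻¹.toNNReal *
        (fockDensity α (entireRep f) z * weightMeasure w (Metric.ball z 1)) := lintegral_mono hpt
    _ = c⁻¹.toNNReal *
        ∫⁻ z, fockDensity α (entireRep f) z * weightMeasure w (Metric.ball z 1) :=
        lintegral_const_mul' _ _ (by simp)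
    _ ≤ c⁻¹.toNNReal * (C * ENNReal.ofReal (‖f‖ ^ 2)) := by gcongr; exact hC f
    _ = _ := by rw [ENNReal.coe_mul, mul_assoc]

lemma exists_norm_kernel_sq_mul_exp_le [h : Admissible α w] : ∃ C : ℝ≥0, ∀ z : ℂ,
    ENNReal.ofReal (‖kernel α w z‖ ^ 2 * Real.exp (-α * ‖z‖ ^ 2)) ≤
      C * (weightMeasure w (Metric.ball z 1))⁻¹ := by
  obtain ⟨C, hC0, hC⟩ := exists_norm_kernel_le α w
  refine ⟨C.toNNReal, fun z => ?_⟩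
  have hm := unitMass_pos α w z
  change _ ≤ ENNReal.ofReal C * _
  rw [← ofReal_unitMass α w, ← ENNReal.ofReal_inv_of_pos hm, ← ENNReal.ofReal_mul hC0.le]
  refine ENNReal.ofReal_le_ofReal ?_
  rw [← div_eq_mul_inv, le_div_iff₀ hm, neg_mul, Real.exp_neg]
  have hE := Real.exp_pos (α * ‖z‖ ^ 2)
  calc _ = (‖kernel α w z‖ ^ 2 * unitMass w z) * (Real.exp (α * ‖z‖ ^ 2))⁻¹ := by ring
    _ ≤ (C * Real.exp (α * ‖z‖ ^ 2)) * (Real.exp (α * ‖z‖ ^ 2))⁻¹ :=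
        mul_le_mul_of_nonneg_right (hC z) (by positivity)
    _ = C := by field_simp

/-- Since |b_z(ζ)| = |⟨b_z, B_ζ⟩|, this is the Bessel inequality for f = B_ζ combined with the upper
bound for ‖B_ζ‖. -/
lemma exists_lintegral_fockDensity_normalizedKernel_le [h : Admissible α w] :
    ∃ C : ℝ≥0, ∀ ζ : ℂ, ∫⁻ z, fockDensity α (entireRep (normalizedKernel α w z)) ζ ≤
      C * (weightMeasure w (Metric.ball ζ 1))⁻¹ := by
  obtain ⟨C, hC⟩ := exists_lintegral_inner_normalizedKernel_le α w
  obtain ⟨D, hD⟩ := exists_norm_kernel_sq_mul_exp_le α w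
  refine ⟨C * D, fun ζ => ?_⟩
  have hpt : ∀ z, fockDensity α (entireRep (normalizedKernel α w z)) ζ =
      ENNReal.ofReal (‖(inner ℂ (normalizedKernel α w z) (kernel α w ζ) : ℂ)‖ ^ 2) *
        ENNReal.ofReal (Real.exp (-α * ‖ζ‖ ^ 2)) := fun z => by
    rw [fockDensity, entireRep_normalizedKernel, norm_inner_symm,
      ENNReal.ofReal_mul (by positivity)]
  simp only [hpt]
  rw [lintegral_mul_const' _ _ (by simp)]
  calc _ ≤ C * ENNReal.ofReal (‖kernel α w ζ‖ ^ 2) * ENNReal.ofReal (Real.exp (-α * ‖ζ‖ ^ 2)) := by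
        gcongr; exact hC _
    _ = C * ENNReal.ofReal (‖kernel α w ζ‖ ^ 2 * Real.exp (-α * ‖ζ‖ ^ 2)) := by
        rw [ENNReal.ofReal_mul (by positivity), mul_assoc]
    _ ≤ C * (D * (weightMeasure w (Metric.ball ζ 1))⁻¹) := by gcongr; exact hD ζ
    _ = _ := by rw [ENNReal.coe_mul, mul_assoc]

lemma lintegral_fockDensity_normalizedKernel [h : Admissible α w] (z : ℂ) :
    ∫⁻ ζ, fockDensity α (entireRep (normalizedKernel α w z)) ζ ∂weightMeasure w = 1 := by
  rw [← ofReal_norm_sq, norm_normalizedKernel]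
  simp

/-- The Berezin transform dominates the average function on small disks. -/
lemma KernelLowerBound.exists_average_le_berezin [h : Admissible α w] {δ : ℝ}
    (hδ : KernelLowerBound α w δ) (hδ1 : δ ≤ 1) {r : ℝ} (hr : 0 < r) (hrδ : r ≤ δ) :
    ∃ K : ℝ≥0, 1 ≤ K ∧ ∀ (μ : Measure ℂ) (z : ℂ), average w r μ z ≤ K * berezin α w μ z := by
  obtain ⟨c, hc0, hc⟩ := hδ r hr
  obtain ⟨C, hC0, hC⟩ := exists_norm_kernel_le α w
  refine ⟨(C / c ^ 2).toNNReal + 1, by simp, fun μ z => ?_⟩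
  set m := (weightMass w (Metric.ball z r)).toReal with hm
  have hmm : weightMass w (Metric.ball z r) = weightMeasure w (Metric.ball z r) :=
    weightMass_eq _ measurableSet_ball
  have hm0 : 0 < m := by
    rw [hm, hmm]
    exact ENNReal.toReal_pos (h.doubling.ball_ne_zero z hr) (h.doubling.finite z r)
  have hmM : m ≤ unitMass w z := by
    rw [hm, hmm]
    exact ENNReal.toReal_mono (h.doubling.finite z 1)
      (measure_mono (Metric.ball_subset_ball (hrδ.trans hδ1)))
  have hmofReal : ENNReal.ofReal m = weightMass w (Metric.ball z r) := by
    rw [hm, hmm, ENNReal.ofReal_toReal (h.doubling.finite z r)]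
  have hk := norm_kernel_pos α w z
  -- Dividing the square of the lower bound for |B_z(ζ)|, of order m⁻², by ‖B_z‖², of order at most
  -- m⁻¹, leaves c²/(Cm) for the density of b_z.
  have hpt : ∀ ζ ∈ Metric.ball z r, ENNReal.ofReal m⁻¹ ≤
      ENNReal.ofReal (C / c ^ 2) * fockDensity α (entireRep (normalizedKernel α w z)) ζ := by
    intro ζ hζ
    rw [fockDensity, ← ENNReal.ofReal_mul (by positivity)]
    refine ENNReal.ofReal_le_ofReal ?_
    have h1 := hc z ζ (Metric.ball_subset_ball hrδ hζ)
    rw [norm_entireRep_normalizedKernel]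
    set B := ‖entireRep (kernel α w z) ζ‖
    have h2 : (c * (Real.exp (α / 2 * ‖z‖ ^ 2 + α / 2 * ‖ζ‖ ^ 2) / m)) ^ 2 ≤ B ^ 2 := by gcongr
    have h3 : Real.exp (α / 2 * ‖z‖ ^ 2 + α / 2 * ‖ζ‖ ^ 2) ^ 2 =
        Real.exp (α * ‖z‖ ^ 2) * Real.exp (α * ‖ζ‖ ^ 2) := by
      rw [← Real.exp_nat_mul, ← Real.exp_add]; congr 1; push_cast; ring
    rw [mul_pow, div_pow, h3] at h2
    have h4 : ‖kernel α w z‖ ^ 2 * m ≤ C * Real.exp (α * ‖z‖ ^ 2) :=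
      le_trans (by gcongr) (hC z)
    rw [neg_mul, Real.exp_neg]
    set E := Real.exp (α * ‖z‖ ^ 2)
    set E' := Real.exp (α * ‖ζ‖ ^ 2)
    have hE : 0 < E := Real.exp_pos _
    have hE' : 0 < E' := Real.exp_pos _
    have h5 : C / c ^ 2 * ((B / ‖kernel α w z‖) ^ 2 * E'⁻¹) =
        C * B ^ 2 / (c ^ 2 * ‖kernel α w z‖ ^ 2 * E') := by
      field_simp
    rw [h5, inv_eq_one_div, div_le_div_iff₀ hm0 (by positivity)]
    have h6 : c ^ 2 * (E * E') ≤ B ^ 2 * m ^ 2 := by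
      rwa [← mul_div_assoc, div_le_iff₀ (by positivity)] at h2
    have h7 : (c ^ 2 * ‖kernel α w z‖ ^ 2 * E') * (E * m) ≤ (C * B ^ 2 * m) * (E * m) := by
      calc _ = (c ^ 2 * (E * E')) * (‖kernel α w z‖ ^ 2 * m) := by ring
        _ ≤ (B ^ 2 * m ^ 2) * (C * E) := by gcongr
        _ = _ := by ring
    have := le_of_mul_le_mul_right h7 (by positivity)
    linarith
  calc average w r μ z = ENNReal.ofReal m⁻¹ * μ (Metric.ball z r) := by
        rw [average, ENNReal.ofReal_inv_of_pos hm0, hmofReal, div_eq_mul_inv, mul_comm]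
    _ = ∫⁻ _ in Metric.ball z r, ENNReal.ofReal m⁻¹ ∂μ := (setLIntegral_const _ _).symm
    _ ≤ ∫⁻ ζ in Metric.ball z r, ENNReal.ofReal (C / c ^ 2) *
          fockDensity α (entireRep (normalizedKernel α w z)) ζ ∂μ :=
        setLIntegral_mono' measurableSet_ball hpt
    _ ≤ ∫⁻ ζ, ENNReal.ofReal (C / c ^ 2) *
          fockDensity α (entireRep (normalizedKernel α w z)) ζ ∂μ :=
        lintegral_mono' Measure.restrict_le_self le_rfl
    _ = ENNReal.ofReal (C / c ^ 2) * berezin α w μ z := lintegral_const_mul' _ _ (by simp)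
    _ ≤ _ := by
        gcongr
        rw [ENNReal.coe_add]
        exact le_self_add

/-- Integrals of gauge functions of the Berezin transform are dominated by those of averages. -/
lemma exists_modularIntegral_berezin_le [ha : Admissible α w] {r : ℝ} (hr : 0 < r) (hr1 : r ≤ 1) :
    ∃ C K : ℝ≥0, 1 ≤ K ∧ ∀ (μ : Measure ℂ) [SFinite μ] (h : ℝ≥0 → ℝ≥0), IsGauge h → ∀ t : ℝ≥0,
      modularIntegral h (berezin α w μ) t ≤ C * modularIntegral h (average w r μ) (t * K) := by
  have := ha.isLocallyFiniteMeasure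
  obtain ⟨C₁, K₁, hK₁, H₁⟩ := exists_lintegral_average_le α w hr hr1
  obtain ⟨C₂, H₂⟩ := exists_lintegral_fockDensity_le_average α w (half_pos hr) (by linarith)
  obtain ⟨C₃, H₃⟩ := exists_lintegral_fockDensity_normalizedKernel_le α w
  refine ⟨C₃ * C₁, (C₂ + 1) * K₁, one_le_mul (by simp) hK₁, fun μ _ h hh t => ?_⟩
  set ν := weightMeasure w with hν
  have hjm := measurable_uncurry_fockDensity_normalizedKernel α w
  set Ψ : ℂ → ℝ≥0∞ := fun ζ => extendTop h ((t * (C₂ + 1) : ℝ≥0) * average w (r / 2) μ ζ) with hΨ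
  have hΨm : Measurable Ψ :=
    hh.measurable_extendTop.comp ((measurable_average α w (r / 2) μ).const_mul _)
  have hswap : Measurable (Function.uncurry fun z ζ =>
      Ψ ζ * fockDensity α (entireRep (normalizedKernel α w z)) ζ) :=
    (hΨm.comp measurable_snd).mul hjm
  have hpt : ∀ z, extendTop h (t * berezin α w μ z) ≤
      ∫⁻ ζ, Ψ ζ * fockDensity α (entireRep (normalizedKernel α w z)) ζ ∂ν := by
    intro z
    have hdm := measurable_fockDensity α (continuous_entireRep (normalizedKernel α w z))
    have havm := measurable_average α w (r / 2) μ
    -- Total mass 1 because ‖b_z‖ = 1. The Carleson estimate for b_z bounds the Berezin transform by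
    -- a P-mean of averages, to which Jensen applies.
    set P := ν.withDensity (fockDensity α (entireRep (normalizedKernel α w z))) with hP
    have hP1 : P univ ≤ 1 := by
      rw [hP, withDensity_apply _ MeasurableSet.univ, Measure.restrict_univ, hν,
        lintegral_fockDensity_normalizedKernel]
    calc extendTop h (t * berezin α w μ z)
        ≤ extendTop h (∫⁻ ζ, (t * (C₂ + 1) : ℝ≥0) * average w (r / 2) μ ζ ∂P) := by
          refine hh.monotone_extendTop ?_
          rw [lintegral_const_mul _ havm, hP, lintegral_withDensity_eq_lintegral_mul _ hdm havm,
            ENNReal.coe_mul, mul_assoc, berezin_eq]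
          gcongr
          refine (H₂ μ _).trans ?_
          simp only [Pi.mul_apply, mul_comm (fockDensity _ _ _)]
          gcongr
          simp
      _ ≤ ∫⁻ ζ, Ψ ζ ∂P := hh.extendTop_lintegral_le hP1 _
      _ = _ := by
          rw [hP, lintegral_withDensity_eq_lintegral_mul _ hdm hΨm]
          simp only [Pi.mul_apply, mul_comm]
  calc modularIntegral h (berezin α w μ) t
      ≤ ∫⁻ z, (∫⁻ ζ, Ψ ζ * fockDensity α (entireRep (normalizedKernel α w z)) ζ ∂ν) :=
        lintegral_mono hpt
    _ = ∫⁻ ζ, (∫⁻ z, Ψ ζ * fockDensity α (entireRep (normalizedKernel α w z)) ζ) ∂ν :=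
        lintegral_lintegral_swap (f := fun z ζ =>
          Ψ ζ * fockDensity α (entireRep (normalizedKernel α w z)) ζ) hswap.aemeasurable
    _ ≤ ∫⁻ ζ, C₃ * (Ψ ζ * (ν (Metric.ball ζ 1))⁻¹) ∂ν := by
        refine lintegral_mono fun ζ => ?_
        rw [lintegral_const_mul _ (measurable_fockDensity_normalizedKernel α w ζ)]
        calc _ ≤ Ψ ζ * (C₃ * (ν (Metric.ball ζ 1))⁻¹) := by gcongr; exact H₃ ζ
          _ = _ := by ring
    _ = C₃ * ∫⁻ ζ, Ψ ζ * (ν (Metric.ball ζ 1))⁻¹ ∂ν := lintegral_const_mul' _ _ (by simp)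
    _ ≤ C₃ * (C₁ * modularIntegral h (average w r μ) (t * (C₂ + 1) * K₁)) := by
        gcongr
        exact H₁ μ h hh _
    _ = _ := by rw [ENNReal.coe_mul]; ring_nf

end WeightedFock


namespace WeightedFock

/-! ### Integrals of rank one operators -/

section HilbertSpace

variable {H : Type*} [NormedAddCommGroup H] [InnerProductSpace ℂ H] [CompleteSpace H]

/-- An integral of rank one operators over a compact set is a compact operator. -/
lemma exists_isCompactOperator_integral_rankOne {X : Type*} [MeasurableSpace X]
    [TopologicalSpace X] [OpensMeasurableSpace X] [T2Space X] {μ : Measure X}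
    [IsFiniteMeasureOnCompacts μ] {B : X → H} (hB : Continuous B) {ρ : X → ℂ} (hρ : Continuous ρ)
    {K : Set X} (hK : IsCompact K) :
    ∃ S : H →L[ℂ] H, IsCompactOperator S ∧ ∀ x y : H,
      IntegrableOn (fun ξ => ρ ξ * (inner ℂ (B ξ) y * inner ℂ x (B ξ))) K μ ∧
      inner ℂ x (S y) = ∫ ξ in K, ρ ξ * (inner ℂ (B ξ) y * inner ℂ x (B ξ)) ∂μ := by
  set p : Submodule ℂ (H →L[ℂ] H) := compactOperator (RingHom.id ℂ) H H with hp
  -- The compact operators form a Banach space, so the Bochner integral can be taken inside it and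
  -- compactness of its value is automatic.
  have hpc : IsClosed (p : Set (H →L[ℂ] H)) := isClosed_setOfPred_isCompactOperator
  have : CompleteSpace p := hpc.completeSpace_coe
  have hmem : ∀ ξ, ρ ξ • InnerProductSpace.rankOne ℂ (B ξ) (B ξ) ∈ p := by
    intro ξ
    refine p.smul_mem _ ?_
    change IsCompactOperator _
    rw [InnerProductSpace.rankOne_def']
    exact (isCompactOperator_of_locallyCompactSpace_dom (innerSL ℂ (B ξ))).clm_comp
      (ContinuousLinearMap.toSpanSingleton ℂ (B ξ))
  set F : X → p := fun ξ => ⟨ρ ξ • InnerProductSpace.rankOne ℂ (B ξ) (B ξ), hmem ξ⟩ with hF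
  have hFc : Continuous F := by
    refine Continuous.subtype_mk ?_ _
    refine hρ.smul ?_
    exact (ContinuousLinearMap.smulRightL ℂ H H).continuous₂.comp
      (((innerSL ℂ (E := H)).continuous.comp hB).prodMk hB)
  have hFi : IntegrableOn F K μ := hFc.continuousOn.integrableOn_compact hK
  refine ⟨(∫ ξ in K, F ξ ∂μ : p), (∫ ξ in K, F ξ ∂μ : p).2, fun x y => ?_⟩
  set L : p →L[ℂ] ℂ := (innerSL ℂ x) ∘L (ContinuousLinearMap.apply ℂ H y) ∘L p.subtypeL with hL
  have hLF : ∀ ξ, L (F ξ) = ρ ξ * (inner ℂ (B ξ) y * inner ℂ x (B ξ)) := by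
    intro ξ
    simp [hL, hF]
  have h1 := L.integrable_comp hFi
  have h2 := L.integral_comp_comm hFi
  simp only [hLF] at h1 h2
  exact ⟨h1, h2.symm⟩

lemma isCompactOperator_of_forall_norm_sub_le {T : H →L[ℂ] H}
    (h : ∀ ε : ℝ, 0 < ε → ∃ S : H →L[ℂ] H, IsCompactOperator S ∧ ‖T - S‖ ≤ ε) :
    IsCompactOperator T := by
  have hc : IsClosed {f : H →L[ℂ] H | IsCompactOperator f} := isClosed_setOfPred_isCompactOperator
  have : T ∈ closure {f : H →L[ℂ] H | IsCompactOperator f} := by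
    rw [Metric.mem_closure_iff]
    intro ε hε
    obtain ⟨S, hS, hle⟩ := h (ε / 2) (half_pos hε)
    exact ⟨S, hS, by rw [dist_eq_norm]; linarith⟩
  rwa [hc.closure_eq] at this

end HilbertSpace

/-! ### Toeplitz operators of Carleson measures -/

variable {α : ℝ} {w : ℂ → ℝ}

/-- The Carleson embedding inequality `∫ |f|² e^{-α|z|²} dμ ≤ C ‖f‖²`. -/
def CarlesonBound (α : ℝ) (w : ℂ → ℝ) (μ : Measure ℂ) (C : ℝ≥0) : Prop :=
  ∀ f : FockSpace α w, ∫⁻ z, fockDensity α (entireRep f) z ∂μ ≤ C * ENNReal.ofReal (‖f‖ ^ 2)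

/-- The measure `e^{-α|z|²} dμ`. -/
noncomputable def gaussMeasure (α : ℝ) (μ : Measure ℂ) : Measure ℂ :=
  μ.withDensity fun z => ((Real.exp (-α * ‖z‖ ^ 2)).toNNReal : ℝ≥0∞)

lemma measurable_gauss (α : ℝ) : Measurable fun z : ℂ => (Real.exp (-α * ‖z‖ ^ 2)).toNNReal := by
  fun_prop

lemma lintegral_enorm_sq_gaussMeasure (μ : Measure ℂ) {F : ℂ → ℂ} (hF : Continuous F) :
    ∫⁻ z, ‖F z‖ₑ ^ 2 ∂gaussMeasure α μ = ∫⁻ z, fockDensity α F z ∂μ := by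
  rw [gaussMeasure, lintegral_withDensity_eq_lintegral_mul _
    (measurable_gauss α).coe_nnreal_ennreal (by fun_prop)]
  refine lintegral_congr fun z => ?_
  rw [Pi.mul_apply, fockDensity, mul_comm, ENNReal.ofReal_mul (by positivity),
    ENNReal.ofReal_pow (norm_nonneg _), ofReal_norm]
  rfl

lemma CarlesonBound.memLp {μ : Measure ℂ} {C : ℝ≥0} (hC : CarlesonBound α w μ C)
    (f : FockSpace α w) : MemLp (entireRep f) 2 (gaussMeasure α μ) := by
  refine ⟨(continuous_entireRep f).aestronglyMeasurable, ?_⟩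
  rw [eLpNorm_lt_top_iff_lintegral_rpow_enorm_lt_top (by simp) (by simp)]
  simp only [ENNReal.toReal_ofNat, ENNReal.rpow_ofNat]
  rw [lintegral_enorm_sq_gaussMeasure μ (continuous_entireRep f)]
  exact (hC f).trans_lt (by finiteness)

lemma CarlesonBound.norm_toLp_sq {μ : Measure ℂ} {C : ℝ≥0} (hC : CarlesonBound α w μ C)
    (f : FockSpace α w) : ENNReal.ofReal (‖(hC.memLp f).toLp‖ ^ 2) =
      ∫⁻ z, fockDensity α (entireRep f) z ∂μ := by
  rw [enorm_Lp_sq, ← lintegral_enorm_sq_gaussMeasure μ (continuous_entireRep f)]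
  refine lintegral_congr_ae ?_
  filter_upwards [(hC.memLp f).coeFn_toLp] with z hz
  rw [hz]

/-- The embedding of the Fock space into `L²(e^{-α|z|²} dμ)`. -/
noncomputable def carlesonEmbedding [Admissible α w] {μ : Measure ℂ} {C : ℝ≥0}
    (hC : CarlesonBound α w μ C) : FockSpace α w →L[ℂ] Lp ℂ 2 (gaussMeasure α μ) :=
  LinearMap.mkContinuous
    { toFun := fun f => (hC.memLp f).toLp
      map_add' := fun f g => by
        rw [← MemLp.toLp_add]
        congr 1
        exact funext fun z => entireRep_add f g z
      map_smul' := fun c f => by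
        rw [RingHom.id_apply, ← MemLp.toLp_const_smul]
        congr 1
        exact funext fun z => entireRep_smul c f z }
    (√C) (fun f => by
      have h := hC f
      rw [← hC.norm_toLp_sq, ← ENNReal.ofReal_coe_nnreal, ← ENNReal.ofReal_mul (by positivity),
        ENNReal.ofReal_le_ofReal_iff (by positivity)] at h
      refine abs_le_of_sq_le_sq' ?_ (by positivity) |>.2
      rw [mul_pow, Real.sq_sqrt (by positivity)]
      exact h)

lemma norm_carlesonEmbedding_sq [Admissible α w] {μ : Measure ℂ} {C : ℝ≥0}
    (hC : CarlesonBound α w μ C) (f : FockSpace α w) :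
    ENNReal.ofReal (‖carlesonEmbedding hC f‖ ^ 2) = ∫⁻ z, fockDensity α (entireRep f) z ∂μ :=
  hC.norm_toLp_sq f

lemma norm_carlesonEmbedding_le [Admissible α w] {μ : Measure ℂ} {C : ℝ≥0}
    (hC : CarlesonBound α w μ C) : ‖carlesonEmbedding hC‖ ≤ √C :=
  LinearMap.mkContinuous_norm_le _ (by positivity) _

/-- The Toeplitz operator of a Carleson measure. -/
noncomputable def toeplitz [Admissible α w] {μ : Measure ℂ} {C : ℝ≥0}
    (hC : CarlesonBound α w μ C) : FockSpace α w →L[ℂ] FockSpace α w :=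
  ContinuousLinearMap.adjoint (carlesonEmbedding hC) ∘L carlesonEmbedding hC

lemma inner_toeplitz [Admissible α w] {μ : Measure ℂ} {C : ℝ≥0}
    (hC : CarlesonBound α w μ C) (g f : FockSpace α w) :
    (inner ℂ g (toeplitz hC f) : ℂ) =
      inner ℂ (carlesonEmbedding hC g) (carlesonEmbedding hC f) :=
  ContinuousLinearMap.adjoint_inner_right (carlesonEmbedding hC) g (carlesonEmbedding hC f)

lemma norm_toeplitz_le [Admissible α w] {μ : Measure ℂ} {C : ℝ≥0}
    (hC : CarlesonBound α w μ C) : ‖toeplitz hC‖ ≤ C := by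
  have h := norm_carlesonEmbedding_le hC
  calc ‖toeplitz hC‖ ≤ ‖ContinuousLinearMap.adjoint (carlesonEmbedding hC)‖ *
        ‖carlesonEmbedding hC‖ := ContinuousLinearMap.opNorm_comp_le _ _
    _ = ‖carlesonEmbedding hC‖ * ‖carlesonEmbedding hC‖ := by
        rw [LinearIsometryEquiv.norm_map]
    _ ≤ √C * √C := by gcongr
    _ = C := Real.mul_self_sqrt (by positivity)

lemma isPositive_toeplitz [Admissible α w] {μ : Measure ℂ} {C : ℝ≥0}
    (hC : CarlesonBound α w μ C) : (toeplitz hC).IsPositive :=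
  ContinuousLinearMap.isPositive_adjoint_comp_self _

/-- The form equals ⟨Jg, Jf⟩ for the embedding J. The symmetric bound by a sum of squares later
produces one probability density for each pair e_n, σ_n. -/
lemma enorm_inner_toeplitz_le [Admissible α w] {μ : Measure ℂ} {C : ℝ≥0}
    (hC : CarlesonBound α w μ C) (g f : FockSpace α w) :
    2 * ‖(inner ℂ g (toeplitz hC f) : ℂ)‖ₑ ≤
      ∫⁻ z, fockDensity α (entireRep g) z ∂μ + ∫⁻ z, fockDensity α (entireRep f) z ∂μ := by
  rw [← norm_carlesonEmbedding_sq hC, ← norm_carlesonEmbedding_sq hC, inner_toeplitz,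
    ← ofReal_norm, ← ENNReal.ofReal_add (by positivity) (by positivity)]
  have e2 : ∀ x : ℝ, 2 * ENNReal.ofReal x = ENNReal.ofReal (2 * x) := fun x => by
    rw [ENNReal.ofReal_mul (by positivity), ENNReal.ofReal_ofNat]
  rw [e2]
  refine ENNReal.ofReal_le_ofReal ?_
  have h1 := norm_inner_le_norm (𝕜 := ℂ) (carlesonEmbedding hC g) (carlesonEmbedding hC f)
  have h2 := two_mul_le_add_sq ‖carlesonEmbedding hC g‖ ‖carlesonEmbedding hC f‖
  linarith

lemma isToeplitz_toeplitz [Admissible α w] {μ : Measure ℂ} {C : ℝ≥0}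
    (hC : CarlesonBound α w μ C) : IsToeplitz μ (toeplitz hC) := by
  intro f z
  have hae : (fun ξ => (inner ℂ (carlesonEmbedding hC (kernel α w z) ξ)
      (carlesonEmbedding hC f ξ) : ℂ)) =ᵐ[gaussMeasure α μ] fun ξ =>
      entireRep f ξ * starRingEnd ℂ (entireRep (kernel α w z) ξ) := by
    filter_upwards [(hC.memLp f).coeFn_toLp, (hC.memLp (kernel α w z)).coeFn_toLp] with ξ h1 h2
    change inner ℂ ((hC.memLp (kernel α w z)).toLp _ ξ) ((hC.memLp f).toLp _ ξ) = _
    rw [h1, h2]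
    rfl
  have hfun : (fun ξ => entireRep f ξ * starRingEnd ℂ (entireRep (kernel α w z) ξ) *
      (Real.exp (-α * ‖ξ‖ ^ 2) : ℂ)) = fun ξ => (Real.exp (-α * ‖ξ‖ ^ 2)).toNNReal •
        (entireRep f ξ * starRingEnd ℂ (entireRep (kernel α w z) ξ)) := by
    funext ξ
    rw [NNReal.smul_def, Real.coe_toNNReal _ (by positivity), Complex.real_smul, mul_comm]
  rw [hfun]
  constructor
  · rw [← integrable_withDensity_iff_integrable_smul (measurable_gauss α)]
    exact (L2.integrable_inner _ _).congr hae
  · rw [← integral_withDensity_eq_integral_smul (measurable_gauss α), entireRep_eq_inner,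
      inner_toeplitz, L2.inner_def]
    exact integral_congr_ae hae

lemma entireRep_injective [Admissible α w] {f g : FockSpace α w}
    (h : ∀ z, entireRep f z = entireRep g z) : f = g := by
  refine Subtype.ext (Lp.ext ?_)
  refine (coeFn_ae_eq_entireRep f).trans (EventuallyEq.trans ?_ (coeFn_ae_eq_entireRep g).symm)
  exact Eventually.of_forall h

lemma IsToeplitz.unique [Admissible α w] {μ : Measure ℂ}
    {T T' : FockSpace α w →L[ℂ] FockSpace α w} (h : IsToeplitz μ T) (h' : IsToeplitz μ T') :
    T = T' :=
  ContinuousLinearMap.ext fun f => entireRep_injective fun z =>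
    ((h f z).2).trans ((h' f z).2).symm

/-- Pairing with b_z is evaluation at z divided by ‖B_z‖, and this factor turns the conjugate of B_z
in the Toeplitz integral into that of b_z. The assumed absolute convergence allows the passage to
the integral in [0,∞]. -/
lemma IsToeplitz.berezin_eq [Admissible α w] {μ : Measure ℂ}
    {T : FockSpace α w →L[ℂ] FockSpace α w} (h : IsToeplitz μ T) (z : ℂ) :
    berezin α w μ z =
      ‖(inner ℂ (normalizedKernel α w z) (T (normalizedKernel α w z)) : ℂ)‖ₑ := by
  obtain ⟨hint, heq⟩ := h (normalizedKernel α w z) z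
  have hk := norm_kernel_pos α w z
  set k : ℂ := ((‖kernel α w z‖⁻¹ : ℝ) : ℂ) with hkdef
  have e0 : ∀ g : FockSpace α w, (inner ℂ (normalizedKernel α w z) g : ℂ) =
      k * entireRep g z := fun g => by
    have e : (inner ℂ (normalizedKernel α w z) g : ℂ) =
        starRingEnd ℂ k * inner ℂ (kernel α w z) g :=
      inner_smul_left (𝕜 := ℂ) (kernel α w z) g k
    rw [e, entireRep_eq_inner, hkdef, Complex.conj_ofReal]
  have e1 : ∀ ξ, k * (entireRep (normalizedKernel α w z) ξ *
      starRingEnd ℂ (entireRep (kernel α w z) ξ) * (Real.exp (-α * ‖ξ‖ ^ 2) : ℂ)) =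
      ((‖entireRep (normalizedKernel α w z) ξ‖ ^ 2 * Real.exp (-α * ‖ξ‖ ^ 2) : ℝ) : ℂ) := by
    intro ξ
    have e2 : starRingEnd ℂ (entireRep (normalizedKernel α w z) ξ) =
        k * starRingEnd ℂ (entireRep (kernel α w z) ξ) := by
      rw [normalizedKernel, entireRep_smul, map_mul, Complex.conj_ofReal]
    have e3 := Complex.mul_conj' (entireRep (normalizedKernel α w z) ξ)
    push_cast
    rw [← e3, e2]
    ring
  have hint' := hint.const_mul k
  simp only [e1] at hint'
  have hint'' : Integrable (fun ξ => ‖entireRep (normalizedKernel α w z) ξ‖ ^ 2 *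
      Real.exp (-α * ‖ξ‖ ^ 2)) μ := by
    have := hint'.re
    simpa only [RCLike.re_to_complex, Complex.ofReal_re] using this
  rw [e0, heq, ← integral_const_mul]
  simp only [e1]
  rw [integral_complex_ofReal, ← ofReal_norm, Complex.norm_real, Real.norm_of_nonneg
    (integral_nonneg fun ξ => by positivity), ofReal_integral_eq_lintegral_ofReal hint''
    (Eventually.of_forall fun ξ => by positivity)]
  rfl

lemma IsToeplitz.berezin_le [Admissible α w] {μ : Measure ℂ}
    {T : FockSpace α w →L[ℂ] FockSpace α w} (h : IsToeplitz μ T) (z : ℂ) :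
    berezin α w μ z ≤ ‖T‖ₑ := by
  rw [h.berezin_eq, ← ofReal_norm, ← ofReal_norm]
  refine ENNReal.ofReal_le_ofReal ?_
  have h1 := norm_inner_le_norm (𝕜 := ℂ) (normalizedKernel α w z) (T (normalizedKernel α w z))
  have h2 := T.le_opNorm (normalizedKernel α w z)
  rw [norm_normalizedKernel, mul_one] at h2
  rw [norm_normalizedKernel, one_mul] at h1
  exact h1.trans h2

end WeightedFock


namespace WeightedFock

/-! ### Compactness of Toeplitz operators -/

variable (α : ℝ) (w : ℂ → ℝ)

lemma exists_carlesonBound_of_average_le [Admissible α w] {r : ℝ} (hr : 0 < r) (hr1 : r ≤ 1) :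
    ∃ C : ℝ≥0, ∀ (μ : Measure ℂ) [SFinite μ] (S : ℝ≥0), (∀ z, average w r μ z ≤ S) →
      CarlesonBound α w μ (C * S) := by
  obtain ⟨C, hC⟩ := exists_lintegral_fockDensity_le_average α w hr hr1
  refine ⟨C, fun μ _ S hS f => (hC μ f).trans ?_⟩
  rw [ENNReal.coe_mul, mul_assoc, ofReal_norm_sq]
  gcongr _ * ?_
  rw [← lintegral_const_mul' _ _ (by simp)]
  exact lintegral_mono fun z => mul_le_mul_left (hS z) _

variable {α w}

/-- Split μ at a large disk K. The part on K gives a compact integral of rank one operators, and the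
part off K has uniformly small averages, hence a Toeplitz operator of small norm. -/
lemma isCompactOperator_toeplitz [Admissible α w] {μ : Measure ℂ} [IsLocallyFiniteMeasure μ]
    {C₀ : ℝ≥0} (hC₀ : CarlesonBound α w μ C₀) {r : ℝ} (hr : 0 < r) (hr1 : r ≤ 1)
    (hvan : ∀ ε : ℝ≥0, 0 < ε → ∃ R : ℝ, ∀ z : ℂ, R ≤ ‖z‖ → average w r μ z ≤ ε) :
    IsCompactOperator (toeplitz hC₀) := by
  obtain ⟨C, hC⟩ := exists_carlesonBound_of_average_le α w hr hr1
  refine isCompactOperator_of_forall_norm_sub_le fun ε hε => ?_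
  lift ε to ℝ≥0 using hε.le
  have hε0 : 0 < ε := by exact_mod_cast hε
  obtain ⟨R, hR⟩ := hvan (ε / (C + 1)) (by positivity)
  -- As r ≤ 1, a disk D(z,r) with |z| ≤ R lies in K and is not charged by the outer part.
  set K : Set ℂ := Metric.closedBall 0 (R + 1) with hK
  have hKc : IsCompact K := isCompact_closedBall _ _
  have hKm : MeasurableSet K := hKc.measurableSet
  have h2 : ∀ z, average w r (μ.restrict Kᶜ) z ≤ (ε / (C + 1) : ℝ≥0) := by
    intro z
    rcases le_total R ‖z‖ with h | h
    · refine le_trans ?_ (hR z h)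
      unfold average
      gcongr
      exact Measure.restrict_le_self
    · have : (μ.restrict Kᶜ) (Metric.ball z r) = 0 := by
        rw [Measure.restrict_apply measurableSet_ball]
        have hsub : Metric.ball z r ⊆ K := by
          intro x hx
          have h3 := Metric.mem_ball.1 hx
          rw [dist_eq_norm] at h3
          rw [hK, mem_closedBall_zero_iff]
          have := norm_le_norm_add_norm_sub' x z
          linarith
        rw [← Set.sdiff_eq, Set.sdiff_eq_empty.2 hsub, measure_empty]
      rw [average, this, ENNReal.zero_div]
      exact zero_le
  have hC2 := hC (μ.restrict Kᶜ) _ h2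
  obtain ⟨S, hS, hSin⟩ := exists_isCompactOperator_integral_rankOne (μ := μ)
    (continuous_kernel (α := α) (w := w)) (ρ := fun ξ => (Real.exp (-α * ‖ξ‖ ^ 2) : ℂ))
    (by fun_prop) hKc
  have hToep : IsToeplitz μ (S + toeplitz hC2) := by
    intro f z
    obtain ⟨hi1, he1⟩ := hSin (kernel α w z) f
    obtain ⟨hi2, he2⟩ := isToeplitz_toeplitz hC2 f z
    have hfun : ∀ ξ : ℂ, (Real.exp (-α * ‖ξ‖ ^ 2) : ℂ) * (inner ℂ (kernel α w ξ) f *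
        inner ℂ (kernel α w z) (kernel α w ξ)) = entireRep f ξ *
        starRingEnd ℂ (entireRep (kernel α w z) ξ) * (Real.exp (-α * ‖ξ‖ ^ 2) : ℂ) := by
      intro ξ
      rw [← entireRep_eq_inner, ← entireRep_eq_inner, entireRep_kernel_symm ξ z]
      ring
    simp only [hfun] at hi1 he1
    have hint := integrableOn_univ.1 (by
      rw [← union_compl_self K]
      exact IntegrableOn.union hi1 hi2)
    refine ⟨hint, ?_⟩
    rw [← integral_add_compl hKm hint, ← he1, ← he2, ← entireRep_eq_inner, ← entireRep_add]
    rfl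
  refine ⟨S, hS, ?_⟩
  rw [(isToeplitz_toeplitz hC₀).unique hToep, add_sub_cancel_left]
  refine (norm_toeplitz_le hC2).trans ?_
  rw [NNReal.coe_le_coe]
  calc C * (ε / (C + 1)) ≤ (C + 1) * (ε / (C + 1)) := by gcongr; simp
    _ = ε := by field_simp

/-- If all neighbourhoods of x had infinite mass, the average would be ∞ throughout D(x,r), and with
h(∞) = ∞ the integral would diverge. -/
lemma isLocallyFiniteMeasure_of_modularIntegral [ha : Admissible α w] {μ : Measure ℂ}
    {h : ℝ≥0 → ℝ≥0} {r : ℝ} (hr : 0 < r) {t : ℝ≥0} (ht : 0 < t)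
    (hfin : modularIntegral h (average w r μ) t ≠ ∞) : IsLocallyFiniteMeasure μ := by
  refine ⟨fun x => ?_⟩
  by_contra hx
  refine hfin (top_le_iff.1 ?_)
  have htop : ∀ z ∈ Metric.ball x r, extendTop h (t * average w r μ z) = ∞ := by
    intro z hz
    have h1 : μ (Metric.ball z r) = ∞ := by
      by_contra h2
      exact hx ⟨_, Metric.isOpen_ball.mem_nhds (Metric.mem_ball_comm.1 hz), lt_top_iff_ne_top.2 h2⟩
    rw [average_eq, h1, ENNReal.top_div_of_ne_top (ha.doubling.finite z r),
      ENNReal.mul_top (by simpa using ht.ne'), extendTop_top]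
  calc (∞ : ℝ≥0∞) = ∞ * volume (Metric.ball x r) :=
        (ENNReal.top_mul (Metric.measure_ball_pos volume x hr).ne').symm
    _ = ∫⁻ _ in Metric.ball x r, ∞ := (setLIntegral_const _ _).symm
    _ ≤ ∫⁻ z in Metric.ball x r, extendTop h (t * average w r μ z) :=
        setLIntegral_mono' measurableSet_ball fun z hz => (htop z hz).ge
    _ ≤ _ := setLIntegral_le_lintegral _ _

lemma isLocallyFiniteMeasure_of_average_le [ha : Admissible α w] {μ : Measure ℂ}
    {r : ℝ} (hr : 0 < r) (hfin : ∀ z, average w r μ z ≠ ∞) : IsLocallyFiniteMeasure μ := by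
  refine ⟨fun x => ⟨_, Metric.ball_mem_nhds x hr, lt_top_iff_ne_top.2 fun h => hfin x ?_⟩⟩
  rw [average_eq, h, ENNReal.top_div_of_ne_top (ha.doubling.finite x r)]

lemma exists_setLIntegral_compl_ball_lt {g : ℂ → ℝ≥0∞}
    (hfin : ∫⁻ z, g z ≠ ∞) {ε : ℝ≥0∞} (hε : 0 < ε) :
    ∃ R : ℝ, ∫⁻ z in (Metric.ball (0 : ℂ) R)ᶜ, g z < ε := by
  set P := (volume : Measure ℂ).withDensity g with hP
  have hlim := tendsto_measure_iInter_atTop (μ := P)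
    (s := fun n : ℕ => (Metric.ball (0 : ℂ) n)ᶜ)
    (fun n => measurableSet_ball.compl.nullMeasurableSet)
    (fun m n hmn => compl_subset_compl.2 (Metric.ball_subset_ball (by exact_mod_cast hmn)))
    ⟨0, by
      refine ne_top_of_le_ne_top ?_ (measure_mono (subset_univ _))
      rwa [hP, withDensity_apply _ MeasurableSet.univ, Measure.restrict_univ]⟩
  rw [← compl_iUnion, Metric.iUnion_ball_nat, compl_univ, measure_empty] at hlim
  obtain ⟨n, hn⟩ := (hlim.eventually_lt_const hε).exists
  refine ⟨n, ?_⟩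
  rwa [Function.comp_apply, hP, withDensity_apply _ measurableSet_ball.compl] at hn

/-- If a gauge function of an average is integrable, then the averages over smaller disks are
bounded and vanish at infinity. -/
lemma average_bounded_and_vanishing {μ : Measure ℂ} {h : ℝ≥0 → ℝ≥0}
    (hh : IsGauge h) {r : ℝ} (hr : 0 < r) (hr1 : r ≤ 1) {K : ℝ≥0}
    (hK : ∀ (μ : Measure ℂ) (z y : ℂ), dist z y ≤ r / 2 →
      average w (r / 2) μ y ≤ K * average w r μ z) {t : ℝ≥0} (ht : 0 < t)
    (hfin : modularIntegral h (average w r μ) (t * K) ≠ ∞) :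
    (∃ S : ℝ≥0, ∀ z, average w (r / 2) μ z ≤ S) ∧
      ∀ ε : ℝ≥0, 0 < ε → ∃ R : ℝ, ∀ z : ℂ, R ≤ ‖z‖ → average w (r / 2) μ z ≤ ε := by
  set V : ℝ≥0∞ := volume (Metric.ball (0 : ℂ) (r / 2)) with hV
  have hV0 : V ≠ 0 := (Metric.measure_ball_pos volume (0 : ℂ) (half_pos hr)).ne'
  have hVt : V ≠ ∞ := measure_ball_lt_top.ne
  have key := extendTop_average_mul_le w hK hh μ t
  set Ψ : ℂ → ℝ≥0∞ := fun z => extendTop h ((t * K : ℝ≥0) * average w r μ z) with hΨ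
  have ht0 : (t : ℝ≥0∞) ≠ 0 := by simpa using ht.ne'
  constructor
  -- An affine minorant of positive slope: convexity makes h grow at least linearly, so a bound for
  -- h of the average bounds the average. X is that bound solved for the average.
  · obtain ⟨m, b, hmb, hle⟩ := hh.exists_affine_le (x := ∞) (a := 1) (by simp)
    have hm : (m : ℝ≥0∞) ≠ 0 := by
      intro hm
      rw [hm, zero_mul] at hle
      simp at hle
    set A := ∫⁻ z, Ψ z with hA
    have hAfin : A ≠ ∞ := hfin
    set X : ℝ≥0∞ := (A / V + b) / m / t with hX
    have hXt : X ≠ ∞ := ENNReal.div_ne_top (ENNReal.div_ne_top (ENNReal.add_ne_top.2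
      ⟨ENNReal.div_ne_top hAfin hV0, by simp⟩) hm) ht0
    refine ⟨X.toNNReal, fun z => ?_⟩
    rw [ENNReal.coe_toNNReal hXt, hX, ENNReal.le_div_iff_mul_le (Or.inl ht0) (Or.inl (by simp)),
      ENNReal.le_div_iff_mul_le (Or.inl hm) (Or.inl (by simp))]
    calc average w (r / 2) μ z * t * m = m * (t * average w (r / 2) μ z) := by ring
      _ ≤ extendTop h (t * average w (r / 2) μ z) + b := hmb _
      _ ≤ A / V + b := by
          gcongr
          rw [ENNReal.le_div_iff_mul_le (Or.inl hV0) (Or.inl hVt)]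
          exact (key z).trans (setLIntegral_le_lintegral _ _)
  · intro ε hε
    -- Far out, the integral of h over a disk D(z,r/2) drops below this number, and strict
    -- inequality between the values of h passes to the arguments.
    have hpos : 0 < extendTop h (t * ε : ℝ≥0) * V := by
      refine ENNReal.mul_pos ?_ hV0
      rw [extendTop_coe]
      have : h 0 < h (t * ε) := hh.strictMono (by positivity)
      rw [hh.map_zero] at this
      simpa using this.ne'
    obtain ⟨R, hR⟩ := exists_setLIntegral_compl_ball_lt (g := Ψ) hfin hpos
    refine ⟨R + 1, fun z hz => ?_⟩
    have hsub : Metric.ball z (r / 2) ⊆ (Metric.ball (0 : ℂ) R)ᶜ := by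
      intro x hx hx'
      have h1 := Metric.mem_ball.1 hx
      rw [dist_eq_norm] at h1
      rw [mem_ball_zero_iff] at hx'
      have := norm_le_norm_add_norm_sub x z
      linarith
    have h1 : extendTop h (t * average w (r / 2) μ z) * V < extendTop h (t * ε : ℝ≥0) * V :=
      (key z).trans_lt ((lintegral_mono_set hsub).trans_lt hR)
    have h2 : extendTop h (t * average w (r / 2) μ z) < extendTop h (t * ε : ℝ≥0) :=
      lt_of_mul_lt_mul_right h1 zero_le
    have h3 := (hh.monotone_extendTop.reflect_lt h2).le
    rw [ENNReal.coe_mul] at h3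
    exact (ENNReal.mul_le_mul_iff_right ht0 (by simp)).1 h3

end WeightedFock


namespace WeightedFock

/-! ### Canonical decompositions of positive compact operators -/

section SpectralTheorem

variable {H : Type*} [NormedAddCommGroup H] [InnerProductSpace ℂ H] [CompleteSpace H]

open scoped ComplexOrder in
/-- The norm of a non-zero positive compact operator is an eigenvalue. -/
lemma exists_eigenvector_norm {T : H →L[ℂ] H} (hT : IsCompactOperator T) (hpos : T.IsPositive)
    (h0 : T ≠ 0) : ∃ e : H, ‖e‖ = 1 ∧ T e = ((‖T‖ : ℝ) : ℂ) • e := by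
  have hN : Nontrivial (H →L[ℂ] H) := ⟨T, 0, h0⟩
  obtain ⟨k, hk, hkr⟩ := spectrum.exists_nnnorm_eq_spectralRadius T
  -- Self-adjointness gives a spectral value of modulus ‖T‖. Compactness makes it an eigenvalue, and
  -- positivity makes it equal to ‖T‖.
  rw [ContinuousLinearMap.spectralRadius_eq_nnnorm T hpos.isSelfAdjoint, ENNReal.coe_inj] at hkr
  have hkn : ‖k‖ = ‖T‖ := congrArg NNReal.toReal hkr
  have hk0 : k ≠ 0 := by
    rw [← norm_ne_zero_iff, hkn]; exact norm_ne_zero_iff.2 h0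
  obtain ⟨v, hv⟩ := ((hT.hasEigenvalue_iff_mem_spectrum hk0).2 hk).exists_hasEigenvector
  have hTv : T v = k • v := hv.apply_eq_smul
  have hv0 : ‖v‖ ≠ 0 := norm_ne_zero_iff.2 hv.2
  have hin := hpos.inner_nonneg_right v
  rw [hTv, inner_smul_right, inner_self_eq_norm_sq_to_K] at hin
  have hk' : k = ((‖T‖ : ℝ) : ℂ) := by
    have h1 : (0 : ℂ) ≤ k := by
      have h2 : (0 : ℂ) ≤ (((‖v‖ ^ 2)⁻¹ : ℝ) : ℂ) := Complex.zero_le_real.2 (by positivity)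
      have h3 := mul_nonneg hin h2
      have h4 : ((‖v‖ : ℝ) : ℂ) ≠ 0 := by exact_mod_cast hv0
      convert! h3 using 1
      push_cast
      simp [h4]
    rw [← hkn]
    exact (RCLike.norm_of_nonneg' h1).symm
  refine ⟨((‖v‖⁻¹ : ℝ) : ℂ) • v, ?_, ?_⟩
  · rw [norm_smul, Complex.norm_real, norm_inv, norm_norm, inv_mul_cancel₀ hv0]
  · rw [map_smul, hTv, hk', smul_comm]

/-- Deflation of a positive compact operator by a top eigenvector. -/
lemma exists_deflation {T : H →L[ℂ] H} (hT : IsCompactOperator T) (hpos : T.IsPositive) :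
    ∃ (e : H) (T' : H →L[ℂ] H), IsCompactOperator T' ∧ T'.IsPositive ∧ ‖T'‖ ≤ ‖T‖ ∧
      (∀ x, T' x = T x - ((‖T‖ : ℝ) : ℂ) • (inner ℂ e x : ℂ) • e) ∧
      (T ≠ 0 → ‖e‖ = 1 ∧ T e = ((‖T‖ : ℝ) : ℂ) • e) := by
  by_cases h0 : T = 0
  · refine ⟨0, T, hT, hpos, le_rfl, fun x => by simp, fun h => absurd h0 h⟩
  obtain ⟨e, he, hTe⟩ := exists_eigenvector_norm hT hpos h0
  -- Compression to the complement of e keeps compactness and positivity without computation; as e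
  -- is an eigenvector, it amounts to subtracting ‖T‖⟨e, ·⟩e.
  set U : Submodule ℂ H := (ℂ ∙ e)ᗮ
  have hU : ∀ x, U.starProjection x = x - (inner ℂ e x : ℂ) • e := fun x => by
    rw [Submodule.starProjection_orthogonal_val, Submodule.starProjection_unit_singleton ℂ he]
  have hee : (inner ℂ e e : ℂ) = 1 := by
    rw [inner_self_eq_norm_sq_to_K, he]; simp
  refine ⟨e, U.starProjection ∘L T ∘L U.starProjection, ?_, hpos.conj_starProjection U, ?_, ?_,
    fun _ => ⟨he, hTe⟩⟩
  · exact (hT.comp_clm U.starProjection).clm_comp U.starProjection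
  · refine (ContinuousLinearMap.opNorm_comp_le _ _).trans ?_
    refine (mul_le_of_le_one_left (norm_nonneg _) (Submodule.starProjection_norm_le _)).trans ?_
    refine (ContinuousLinearMap.opNorm_comp_le _ _).trans ?_
    exact mul_le_of_le_one_right (norm_nonneg _) (Submodule.starProjection_norm_le _)
  · intro x
    have h1 : ∀ y, (inner ℂ e (T y) : ℂ) = ((‖T‖ : ℝ) : ℂ) * inner ℂ e y := fun y => by
      have e1 : (inner ℂ (T e) y : ℂ) = inner ℂ e (T y) := hpos.isSymmetric e y
      rw [← e1, hTe, inner_smul_left]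
      simp
    simp only [ContinuousLinearMap.comp_apply, hU, map_sub, map_smul, h1, hTe, inner_sub_right,
      inner_smul_right, hee]
    match_scalars <;> ring_nf

/-- A canonical series built from orthonormal systems and bounded coefficients converges. -/
lemma summable_smul_inner_smul {s : ℕ → ℝ≥0} (hs : Antitone s) {e σ : ℕ → H}
    (he : Orthonormal ℂ (fun n : {n // s n ≠ 0} => e n))
    (hσ : Orthonormal ℂ (fun n : {n // s n ≠ 0} => σ n)) (x : H) :
    Summable fun n => ((s n : ℝ) : ℂ) • (inner ℂ (e n) x : ℂ) • σ n := by
  have hinj : Function.Injective (Subtype.val : {n // s n ≠ 0} → ℕ) := Subtype.val_injective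
  rw [← hinj.summable_iff]
  · have h1 := (hσ.orthogonalFamily).summable_iff_norm_sq_summable
      (fun n : {n // s n ≠ 0} => ((s n : ℝ) : ℂ) * (inner ℂ (e n) x : ℂ))
    have h2 : (Summable fun i : {n // s n ≠ 0} => ‖((s i : ℝ) : ℂ) * (inner ℂ (e i) x : ℂ)‖ ^ 2) := by
      refine Summable.of_nonneg_of_le (fun _ => by positivity) (fun i => ?_)
        ((he.inner_products_summable (x := x)).mul_left ((s 0 : ℝ) ^ 2))
      rw [norm_mul, mul_pow]
      refine mul_le_mul_of_nonneg_right ?_ (by positivity)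
      rw [Complex.norm_real, Real.norm_of_nonneg (s i).coe_nonneg]
      exact pow_le_pow_left₀ (s i).2 (hs (Nat.zero_le _)) 2
    refine (h1.2 h2).congr fun i => ?_
    simp [LinearIsometry.toSpanSingleton_apply, mul_smul]
  · intro n hn
    have : s n = 0 := by
      by_contra h
      exact hn ⟨⟨n, h⟩, rfl⟩
    simp [this]

/-- A positive compact operator has a canonical decomposition. -/
lemma exists_isSingularValueSeq {T : H →L[ℂ] H} (hT : IsCompactOperator T) (hpos : T.IsPositive) :
    ∃ s, IsSingularValueSeq T s := by
  choose! v D hDc hDp hDn hD hv using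
    fun (S : H →L[ℂ] H) (h : IsCompactOperator S ∧ S.IsPositive) => exists_deflation h.1 h.2
  -- The remainder after n deflations; its norm is the n-th singular value.
  set R : ℕ → H →L[ℂ] H := fun n => D^[n] T
  have hR0 : R 0 = T := rfl
  have hRs : ∀ n, R (n + 1) = D (R n) := fun n => Function.iterate_succ_apply' D n T
  have hR : ∀ n, IsCompactOperator (R n) ∧ (R n).IsPositive := by
    intro n
    induction n with
    | zero => exact ⟨hT, hpos⟩
    | succ n ih => rw [hRs]; exact ⟨hDc _ ih, hDp _ ih⟩
  set s : ℕ → ℝ≥0 := fun n => ‖R n‖₊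
  set e : ℕ → H := fun n => v (R n)
  have hstep : ∀ n x, R (n + 1) x = R n x - ((s n : ℝ) : ℂ) • (inner ℂ (e n) x : ℂ) • e n :=
    fun n x => by rw [hRs]; exact hD _ (hR n) x
  have hne : ∀ n, s n ≠ 0 → ‖e n‖ = 1 ∧ R n (e n) = ((s n : ℝ) : ℂ) • e n := fun n h =>
    hv _ (hR n) (nnnorm_ne_zero_iff.1 h)
  have hanti : Antitone s := antitone_nat_of_succ_le fun n => by
    change ‖R (n + 1)‖₊ ≤ ‖R n‖₊
    rw [hRs]; exact hDn _ (hR n)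
  -- eigenvectors found before step `n` are killed by the later operators
  have hsymm : ∀ n x y, (inner ℂ (R n x) y : ℂ) = inner ℂ x (R n y) := fun n x y =>
    (hR n).2.isSymmetric x y
  have horth_of_ker : ∀ n x, s n ≠ 0 → R n x = 0 → (inner ℂ (e n) x : ℂ) = 0 := by
    intro n x hn hx
    have h1 := hsymm n (e n) x
    rw [hx, inner_zero_right, (hne n hn).2, inner_smul_left] at h1
    simpa [hn] using h1
  have hker : ∀ n x, R n x = 0 → R (n + 1) x = 0 := by
    intro n x hx
    by_cases hn : s n = 0
    · rw [hstep, hx, hn]; simp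
    · rw [hstep, hx, horth_of_ker n x hn hx]; simp
  have hkill : ∀ n, s n ≠ 0 → R (n + 1) (e n) = 0 := by
    intro n hn
    rw [hstep, (hne n hn).2, inner_self_eq_norm_sq_to_K, (hne n hn).1]; simp
  have hkill' : ∀ n m, s n ≠ 0 → n < m → R m (e n) = 0 := by
    intro n m hn hnm
    induction m, hnm using Nat.le_induction with
    | base => exact hkill n hn
    | succ m _ ih => exact hker m _ ih
  have horth : ∀ n m, s n ≠ 0 → s m ≠ 0 → n < m → (inner ℂ (e m) (e n) : ℂ) = 0 := fun n m hn hm h =>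
    horth_of_ker m _ hm (hkill' n m hn h)
  have hON : Orthonormal ℂ (fun n : {n // s n ≠ 0} => e n) := by
    refine ⟨fun n => (hne n n.2).1, fun n m hnm => ?_⟩
    rcases lt_or_gt_of_ne (fun h => hnm (Subtype.ext h) : (n : ℕ) ≠ m) with h | h
    · rw [← inner_conj_symm, horth n m n.2 m.2 h, map_zero]
    · exact horth m n m.2 n.2 h
  have hpartial : ∀ n x, ∑ i ∈ Finset.range n, ((s i : ℝ) : ℂ) • (inner ℂ (e i) x : ℂ) • e i
      = T x - R n x := by
    intro n x
    induction n with
    | zero => simp [hR0]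
    | succ n ih => rw [Finset.sum_range_succ, ih, hstep]; abel
  have hsum := summable_smul_inner_smul hanti hON hON
  have hTe : ∀ n, s n ≠ 0 → T (e n) = ((s n : ℝ) : ℂ) • e n := by
    intro n hn
    have h1 := hpartial n (e n)
    rw [Finset.sum_eq_zero, (hne n hn).2] at h1
    · exact (sub_eq_zero.1 h1.symm)
    · intro i hi
      have hi' := Finset.mem_range.1 hi
      have hsi : s i ≠ 0 := fun h => hn (le_antisymm (h ▸ hanti hi'.le) (by simp))
      rw [← inner_conj_symm, horth i n hsi hn hi']; simp
  -- Otherwise s_n ≥ ε for all n, and the vectors T e_n = s_n e_n, being orthogonal, are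
  -- ε-separated, against compactness of T.
  have hlim : Tendsto s atTop (𝓝 0) := by
    by_contra hcon
    obtain ⟨ε, hε, hεs⟩ : ∃ ε : ℝ≥0, 0 < ε ∧ ∀ n, ε ≤ s n := by
      by_contra! hex
      refine hcon (tendsto_order.2 ⟨fun a ha => absurd ha not_lt_zero, fun ε hε => ?_⟩)
      obtain ⟨n, hn⟩ := hex ε hε
      exact eventually_atTop.2 ⟨n, fun m hm => (hanti hm).trans_lt hn⟩
    have hs0 : ∀ n, s n ≠ 0 := fun n => (hε.trans_le (hεs n)).ne'
    have hcpt := hT.isCompact_closure_image_closedBall 1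
    obtain ⟨y, -, φ, hφ, hy⟩ := hcpt.tendsto_subseq (x := fun n => T (e n)) fun n =>
      subset_closure ⟨e n, by simp [(hne n (hs0 n)).1], rfl⟩
    obtain ⟨N, hN⟩ := Metric.cauchySeq_iff.1 hy.cauchySeq ε hε
    have h1 := hN N le_rfl (N + 1) (Nat.le_succ N)
    have hlt : φ N < φ (N + 1) := hφ (Nat.lt_succ_self N)
    simp only [Function.comp_apply, hTe _ (hs0 _)] at h1
    rw [dist_eq_norm] at h1
    refine absurd ((hεs (φ N)).trans ?_) (not_le.2 (NNReal.coe_lt_coe.1 (by simpa using h1) : ‖((s (φ N) : ℝ) : ℂ) • e (φ N) - ((s (φ (N + 1)) : ℝ) : ℂ) • e (φ (N + 1))‖₊ < ε))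
    have h2 := norm_inner_le_norm (𝕜 := ℂ) (e (φ N))
      (((s (φ N) : ℝ) : ℂ) • e (φ N) - ((s (φ (N + 1)) : ℝ) : ℂ) • e (φ (N + 1)))
    rw [inner_sub_right, inner_smul_right, inner_smul_right, ← inner_conj_symm (e (φ N)) (e (φ (N + 1))),
      horth _ _ (hs0 _) (hs0 _) hlt, inner_self_eq_norm_sq_to_K, (hne _ (hs0 _)).1] at h2
    exact NNReal.coe_le_coe.1 (by simpa using h2)
  refine ⟨s, hanti, hlim, e, e, hON, hON, fun x => ?_⟩
  have h1 := (hsum x).hasSum.tendsto_sum_nat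
  have h2 : Tendsto (fun n => ∑ i ∈ Finset.range n, ((s i : ℝ) : ℂ) • (inner ℂ (e i) x : ℂ) • e i)
      atTop (𝓝 (T x)) := by
    simp only [hpartial]
    have : Tendsto (fun n => R n x) atTop (𝓝 0) := by
      refine squeeze_zero_norm (a := fun n => (s n : ℝ) * ‖x‖) (fun n => (R n).le_opNorm x) ?_
      simpa using (NNReal.tendsto_coe.2 hlim).mul_const ‖x‖
    simpa using tendsto_const_nhds.sub this
  rw [← tendsto_nhds_unique h1 h2]
  exact (hsum x).hasSum

/-- The estimates below use only that the chosen sequence belongs to some canonical decomposition,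
so its uniqueness plays no role. -/
lemma isSingularValueSeq_singularValues {T : H →L[ℂ] H} (hT : IsCompactOperator T)
    (hpos : T.IsPositive) : IsSingularValueSeq T (singularValues T) := by
  have h := exists_isSingularValueSeq hT hpos
  rw [singularValues, dif_pos h]
  exact h.choose_spec

end SpectralTheorem

/-! ### Quadratic forms in terms of a canonical decomposition -/

section SingularValues

variable {H : Type*} [NormedAddCommGroup H] [InnerProductSpace ℂ H]

open Classical in
/-- Bessel's inequality for systems which are orthonormal off the zeros of `s`. -/
lemma tsum_ite_enorm_inner_sq_le {s : ℕ → ℝ≥0} {e : ℕ → H}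
    (he : Orthonormal ℂ (fun n : {n // s n ≠ 0} => e n)) (x : H) :
    ∑' n, (if s n = 0 then 0 else ‖(inner ℂ (e n) x : ℂ)‖ₑ ^ 2) ≤ ‖x‖ₑ ^ 2 := by
  have h1 : ∑' n, (if s n = 0 then 0 else ‖(inner ℂ (e n) x : ℂ)‖ₑ ^ 2)
      = ∑' n : {n // s n ≠ 0}, ‖(inner ℂ (e n) x : ℂ)‖ₑ ^ 2 := by
    refine (Eq.symm ?_)
    have := tsum_subtype {n | s n ≠ 0} (fun n => ‖(inner ℂ (e n) x : ℂ)‖ₑ ^ 2)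
    refine this.trans (tsum_congr fun n => ?_)
    by_cases hn : s n = 0 <;> simp [hn]
  have h2 : ∀ y : ℂ, ‖y‖ₑ ^ 2 = ENNReal.ofReal (‖y‖ ^ 2) := fun y => by
    rw [ENNReal.ofReal_pow (norm_nonneg _), ofReal_norm]
  rw [h1]
  simp_rw [h2]
  rw [← ENNReal.ofReal_tsum_of_nonneg (fun _ => by positivity) (he.inner_products_summable x)]
  refine (ENNReal.ofReal_le_ofReal (he.tsum_inner_products_le x)).trans_eq ?_
  rw [ENNReal.ofReal_pow (norm_nonneg _), ofReal_norm]

open Classical in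
/-- The `n`-th weight of a vector with respect to a canonical decomposition. -/
noncomputable def schmidtWeight (s : ℕ → ℝ≥0) (e σ : ℕ → H) (n : ℕ) (x : H) : ℝ≥0∞ :=
  2⁻¹ * ((if s n = 0 then 0 else ‖(inner ℂ (e n) x : ℂ)‖ₑ ^ 2) +
    if s n = 0 then 0 else ‖(inner ℂ (σ n) x : ℂ)‖ₑ ^ 2)

lemma tsum_schmidtWeight_le {s : ℕ → ℝ≥0} {e σ : ℕ → H}
    (he : Orthonormal ℂ (fun n : {n // s n ≠ 0} => e n))
    (hσ : Orthonormal ℂ (fun n : {n // s n ≠ 0} => σ n)) (x : H) :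
    ∑' n, schmidtWeight s e σ n x ≤ ‖x‖ₑ ^ 2 := by
  simp only [schmidtWeight]
  rw [ENNReal.tsum_mul_left, ENNReal.tsum_add]
  refine (mul_le_mul_right (add_le_add (tsum_ite_enorm_inner_sq_le he x)
    (tsum_ite_enorm_inner_sq_le hσ x)) _).trans_eq ?_
  rw [← two_mul, ← mul_assoc, ENNReal.inv_mul_cancel (by simp) (by simp), one_mul]

lemma mul_le_half_sq_add_sq (a b : ℝ≥0∞) : a * b ≤ 2⁻¹ * (a ^ 2 + b ^ 2) := by
  by_cases ha : a = ∞
  · subst ha; simp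
  by_cases hb : b = ∞
  · subst hb; simp
  lift a to ℝ≥0 using ha
  lift b to ℝ≥0 using hb
  have h : a * b ≤ 2⁻¹ * (a ^ 2 + b ^ 2) := by
    rw [← NNReal.coe_le_coe]; push_cast
    nlinarith [sq_nonneg ((a : ℝ) - b)]
  have h2 : ((2⁻¹ : ℝ≥0) : ℝ≥0∞) = 2⁻¹ := by simp
  rw [← h2]
  exact_mod_cast h

/-- Expand ⟨x, Tx⟩ termwise and use |⟨e_n, x⟩| |⟨σ_n, x⟩| ≤ ½(|⟨e_n, x⟩|² + |⟨σ_n, x⟩|²). For a unit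
vector x the weights sum to at most 1, which is the form Jensen needs. -/
lemma enorm_inner_apply_le_tsum {T : H →L[ℂ] H} {s : ℕ → ℝ≥0} {e σ : ℕ → H}
    (hsum : ∀ x : H, HasSum (fun n => ((s n : ℝ) : ℂ) • (inner ℂ (e n) x : ℂ) • σ n) (T x)) (x : H) :
    ‖(inner ℂ x (T x) : ℂ)‖ₑ ≤ ∑' n, s n * schmidtWeight s e σ n x := by
  have h1 := (hsum x).mapL (innerSL ℂ x)
  rw [innerSL_apply_apply] at h1
  rw [← h1.tsum_eq]
  refine enorm_tsum_le_tsum_enorm.trans (ENNReal.tsum_le_tsum fun n => ?_)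
  rw [innerSL_apply_apply, inner_smul_right, inner_smul_right, enorm_mul, enorm_mul]
  have h2 : ‖((s n : ℝ) : ℂ)‖ₑ = s n := by
    rw [← ofReal_norm, Complex.norm_real, Real.norm_of_nonneg (s n).coe_nonneg,
      ENNReal.ofReal_coe_nnreal]
  rw [h2]
  by_cases hn : s n = 0
  · simp [hn]
  · simp only [schmidtWeight, hn, if_false]
    refine mul_le_mul_right ?_ _
    rw [← enorm_norm (inner ℂ x (σ n) : ℂ), norm_inner_symm, enorm_norm]
    exact mul_le_half_sq_add_sq _ _

lemma inner_apply_eq_of_hasSum {T : H →L[ℂ] H} {s : ℕ → ℝ≥0} {e σ : ℕ → H}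
    (he : Orthonormal ℂ (fun n : {n // s n ≠ 0} => e n))
    (hσ : Orthonormal ℂ (fun n : {n // s n ≠ 0} => σ n))
    (hsum : ∀ x : H, HasSum (fun n => ((s n : ℝ) : ℂ) • (inner ℂ (e n) x : ℂ) • σ n) (T x)) {n : ℕ}
    (hn : s n ≠ 0) : (inner ℂ (σ n) (T (e n)) : ℂ) = ((s n : ℝ) : ℂ) := by
  have h1 := hsum (e n)
  have h2 : HasSum (fun m => ((s m : ℝ) : ℂ) • (inner ℂ (e m) (e n) : ℂ) • σ m)
      (((s n : ℝ) : ℂ) • (inner ℂ (e n) (e n) : ℂ) • σ n) := by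
    refine hasSum_single n fun m hm => ?_
    by_cases hsm : s m = 0
    · simp [hsm]
    · have : (inner ℂ (e m) (e n) : ℂ) = 0 :=
        he.2 (i := ⟨m, hsm⟩) (j := ⟨n, hn⟩) fun h => hm (congrArg Subtype.val h)
      simp [this]
  have hen : ‖e n‖ = 1 := he.1 ⟨n, hn⟩
  have hσn : ‖σ n‖ = 1 := hσ.1 ⟨n, hn⟩
  rw [h1.unique h2, inner_smul_right, inner_smul_right, inner_self_eq_norm_sq_to_K,
    inner_self_eq_norm_sq_to_K, hen, hσn]
  simp

end SingularValues

end WeightedFock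


namespace WeightedFock

/-! ### Singular values of Toeplitz operators -/

/-- Jensen's inequality for gauge functions and series. -/
lemma IsGauge.extendTop_tsum_le {h : ℝ≥0 → ℝ≥0} (hh : IsGauge h) {p : ℕ → ℝ≥0∞}
    (hp : ∑' n, p n ≤ 1) (g : ℕ → ℝ≥0∞) :
    extendTop h (∑' n, p n * g n) ≤ ∑' n, p n * extendTop h (g n) := by
  have key : ∀ g : ℕ → ℝ≥0∞, ∫⁻ n, g n ∂(Measure.count.withDensity p) = ∑' n, p n * g n := by
    intro g
    rw [lintegral_withDensity_eq_lintegral_mul _ (measurable_of_countable _)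
      (measurable_of_countable _), lintegral_count]
    rfl
  have h1 := hh.extendTop_lintegral_le (P := Measure.count.withDensity p) (by
    rw [withDensity_apply _ MeasurableSet.univ, Measure.restrict_univ, lintegral_count]
    exact hp) g
  rwa [key, key] at h1

section

variable (α : ℝ) (w : ℂ → ℝ)

lemma enorm_sq_eq_ofReal {E : Type*} [SeminormedAddCommGroup E] (x : E) :
    ‖x‖ₑ ^ 2 = ENNReal.ofReal (‖x‖ ^ 2) := by
  rw [ENNReal.ofReal_pow (norm_nonneg _), ofReal_norm]

/-- The Bessel inequality for the family b_z, applied to the unit vectors e_n and σ_n; hence the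
bound is uniform in n. -/
lemma exists_lintegral_schmidtWeight_le [Admissible α w] : ∃ C : ℝ≥0, ∀ (s : ℕ → ℝ≥0)
    (e σ : ℕ → FockSpace α w), Orthonormal ℂ (fun n : {n // s n ≠ 0} => e n) →
      Orthonormal ℂ (fun n : {n // s n ≠ 0} => σ n) → ∀ n,
      ∫⁻ z, schmidtWeight s e σ n (normalizedKernel α w z) ≤ C := by
  obtain ⟨C, hC⟩ := exists_lintegral_inner_normalizedKernel_le α w
  refine ⟨C, fun s e σ he hσ n => ?_⟩
  by_cases hn : s n = 0
  · simp [schmidtWeight, hn]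
  have hb := continuous_normalizedKernel α w
  have h1 : ∀ g : FockSpace α w, ‖g‖ = 1 →
      ∫⁻ z, ‖(inner ℂ g (normalizedKernel α w z) : ℂ)‖ₑ ^ 2 ≤ C := fun g hg => by
    have := hC g
    rw [hg] at this
    simp only [enorm_sq_eq_ofReal]
    simpa [norm_inner_symm] using this
  have hen : ‖e n‖ = 1 := he.1 ⟨n, hn⟩
  have hσn : ‖σ n‖ = 1 := hσ.1 ⟨n, hn⟩
  simp only [schmidtWeight, hn, if_false]
  have hm : ∀ g : FockSpace α w,
      Measurable fun z => ‖(inner ℂ g (normalizedKernel α w z) : ℂ)‖ₑ ^ 2 := fun g => by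
    have : Continuous fun z => (inner ℂ g (normalizedKernel α w z) : ℂ) :=
      continuous_const.inner hb
    exact this.measurable.enorm.pow_const 2
  rw [lintegral_const_mul' _ _ (by simp), lintegral_add_left (hm _)]
  refine (mul_le_mul_right (add_le_add (h1 _ hen) (h1 _ hσn)) _).trans_eq ?_
  rw [← two_mul, ← mul_assoc, ENNReal.inv_mul_cancel (by simp) (by simp), one_mul]

/-- The Berezin transform is controlled by the singular values. -/
lemma exists_modularIntegral_berezin_le_singularSum [Admissible α w] : ∃ C : ℝ≥0,
    ∀ (μ : Measure ℂ) (h : ℝ≥0 → ℝ≥0), IsGauge h →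
      ∀ T : FockSpace α w →L[ℂ] FockSpace α w, IsToeplitz μ T →
        IsSingularValueSeq T (singularValues T) → ∀ t : ℝ≥0,
        modularIntegral h (berezin α w μ) t ≤ C * singularSum h T t := by
  obtain ⟨C, hC⟩ := exists_lintegral_schmidtWeight_le α w
  refine ⟨C, fun μ h hh T hT hs t => ?_⟩
  set s := singularValues T with hsdef
  obtain ⟨-, -, e, σ, he, hσ, hsum⟩ := hs
  have hb := continuous_normalizedKernel α w
  have hm : ∀ n, Measurable fun z => schmidtWeight s e σ n (normalizedKernel α w z) := by
    intro n
    have h1 : ∀ g : FockSpace α w,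
        Measurable fun z => ‖(inner ℂ g (normalizedKernel α w z) : ℂ)‖ₑ ^ 2 := fun g => by
      have : Continuous fun z => (inner ℂ g (normalizedKernel α w z) : ℂ) :=
        continuous_const.inner hb
      exact this.measurable.enorm.pow_const 2
    by_cases hn : s n = 0
    · simp [schmidtWeight, hn]
    · simp only [schmidtWeight, hn, if_false]
      exact ((h1 _).add (h1 _)).const_mul _
  calc modularIntegral h (berezin α w μ) t
      ≤ ∫⁻ z, ∑' n, schmidtWeight s e σ n (normalizedKernel α w z) * (h (t * s n) : ℝ≥0∞) := by
        refine lintegral_mono fun z => ?_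
        have h1 : ∑' n, schmidtWeight s e σ n (normalizedKernel α w z) ≤ 1 := by
          refine (tsum_schmidtWeight_le he hσ _).trans_eq ?_
          rw [enorm_sq_eq_ofReal, norm_normalizedKernel]; simp
        refine le_trans (hh.monotone_extendTop ?_)
          ((hh.extendTop_tsum_le h1 fun n => ((t * s n : ℝ≥0) : ℝ≥0∞)).trans_eq ?_)
        · rw [hT.berezin_eq]
          refine (mul_le_mul_right (enorm_inner_apply_le_tsum hsum _) _).trans_eq ?_
          rw [← ENNReal.tsum_mul_left]
          refine tsum_congr fun n => ?_
          push_cast; ring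
        · simp only [extendTop_coe]
    _ = ∑' n, (∫⁻ z, schmidtWeight s e σ n (normalizedKernel α w z)) * (h (t * s n) : ℝ≥0∞) := by
        rw [lintegral_tsum fun n => ((hm n).mul_const _).aemeasurable]
        exact tsum_congr fun n => lintegral_mul_const _ (hm n)
    _ ≤ ∑' n, C * (h (t * s n) : ℝ≥0∞) :=
        ENNReal.tsum_le_tsum fun n => mul_le_mul_left (hC s e σ he hσ n) _
    _ = C * singularSum h T t := ENNReal.tsum_mul_left

/-- The singular values are controlled by the average function. -/
lemma exists_singularSum_le_modularIntegral_average [ha : Admissible α w] {r : ℝ} (hr : 0 < r)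
    (hr1 : r ≤ 1) : ∃ C K : ℝ≥0, 1 ≤ K ∧ ∀ (μ : Measure ℂ) [SFinite μ] (C₀ : ℝ≥0)
      (hC₀ : CarlesonBound α w μ C₀), IsCompactOperator (toeplitz hC₀) →
      ∀ h : ℝ≥0 → ℝ≥0, IsGauge h → ∀ t : ℝ≥0,
        singularSum h (toeplitz hC₀) t ≤ C * modularIntegral h (average w r μ) (t * K) := by
  have := ha.isLocallyFiniteMeasure
  obtain ⟨C₁, K₁, hK₁, H₁⟩ := exists_lintegral_average_le α w hr hr1
  obtain ⟨C₂, H₂⟩ := exists_lintegral_fockDensity_le_average α w (half_pos hr) (by linarith)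
  obtain ⟨D, hD⟩ := exists_norm_kernel_sq_mul_exp_le α w
  refine ⟨D * C₁, (C₂ + 1) * K₁, one_le_mul (by simp) hK₁, fun μ _ C₀ hC₀ hcpt h hh t => ?_⟩
  set T := toeplitz hC₀
  have hs := isSingularValueSeq_singularValues hcpt (isPositive_toeplitz hC₀)
  set s := singularValues T with hsdef
  obtain ⟨-, -, e, σ, he, hσ, hsum⟩ := hs
  set ν := weightMeasure w with hν
  have havm := measurable_average α w (r / 2) μ
  set Ψ : ℂ → ℝ≥0∞ := fun ζ => extendTop h ((t * (C₂ + 1) : ℝ≥0) * average w (r / 2) μ ζ) with hΨ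
  have hΨm : Measurable Ψ :=
    hh.measurable_extendTop.comp (havm.const_mul _)
  -- This density is read in two ways. For fixed n with s_n ≠ 0 it is ½(|e_n|² + |σ_n|²) e^{-α|ζ|²},
  -- of ν-integral 1. For fixed ζ its sum over n is at most ‖B_ζ‖² e^{-α|ζ|²}, by Bessel's
  -- inequality for B_ζ.
  set q : ℕ → ℂ → ℝ≥0∞ := fun n ζ =>
    schmidtWeight s e σ n (kernel α w ζ) * ENNReal.ofReal (Real.exp (-α * ‖ζ‖ ^ 2)) with hq
  have hqeq : ∀ n, s n ≠ 0 → q n = fun ζ => 2⁻¹ * (fockDensity α (entireRep (e n)) ζ +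
      fockDensity α (entireRep (σ n)) ζ) := by
    intro n hn
    funext ζ
    simp only [hq, schmidtWeight, hn, if_false, fockDensity, entireRep_eq_inner,
      enorm_sq_eq_ofReal, norm_inner_symm (kernel α w ζ)]
    rw [ENNReal.ofReal_mul (by positivity), ENNReal.ofReal_mul (by positivity)]
    ring
  have hq0 : ∀ n, s n = 0 → q n = fun _ => 0 := by
    intro n hn
    funext ζ
    simp [hq, schmidtWeight, hn]
  have hdm : ∀ f : FockSpace α w, Measurable (fockDensity α (entireRep f)) := fun f =>
    measurable_fockDensity α (continuous_entireRep f)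
  have hqm : ∀ n, Measurable (q n) := by
    intro n
    by_cases hn : s n = 0
    · rw [hq0 n hn]; exact measurable_const
    · rw [hqeq n hn]; exact ((hdm _).add (hdm _)).const_mul _
  have hpt : ∀ n, (h (t * s n) : ℝ≥0∞) ≤ ∫⁻ ζ, q n ζ * Ψ ζ ∂ν := by
    intro n
    by_cases hn : s n = 0
    · simp [hn, hh.map_zero]
    have hen : ‖e n‖ = 1 := he.1 ⟨n, hn⟩
    have hσn : ‖σ n‖ = 1 := hσ.1 ⟨n, hn⟩
    set P := ν.withDensity (q n) with hP
    have hP1 : P univ ≤ 1 := by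
      rw [hP, withDensity_apply _ MeasurableSet.univ, Measure.restrict_univ, hqeq n hn,
        lintegral_const_mul' _ _ (by simp), lintegral_add_left (hdm _), ← ofReal_norm_sq,
        ← ofReal_norm_sq, hen, hσn, one_pow, ENNReal.ofReal_one, ← two_mul, mul_one,
        ENNReal.inv_mul_cancel (by simp) (by simp)]
    have h1 : (s n : ℝ≥0∞) ≤ C₂ * ∫⁻ ζ, average w (r / 2) μ ζ * q n ζ ∂ν := by
      have h2 := enorm_inner_toeplitz_le hC₀ (σ n) (e n)
      rw [inner_apply_eq_of_hasSum he hσ hsum hn, ← ofReal_norm, Complex.norm_real,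
        Real.norm_of_nonneg (s n).coe_nonneg, ENNReal.ofReal_coe_nnreal] at h2
      have h3 := h2.trans (add_le_add (H₂ μ (σ n)) (H₂ μ (e n)))
      have h4 : (s n : ℝ≥0∞) = 2⁻¹ * (2 * s n) := by
        rw [← mul_assoc, ENNReal.inv_mul_cancel (by simp) (by simp), one_mul]
      rw [h4]
      refine (mul_le_mul_right h3 _).trans_eq ?_
      rw [hqeq n hn, ← mul_add, ← lintegral_add_left
        (f := fun ζ => average w (r / 2) μ ζ * fockDensity α (entireRep (σ n)) ζ)
        (havm.mul (hdm _)), mul_left_comm,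
        ← lintegral_const_mul' _ _ (by simp)]
      congr 1
      refine lintegral_congr fun ζ => ?_
      ring
    calc (h (t * s n) : ℝ≥0∞) = extendTop h (t * s n) := by
          rw [← ENNReal.coe_mul, extendTop_coe]
      _ ≤ extendTop h (∫⁻ ζ, (t * (C₂ + 1) : ℝ≥0) * average w (r / 2) μ ζ ∂P) := by
          refine hh.monotone_extendTop ?_
          rw [lintegral_const_mul _ havm, hP,
            lintegral_withDensity_eq_lintegral_mul _ (hqm n) havm, ENNReal.coe_mul, mul_assoc]
          refine mul_le_mul_right (h1.trans ?_) _
          simp only [Pi.mul_apply, mul_comm (q n _)]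
          gcongr
          simp
      _ ≤ ∫⁻ ζ, Ψ ζ ∂P := hh.extendTop_lintegral_le hP1 _
      _ = _ := by
          rw [hP, lintegral_withDensity_eq_lintegral_mul _ (hqm n) hΨm]
          rfl
  have hqsum : ∀ ζ, ∑' n, q n ζ ≤ D * (ν (Metric.ball ζ 1))⁻¹ := by
    intro ζ
    rw [hq, ENNReal.tsum_mul_right]
    refine (mul_le_mul_left (tsum_schmidtWeight_le he hσ _) _).trans ((le_of_eq ?_).trans (hD ζ))
    rw [enorm_sq_eq_ofReal, ← ENNReal.ofReal_mul (by positivity)]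
  calc singularSum h T t ≤ ∑' n, ∫⁻ ζ, q n ζ * Ψ ζ ∂ν := ENNReal.tsum_le_tsum hpt
    _ = ∫⁻ ζ, (∑' n, q n ζ) * Ψ ζ ∂ν := by
        rw [← lintegral_tsum (f := fun n ζ => q n ζ * Ψ ζ)
          fun n => ((hqm n).mul hΨm).aemeasurable]
        exact lintegral_congr fun ζ => ENNReal.tsum_mul_right
    _ ≤ ∫⁻ ζ, D * (Ψ ζ * (ν (Metric.ball ζ 1))⁻¹) ∂ν := by
        refine lintegral_mono fun ζ => (mul_le_mul_left (hqsum ζ) _).trans_eq ?_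
        ring
    _ = D * ∫⁻ ζ, Ψ ζ * (ν (Metric.ball ζ 1))⁻¹ ∂ν := lintegral_const_mul' _ _ (by simp)
    _ ≤ D * (C₁ * modularIntegral h (average w r μ) (t * (C₂ + 1) * K₁)) := by
        gcongr _ * ?_
        exact H₁ μ h hh _
    _ = _ := by rw [ENNReal.coe_mul]; ring_nf

end

variable {α : ℝ} {w : ℂ → ℝ}

/-- A bounded Toeplitz operator has a Carleson measure as its symbol. -/
lemma IsToeplitz.exists_carlesonBound [Admissible α w] {δ : ℝ} (hδ0 : 0 < δ) (hδ1 : δ ≤ 1)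
    (hδ : KernelLowerBound α w δ) {μ : Measure ℂ} {T : FockSpace α w →L[ℂ] FockSpace α w}
    (hT : IsToeplitz μ T) : IsLocallyFiniteMeasure μ ∧
      ∃ (C : ℝ≥0) (hC : CarlesonBound α w μ C), T = toeplitz hC := by
  -- The Berezin transform is at most ‖T‖, so the averages are bounded and μ is Carleson; T then
  -- agrees with J*J because the integral formula determines it.
  obtain ⟨K, -, hK⟩ := hδ.exists_average_le_berezin α w hδ1 hδ0 le_rfl
  have h1 : ∀ z, average w δ μ z ≤ (K * ‖T‖₊ : ℝ≥0) := fun z => by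
    rw [ENNReal.coe_mul]
    exact (hK μ z).trans (mul_le_mul_right (hT.berezin_le z) _)
  have hloc := isLocallyFiniteMeasure_of_average_le (α := α) (w := w) hδ0 fun z =>
    ne_top_of_le_ne_top ENNReal.coe_ne_top (h1 z)
  obtain ⟨C, hC⟩ := exists_carlesonBound_of_average_le α w hδ0 hδ1
  exact ⟨hloc, _, hC μ _ h1, hT.unique (isToeplitz_toeplitz _)⟩

/-- Membership in the Schatten class from the average function. -/
lemma exists_isToeplitz_memSchattenClass [Admissible α w] {r : ℝ} (hr : 0 < r) (hr1 : r ≤ 1)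
    {μ : Measure ℂ} {h : ℝ≥0 → ℝ≥0} (hh : IsGauge h) {C : ℝ≥0} (hC0 : 0 < C)
    (hfin : modularIntegral h (average w r μ) C < ∞) :
    ∃ T : FockSpace α w →L[ℂ] FockSpace α w, IsToeplitz μ T ∧ MemSchattenClass h T := by
  have hloc := isLocallyFiniteMeasure_of_modularIntegral (α := α) (w := w) hr hC0 hfin.ne
  obtain ⟨K, hK1, hK⟩ := exists_average_le α w hr
  have hK0 : 0 < K := one_pos.trans_le hK1
  obtain ⟨⟨S, hS⟩, hvan⟩ := average_bounded_and_vanishing (w := w) hh hr hr1 hK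
    (t := C / K) (by positivity) (by rw [div_mul_cancel₀ _ hK0.ne']; exact hfin.ne)
  obtain ⟨C₁, hC₁⟩ := exists_carlesonBound_of_average_le α w (half_pos hr) (by linarith)
  have hcar := hC₁ μ S hS
  have hcpt := isCompactOperator_toeplitz hcar (half_pos hr) (by linarith) hvan
  refine ⟨toeplitz hcar, isToeplitz_toeplitz hcar, hcpt, ?_⟩
  obtain ⟨C₂, K₂, hK₂, H⟩ := exists_singularSum_le_modularIntegral_average α w hr hr1
  have hK₂0 : 0 < K₂ := one_pos.trans_le hK₂
  refine ⟨C / K₂, by positivity, (H μ _ hcar hcpt h hh _).trans_lt ?_⟩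
  rw [div_mul_cancel₀ _ hK₂0.ne']
  exact ENNReal.mul_lt_top (by simp) hfin

/-- The characterization of Toeplitz operators in the Schatten classes. -/
lemma tfae_memSchattenClass [Admissible α w] {δ : ℝ} (hδ01 : δ ∈ Ioo (0 : ℝ) 1)
    (hδ : KernelLowerBound α w δ) (μ : Measure ℂ) {h : ℝ≥0 → ℝ≥0} (hh : IsGauge h) :
    List.TFAE [
      ∃ T : FockSpace α w →L[ℂ] FockSpace α w, IsToeplitz μ T ∧ MemSchattenClass h T,
      ∃ C : ℝ≥0, 0 < C ∧ modularIntegral h (berezin α w μ) C < ∞,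
      ∃ r ∈ Ioo (0 : ℝ) δ, ∃ C : ℝ≥0, 0 < C ∧ modularIntegral h (average w r μ) C < ∞,
      ∀ r ∈ Ioo (0 : ℝ) δ, ∃ C : ℝ≥0, 0 < C ∧ modularIntegral h (average w r μ) C < ∞] := by
  tfae_have 1 → 2 := by
    rintro ⟨T, hT, hcpt, C, hC, hfin⟩
    obtain ⟨-, C₀, hC₀, hTeq⟩ := hT.exists_carlesonBound hδ01.1 hδ01.2.le hδ
    obtain ⟨K, hK⟩ := exists_modularIntegral_berezin_le_singularSum α w
    refine ⟨C, hC, (hK μ h hh T hT (isSingularValueSeq_singularValues hcpt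
      (hTeq ▸ isPositive_toeplitz hC₀)) C).trans_lt (ENNReal.mul_lt_top (by simp) hfin)⟩
  tfae_have 2 → 4 := by
    rintro ⟨C, hC, hfin⟩ r hr
    obtain ⟨K, hK1, hK⟩ := hδ.exists_average_le_berezin α w hδ01.2.le hr.1 hr.2.le
    have hK0 : 0 < K := one_pos.trans_le hK1
    refine ⟨C / K, by positivity, (hh.modularIntegral_mono fun z => ?_).trans_lt hfin⟩
    refine (mul_le_mul_right (hK μ z) _).trans_eq ?_
    rw [← mul_assoc, ← ENNReal.coe_mul, div_mul_cancel₀ _ hK0.ne']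
  tfae_have 4 → 3 := fun h4 => ⟨δ / 2, ⟨half_pos hδ01.1, half_lt_self hδ01.1⟩,
    h4 _ ⟨half_pos hδ01.1, half_lt_self hδ01.1⟩⟩
  tfae_have 3 → 1 := by
    rintro ⟨r, hr, C, hC, hfin⟩
    exact exists_isToeplitz_memSchattenClass hr.1 (hr.2.trans hδ01.2).le hh hC hfin
  tfae_finish

end WeightedFock


namespace WeightedFock

/-! ### Comparability of the three modulars -/

section Modular

variable {h : ℝ≥0 → ℝ≥0}

lemma IsGauge.modularIntegral_monotone (hh : IsGauge h) (g : ℂ → ℝ≥0∞) :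
    Monotone (modularIntegral h g) := fun _ _ hle =>
  hh.modularIntegral_mono fun _ => mul_le_mul_left (ENNReal.coe_le_coe.2 hle) _

lemma IsGauge.singularSum_monotone (hh : IsGauge h) {H : Type*} [NormedAddCommGroup H]
    [InnerProductSpace ℂ H] (T : H →L[ℂ] H) : Monotone (singularSum h T) := fun _ _ hle =>
  ENNReal.tsum_le_tsum fun _ => ENNReal.coe_le_coe.2 (hh.strictMono.monotone
    (mul_le_mul_left hle _))

/-- A modular integral is a continuous function of the multiplier as long as it is finite. -/
lemma IsGauge.continuousOn_modularIntegral (hh : IsGauge h) {g : ℂ → ℝ≥0∞} (hg : Measurable g)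
    {M : ℝ≥0} (hM : 0 < M) (hfin : modularIntegral h g M ≠ ∞) :
    ContinuousOn (modularIntegral h g) (Iic M) := by
  intro t ht
  have hm : ∀ s : ℝ≥0, Measurable fun z => extendTop h (s * g z) := fun s =>
    hh.measurable_extendTop.comp (hg.const_mul _)
  refine tendsto_lintegral_filter_of_dominated_convergence (fun z => extendTop h (M * g z))
    (Eventually.of_forall hm) ?_ hfin ?_
  · filter_upwards [self_mem_nhdsWithin] with s hs
    exact Eventually.of_forall fun z =>
      hh.monotone_extendTop (mul_le_mul_left (ENNReal.coe_le_coe.2 hs) _)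
  -- Finiteness at M > 0 excludes g = ∞ almost everywhere; at such points continuity in the
  -- multiplier would fail at 0.
  · filter_upwards [ae_lt_top (hm M) hfin] with z hz
    have hgz : g z ≠ ∞ := by
      intro hgz
      rw [hgz, ENNReal.mul_top (by simpa using hM.ne'), extendTop_top] at hz
      exact lt_irrefl _ hz
    lift g z to ℝ≥0 using hgz with y
    simp only [← ENNReal.coe_mul, extendTop_coe]
    refine ENNReal.tendsto_coe.2 (Tendsto.mono_left ?_ nhdsWithin_le_nhds)
    exact (hh.continuous.comp (continuous_id.mul continuous_const)).tendsto t

/-- Either the left endpoint already works, or K·G passes from below x at a to above x at b and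
takes the value x in between. -/
lemma exists_mem_Icc_comparable {G : ℝ≥0 → ℝ≥0∞} {K a b : ℝ≥0} (hK : 1 ≤ K) (hab : a ≤ b)
    (hG : ContinuousOn G (Icc a b)) {x : ℝ≥0∞} (ha : G a ≤ K * x) (hb : x ≤ K * G b) :
    ∃ t ∈ Icc a b, x ≤ K * G t ∧ G t ≤ K * x := by
  by_cases hx : x ≤ K * G a
  · exact ⟨a, left_mem_Icc.2 hab, hx, ha⟩
  have hcont : ContinuousOn (fun t => (K : ℝ≥0∞) * G t) (Icc a b) :=
    (ENNReal.continuous_const_mul ENNReal.coe_ne_top).comp_continuousOn hG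
  obtain ⟨t, ht, hteq⟩ := intermediate_value_Icc hab hcont ⟨(not_le.1 hx).le, hb⟩
  have hK' : (1 : ℝ≥0∞) ≤ K := by exact_mod_cast hK
  refine ⟨t, ht, hteq.ge, ?_⟩
  calc G t = 1 * G t := (one_mul _).symm
    _ ≤ K * G t := mul_le_mul_left hK' _
    _ = 1 * x := by rw [one_mul]; exact hteq
    _ ≤ K * x := mul_le_mul_left hK' _

end Modular

variable (α : ℝ) (w : ℂ → ℝ)

/-- One-sided comparison of the modulars with dilated arguments. -/
lemma exists_modular_le [Admissible α w] {δ : ℝ} (hδ01 : δ ∈ Ioo (0 : ℝ) 1)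
    (hδ : KernelLowerBound α w δ) {r : ℝ} (hr : r ∈ Ioo 0 δ) : ∃ K : ℝ≥0, 1 ≤ K ∧
      ∀ (μ : Measure ℂ) [SFinite μ] (C₀ : ℝ≥0) (hC₀ : CarlesonBound α w μ C₀),
        IsCompactOperator (toeplitz hC₀) → ∀ h : ℝ≥0 → ℝ≥0, IsGauge h → ∀ t : ℝ≥0,
        singularSum h (toeplitz hC₀) t ≤ K * modularIntegral h (berezin α w μ) (K * t) ∧
        modularIntegral h (berezin α w μ) t ≤ K * singularSum h (toeplitz hC₀) t ∧
        modularIntegral h (berezin α w μ) t ≤ K * modularIntegral h (average w r μ) (K * t) ∧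
        modularIntegral h (average w r μ) t ≤ modularIntegral h (berezin α w μ) (K * t) := by
  have hr1 : r ≤ 1 := (hr.2.trans hδ01.2).le
  obtain ⟨C₁, H₁⟩ := exists_modularIntegral_berezin_le_singularSum α w
  obtain ⟨C₂, K₂, hK₂, H₂⟩ := exists_singularSum_le_modularIntegral_average α w hr.1 hr1
  obtain ⟨K₃, hK₃, H₃⟩ := hδ.exists_average_le_berezin α w hδ01.2.le hr.1 hr.2.le
  obtain ⟨C₄, K₄, hK₄, H₄⟩ := exists_modularIntegral_berezin_le α w hr.1 hr1
  set K := C₁ + C₂ + C₄ + K₃ + K₄ + K₂ * K₃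
  have hK₃K : K₃ ≤ K := by
    refine le_trans ?_ (le_trans (le_add_right le_rfl) (le_add_right (le_refl (C₁ + C₂ + C₄ + K₃ + K₄))))
    exact le_add_self
  have hC₁ : (C₁ : ℝ≥0∞) ≤ K := by
    exact_mod_cast show C₁ ≤ K by simp only [K, add_assoc]; exact le_self_add
  have hC₂ : (C₂ : ℝ≥0∞) ≤ K := by
    exact_mod_cast show C₂ ≤ K by
      simp only [K]; rw [← NNReal.coe_le_coe]; push_cast
      have : (0 : ℝ) ≤ K₂ * K₃ := by positivity
      linarith [C₁.coe_nonneg, C₂.coe_nonneg, C₄.coe_nonneg, K₃.coe_nonneg, K₄.coe_nonneg]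
  have hC₄ : (C₄ : ℝ≥0∞) ≤ K := by
    exact_mod_cast show C₄ ≤ K by
      simp only [K]; rw [← NNReal.coe_le_coe]; push_cast
      have : (0 : ℝ) ≤ K₂ * K₃ := by positivity
      linarith [C₁.coe_nonneg, C₂.coe_nonneg, C₄.coe_nonneg, K₃.coe_nonneg, K₄.coe_nonneg]
  have hK₄K : K₄ ≤ K := by
    simp only [K]; rw [← NNReal.coe_le_coe]; push_cast
    have : (0 : ℝ) ≤ K₂ * K₃ := by positivity
    linarith [C₁.coe_nonneg, C₂.coe_nonneg, C₄.coe_nonneg, K₃.coe_nonneg, K₄.coe_nonneg]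
  have hK₂₃ : K₂ * K₃ ≤ K := le_add_self
  have H₃' : ∀ (μ : Measure ℂ) (h : ℝ≥0 → ℝ≥0), IsGauge h → ∀ t : ℝ≥0,
      modularIntegral h (average w r μ) t ≤ modularIntegral h (berezin α w μ) (K₃ * t) :=
    fun μ h hh t => hh.modularIntegral_mono fun z => by
      refine (mul_le_mul_right (H₃ μ z) _).trans_eq ?_
      rw [← mul_assoc, ENNReal.coe_mul, mul_comm (t : ℝ≥0∞)]
  refine ⟨K, hK₃.trans hK₃K, fun μ _ C₀ hC₀ hcpt h hh t => ⟨?_, ?_, ?_, ?_⟩⟩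
  · refine (H₂ μ C₀ hC₀ hcpt h hh t).trans (mul_le_mul' hC₂ ?_)
    refine (H₃' μ h hh _).trans (hh.modularIntegral_monotone _ ?_)
    calc K₃ * (t * K₂) = K₂ * K₃ * t := by ring
      _ ≤ K * t := mul_le_mul_left hK₂₃ _
  · exact (H₁ μ h hh _ (isToeplitz_toeplitz hC₀) (isSingularValueSeq_singularValues hcpt
      (isPositive_toeplitz hC₀)) t).trans (mul_le_mul_left hC₁ _)
  · refine (H₄ μ h hh t).trans (mul_le_mul' hC₄ (hh.modularIntegral_monotone _ ?_))
    rw [mul_comm]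
    exact mul_le_mul_left hK₄K _
  · exact (H₃' μ h hh t).trans (hh.modularIntegral_monotone _ (mul_le_mul_left hK₃K _))

/-- Comparability of the singular sums, the Berezin transform and the average function. -/
lemma exists_comparable_modulars [Admissible α w] {δ : ℝ} (hδ01 : δ ∈ Ioo (0 : ℝ) 1)
    (hδ : KernelLowerBound α w δ) {r : ℝ} (hr : r ∈ Ioo 0 δ) : ∃ K : ℝ≥0, 1 ≤ K ∧
      ∀ (μ : Measure ℂ) (h : ℝ≥0 → ℝ≥0), IsGauge h →
      ∀ T : FockSpace α w →L[ℂ] FockSpace α w, IsToeplitz μ T → IsCompactOperator T →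
        ∃ C₁ C₂ C₃ : ℝ≥0, 0 < C₁ ∧ 0 < C₂ ∧ 0 < C₃ ∧
          C₁ ≤ K * C₂ ∧ C₂ ≤ K * C₁ ∧ C₂ ≤ K * C₃ ∧ C₃ ≤ K * C₂ ∧
          Comparable K (singularSum h T C₁) (modularIntegral h (berezin α w μ) C₂) ∧
          Comparable K (modularIntegral h (berezin α w μ) C₂)
            (modularIntegral h (average w r μ) C₃) ∧
          (MemSchattenClass h T → singularSum h T C₁ < ∞) := by
  obtain ⟨K, hK, H⟩ := exists_modular_le α w hδ01 hδ hr
  have hK0 : 0 < K := one_pos.trans_le hK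
  have hKe : (K : ℝ≥0∞) ≠ ∞ := ENNReal.coe_ne_top
  have hK0e : (K : ℝ≥0∞) ≠ 0 := by simpa using hK0.ne'
  have hK1e : (1 : ℝ≥0∞) ≤ K := by exact_mod_cast hK
  refine ⟨K, hK, fun μ h hh T hT hcpt => ?_⟩
  obtain ⟨hloc, C₀, hC₀, rfl⟩ := hT.exists_carlesonBound hδ01.1 hδ01.2.le hδ
  replace H := H μ C₀ hC₀ hcpt h hh
  set S := singularSum h (toeplitz hC₀) with hS
  set B := modularIntegral h (berezin α w μ) with hB
  set A := modularIntegral h (average w r μ) with hA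
  have hSm : Monotone S := hh.singularSum_monotone _
  have hBm : Monotone B := hh.modularIntegral_monotone _
  have hAm : Monotone A := hh.modularIntegral_monotone _
  by_cases hfin : ∃ t, 0 < t ∧ B t ≠ ∞
  -- Start at C₁ = t₀/K³. Then C₂ ≤ K C₁ and C₃ ≤ K C₂ ≤ K² C₁, and the average modular at K² C₁ is
  -- at most the Berezin modular at t₀. Everything thus stays in the range of finiteness, hence of
  -- continuity.
  · obtain ⟨t₀, ht₀, hBt₀⟩ := hfin
    set t₁ := t₀ / K ^ 3 with ht₁def
    have ht₁ : 0 < t₁ := by positivity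
    have hKt₁ : K * (K * (K * t₁)) = t₀ := by
      rw [ht₁def]; field_simp
    have hdiv : ∀ t : ℝ≥0, t / K ≤ t := fun t => div_le_self zero_le hK
    have hmul : ∀ t : ℝ≥0, t ≤ K * t := fun t => le_mul_of_one_le_left zero_le hK
    have hcan : ∀ t : ℝ≥0, K * (t / K) = t := fun t => mul_div_cancel₀ _ hK0.ne'
    have hBc : ContinuousOn B (Iic t₀) :=
      hh.continuousOn_modularIntegral (measurable_berezin α w μ) ht₀ hBt₀
    have hAc : ContinuousOn A (Iic (K * (K * t₁))) :=
      hh.continuousOn_modularIntegral (measurable_average α w r μ) (by positivity)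
        (ne_top_of_le_ne_top hBt₀ (((H _).2.2.2).trans_eq (by rw [hKt₁])))
    obtain ⟨t₂, ht₂, h1, h2⟩ := exists_mem_Icc_comparable hK ((hdiv t₁).trans (hmul t₁))
      (hBc.mono fun x hx => hx.2.trans (by rw [← hKt₁]; exact (hmul _).trans (hmul _)))
      (((H (t₁ / K)).2.1).trans (mul_le_mul_right (hSm (hdiv t₁)) _)) (H t₁).1
    have ht₂0 : 0 < t₂ := (show 0 < t₁ / K by positivity).trans_le ht₂.1
    obtain ⟨t₃, ht₃, h3, h4⟩ := exists_mem_Icc_comparable (x := B t₂) hK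
      ((hdiv t₂).trans (hmul t₂))
      (hAc.mono fun x hx => hx.2.trans (mul_le_mul_right ht₂.2 _))
      (((H (t₂ / K)).2.2.2).trans (by
        rw [hcan]
        calc B t₂ = 1 * B t₂ := (one_mul _).symm
          _ ≤ K * B t₂ := mul_le_mul_left hK1e _)) (H t₂).2.2.1
    have ht₃0 : 0 < t₃ := (show 0 < t₂ / K by positivity).trans_le ht₃.1
    have hflip : ∀ {a b : ℝ≥0}, a / K ≤ b → a ≤ K * b := fun {a b} hab => by
      rw [← hcan a]; exact mul_le_mul_right hab _
    refine ⟨t₁, t₂, t₃, ht₁, ht₂0, ht₃0, hflip ht₂.1, ht₂.2, hflip ht₃.1, ht₃.2, ⟨h1, h2⟩,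
      ⟨h3, h4⟩, fun _ => ?_⟩
    refine ((H t₁).1).trans_lt (ENNReal.mul_lt_top (lt_top_iff_ne_top.2 hKe) ?_)
    refine (hBm ?_).trans_lt (lt_top_iff_ne_top.2 hBt₀)
    rw [← hKt₁]
    exact (hmul _).trans (hmul _)
  -- The Berezin modular is ∞ for every multiplier; the one-sided bounds make the other two infinite
  -- as well, and T is not in the Schatten class.
  · push Not at hfin
    have hS1 : ∀ t, 0 < t → S t = ∞ := fun t ht => by
      have := (H t).2.1
      rw [hfin t ht, top_le_iff] at this
      by_contra hne
      exact ENNReal.mul_ne_top hKe hne this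
    have hA1 : A 1 = ∞ := by
      have := (H (1 / K)).2.2.1
      rw [hfin _ (by positivity), top_le_iff, mul_div_cancel₀ _ hK0.ne'] at this
      by_contra hne
      exact ENNReal.mul_ne_top hKe hne this
    refine ⟨1, 1, 1, one_pos, one_pos, one_pos, by simpa, by simpa, by simpa, by simpa, ?_, ?_, ?_⟩
    · rw [hS1 1 one_pos, hfin 1 one_pos]
      simp [Comparable, ENNReal.mul_top hK0e]
    · rw [hA1, hfin 1 one_pos]
      simp [Comparable, ENNReal.mul_top hK0e]
    · rintro ⟨-, C, hC, hlt⟩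
      exact absurd (hS1 C hC) hlt.ne

end WeightedFock

theorem theorem5p1 (α : ℝ) (hα : 0 < α) (w : ℂ → ℝ) (hw : WeightedFock.IsWeight w)
    (hA : WeightedFock.IsRestrictedAInfty w) :
    -- the constant `δ` exists, and depends on `α` and `w` only
    (∃ δ ∈ Ioo (0 : ℝ) 1, WeightedFock.KernelLowerBound α w δ) ∧
    ∀ δ ∈ Ioo (0 : ℝ) 1, WeightedFock.KernelLowerBound α w δ →
      -- the equivalence of the conditions, the last one both for some and for any radius
      (∀ (μ : Measure ℂ) (h : ℝ≥0 → ℝ≥0), WeightedFock.IsGauge h →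
        List.TFAE [
          ∃ T : WeightedFock.FockSpace α w →L[ℂ] WeightedFock.FockSpace α w,
            WeightedFock.IsToeplitz μ T ∧ WeightedFock.MemSchattenClass h T,
          ∃ C : ℝ≥0, 0 < C ∧
            WeightedFock.modularIntegral h (WeightedFock.berezin α w μ) C < ∞,
          ∃ r ∈ Ioo (0 : ℝ) δ, ∃ C : ℝ≥0, 0 < C ∧
            WeightedFock.modularIntegral h (WeightedFock.average w r μ) C < ∞,
          ∀ r ∈ Ioo (0 : ℝ) δ, ∃ C : ℝ≥0, 0 < C ∧
            WeightedFock.modularIntegral h (WeightedFock.average w r μ) C < ∞]) ∧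
      -- the comparability, with `K` independent of `μ` and `h`
      (∀ r ∈ Ioo (0 : ℝ) δ, ∃ K : ℝ≥0, 1 ≤ K ∧
        ∀ (μ : Measure ℂ) (h : ℝ≥0 → ℝ≥0), WeightedFock.IsGauge h →
        ∀ T : WeightedFock.FockSpace α w →L[ℂ] WeightedFock.FockSpace α w,
          WeightedFock.IsToeplitz μ T → IsCompactOperator T →
          ∃ C₁ C₂ C₃ : ℝ≥0, 0 < C₁ ∧ 0 < C₂ ∧ 0 < C₃ ∧
            C₁ ≤ K * C₂ ∧ C₂ ≤ K * C₁ ∧ C₂ ≤ K * C₃ ∧ C₃ ≤ K * C₂ ∧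
            WeightedFock.Comparable K (WeightedFock.singularSum h T C₁)
              (WeightedFock.modularIntegral h (WeightedFock.berezin α w μ) C₂) ∧
            WeightedFock.Comparable K
              (WeightedFock.modularIntegral h (WeightedFock.berezin α w μ) C₂)
              (WeightedFock.modularIntegral h (WeightedFock.average w r μ) C₃) ∧
            (WeightedFock.MemSchattenClass h T → WeightedFock.singularSum h T C₁ < ∞)) := by
  have : WeightedFock.Admissible α w := ⟨hα, hw, hw.locallyDoubling hA⟩
  exact ⟨WeightedFock.exists_kernelLowerBound α w, fun δ hδ01 hδ =>
    ⟨fun μ _ hh => WeightedFock.tfae_memSchattenClass hδ01 hδ μ hh, fun _ hr =>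
      WeightedFock.exists_comparable_modulars α w hδ01 hδ hr⟩⟩
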